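/- Let $\mathbb D$ be the open unit disc, $L=\{\xi\in\partial\mathbb D:\operatorname{Im}\xi\le 0\}$ the closed lower semicircle and $U=\{\xi\in\partial\mathbb D:\operatorname{Im}\xi\ge 0\}$ the closed upper semicircle. Let $A(\mathbb D)$ be the algebra of continuous functions on $\overline{\mathbb D}$ that are holomorphic on $\mathbb D$, and let $A^{\alpha}(\mathbb D)$, $0<\alpha<1$, be the algebra of those functions in $A(\mathbb D)$ that are Hölder continuous with exponent $\alpha$ on $\overline{\mathbb D}$. Let $k\ge 3$ and let $\{\gamma_\xi\}_{\xi\in U}$ be a $C^k$ family of Jordan curves in $\mathbb C$, that is, there is a real function $\rho\in C^k(U\times\mathbb C)$ such that for every $\xi\in U$ we have $\gamma_\xi=\{w:\rho(\xi,w)=0\}$, $\{w:\rho(\xi,w)<0\}$ is the interior $\operatorname{Int}(\gamma_\xi)$ (the bounded component of $\mathbb C\setminus\gamma_\xi$), and $\frac{\partial\rho}{\partial\overline w}(\xi,w)\ne 0$ for all $w\in\gamma_\xi$. Each $\gamma_\xi$ is oriented positively with respect to its interior, and the real axis has its usual orientation. For $j=\pm1$ let $w_j\in\mathbb R\cap\gamma_j$,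 and let $\beta_j\in(-1,1)\setminus\{0\}$ be such that $\pi\beta_1$ is the angle by which the positive direction of the real axis has to be rotated counterclockwise to give the direction of the positive tangent of $\gamma_1$ at $w_1$, and $\pi\beta_{-1}$ is the angle by which the direction of the positive tangent of $\gamma_{-1}$ at $w_{-1}$ has to be rotated counterclockwise to give the positive direction of the real axis (a negative angle means a clockwise rotation). Put $\delta_j=1-\beta_j$ if $\beta_j>0$ and $\delta_j=|\beta_j|$ if $\beta_j<0$. Let $\Psi\in A^{1/2}(\mathbb D)$ be a biholomorphic map from $\mathbb D$ onto the upper half-disc $\{z\in\mathbb D:\operatorname{Im}z>0\}$ which maps $L$ onto $[-1,1]$ and satisfies $\Psi(\pm1)=\pm1$, and let $\psi=\frac12\Psi(3-\Psi^2)$. For $\xi\in\overline{\mathbb D}$ the powers $(\xi-1)^{\delta_1}$ and $(\xi+1)^{\delta_{-1}}$ are taken with $\arg(\xi-1)\in(\frac\pi2,\frac{3\pi}2)$ and $\arg(\xi+1)\in(-\frac\pi2,\frac\pi2)$, and they are $0$ at $\xi=1$ and $\xi=-1$, respectively. Let $$0<\beta<\min\{|\beta_1|,\,1-|\beta_1|,\,|\beta_{-1}|,\,1-|\beta_{-1}|\}.$$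 Suppose that $f\in A(\mathbb D)$ satisfies $\operatorname{Im}f(\xi)=0$ for $\xi\in L$ and $f(\xi)\in\gamma_\xi$ for $\xi\in U$, and that $$f(\xi)=(\xi-1)^{\delta_1}(\xi+1)^{\delta_{-1}}\kappa(\xi)+w_1\frac{1+\psi(\xi)}2+w_{-1}\frac{1-\psi(\xi)}2\qquad(\xi\in\overline{\mathbb D})$$ for some $\kappa\in A(\mathbb D)$. Then $f\in A^{\beta}(\mathbb D)$ and $\kappa\in A^{\beta}(\mathbb D)$. -/

import Mathlib

open Set Filter Topology Complex

namespace Cherepanov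

/-! Function spaces on the closed unit disc. -/

/-- The disc algebra `A(D)`: continuous on the closed unit disc, holomorphic on the open one. -/
def InDiscAlgebra (f : ℂ → ℂ) : Prop :=
  ContinuousOn f (Metric.closedBall 0 1) ∧ DifferentiableOn ℂ f (Metric.ball 0 1)

/-- `A^α(D)`: functions of the disc algebra that are Hölder continuous with exponent `α`
on the closed unit disc. -/
def InHolderDiscAlgebra (α : ℝ) (f : ℂ → ℂ) : Prop :=
  InDiscAlgebra f ∧ ∃ C : ℝ, ∀ z ∈ Metric.closedBall (0 : ℂ) 1, ∀ w ∈ Metric.closedBall (0 : ℂ) 1,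
    ‖f z - f w‖ ≤ C * ‖z - w‖ ^ α

/-! The two arcs of the unit circle. -/

/-- The closed lower semicircle `L`. -/
def lowerArc : Set ℂ := {ξ | ‖ξ‖ = 1 ∧ ξ.im ≤ 0}

/-- The closed upper semicircle, that is, the unit circle without the relative interior of `L`. -/
def upperArc : Set ℂ := {ξ | ‖ξ‖ = 1 ∧ 0 ≤ ξ.im}

/-! Jordan curves and `C^k` families of them. -/

/-- A Jordan curve: an injective continuous image of the circle. -/
def IsJordanCurve (γ : Set ℂ) : Prop :=
  ∃ c : Circle → ℂ, Continuous c ∧ Function.Injective c ∧ range c = γ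

/-- The interior of a Jordan curve: the bounded component of its complement, given as the set of
the points that lie in a bounded component. -/
def jordanInterior (γ : Set ℂ) : Set ℂ :=
  {w | w ∈ γᶜ ∧ Bornology.IsBounded (connectedComponentIn γᶜ w)}

/-- The Wirtinger derivative `∂g/∂w̄` of a real function on the plane. -/
noncomputable def dbar (g : ℂ → ℝ) (w : ℂ) : ℂ :=
  (((fderiv ℝ g w 1 : ℝ) : ℂ) + I * ((fderiv ℝ g w I : ℝ) : ℂ)) / 2

/-- `ρ` is a defining function of class `C^k` of the family `γ` over the upper semicircle, which is
parametrized by `ξ = e^{iθ}`, `0 ≤ θ ≤ π` (one-sided derivatives at the end points). -/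
structure IsDefiningFunction (k : ℕ) (γ : ℂ → Set ℂ) (ρ : ℂ → ℂ → ℝ) : Prop where
  contDiffOn : ContDiffOn ℝ k (fun p : ℝ × ℂ => ρ (cexp ((p.1 : ℂ) * I)) p.2)
    (Icc 0 Real.pi ×ˢ univ)
  curve_eq : ∀ ξ ∈ upperArc, γ ξ = {w | ρ ξ w = 0}
  interior_eq : ∀ ξ ∈ upperArc, jordanInterior (γ ξ) = {w | ρ ξ w < 0}
  dbar_ne_zero : ∀ ξ ∈ upperArc, ∀ w ∈ γ ξ, dbar (ρ ξ) w ≠ 0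

/-- A `C^k` family of Jordan curves parametrized by the closed upper semicircle. -/
def IsJordanFamily (k : ℕ) (γ : ℂ → Set ℂ) : Prop :=
  (∀ ξ ∈ upperArc, IsJordanCurve (γ ξ)) ∧ ∃ ρ : ℂ → ℂ → ℝ, IsDefiningFunction k γ ρ

/-! Oriented angles. -/

/-- `τ` is a positive tangent vector of the Jordan curve `γ` at `w`: it is a nonzero tangent vector,
and the interior of `γ` lies to the left of it. -/
def IsPositiveTangent (γ : Set ℂ) (w τ : ℂ) : Prop :=
  τ ≠ 0 ∧
  (∃ c : ℝ → ℂ, c 0 = w ∧ (∀ᶠ t in 𝓝 (0 : ℝ), c t ∈ γ) ∧ HasDerivAt c τ 0) ∧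
  ∀ᶠ ε : ℝ in 𝓝[>] (0 : ℝ), w + (ε : ℂ) * (I * τ) ∈ jordanInterior γ

/-- The angle in `(-π, π]` by which `u` has to be rotated counterclockwise to point in the direction
of `v`, for nonzero `u` and `v`. -/
noncomputable def orientedAngle (u v : ℂ) : ℝ := arg (v / u)

/-! The boundary value problem and the special form of its solutions. -/

/-- `f` is a solution, in the disc algebra, of `Im f = 0` on the lower semicircle and `f(ξ) ∈ γ_ξ`
on the upper semicircle. -/
structure IsSolution (γ : ℂ → Set ℂ) (f : ℂ → ℂ) : Prop where
  inDiscAlgebra : InDiscAlgebra f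
  on_lower : ∀ ξ ∈ lowerArc, (f ξ).im = 0
  on_upper : ∀ ξ ∈ upperArc, f ξ ∈ γ ξ

/-- The exponent `δ`: it is `1 - b` for `b > 0` and `|b|` for `b < 0`. -/
noncomputable def delta (b : ℝ) : ℝ := if 0 < b then 1 - b else |b|

/-- `(ξ - 1)^δ` on the closed disc, with the plane cut along the positive reals: the argument of
`ξ - 1` is in `(π/2, 3π/2)`, so it is `π` plus the principal argument of `1 - ξ`. -/
noncomputable def powSubOne (δ : ℝ) (ξ : ℂ) : ℂ :=
  cexp ((Real.pi : ℂ) * I * (δ : ℂ)) * (1 - ξ) ^ (δ : ℂ)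

/-- `(ξ + 1)^δ` on the closed disc, with the principal branch. -/
noncomputable def powAddOne (δ : ℝ) (ξ : ℂ) : ℂ := (ξ + 1) ^ (δ : ℂ)

/-- `Ψ ∈ A^{1/2}(D)` is a biholomorphic map of the unit disc onto the upper half-disc that maps the
lower semicircle onto `[-1, 1]` and fixes `1` and `-1`. (The inverse of a holomorphic bijection is
holomorphic.) -/
structure IsHalfDiscMap (Ψ : ℂ → ℂ) : Prop where
  inHolder : InHolderDiscAlgebra (1 / 2) Ψ
  bijOn : BijOn Ψ (Metric.ball 0 1) {z | ‖z‖ < 1 ∧ 0 < z.im}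
  image_lower : Ψ '' lowerArc = ofReal '' Icc (-1 : ℝ) 1
  map_one : Ψ 1 = 1
  map_neg_one : Ψ (-1) = -1

/-- `ψ = F ∘ Ψ` with `F(x) = x (3 - x²) / 2`. -/
noncomputable def psi (Ψ : ℂ → ℂ) (ξ : ℂ) : ℂ := 1 / 2 * Ψ ξ * (3 - Ψ ξ ^ 2)

end Cherepanov

namespace Cherepanov

/-! Everything reduces to the growth bound |κ'(z)| ≤ C(1-|z|)^(β-1). By Hardy and Littlewood
(`inHolderDiscAlgebra_of_deriv_le`) it gives κ ∈ A^β. Then f inherits the regularity, since the two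
powers have exponents δ_j ≥ β and ψ ∈ A^(1/2) with β < 1/2.

On Re z ≥ 0 the power vanishing at -1 is absorbed into κ, so f = E + (1-ξ)^δ κ with E the
interpolating function; reflection in the imaginary axis treats the other corner. Write (1-e^{iθ})^δ
= m·u with m ~ θ^δ and |u| = 1, and divide the equation of the curves by m. Three facts make the
quotient manageable. The choice of δ makes u(0)² = e^{-iπδ} tangent to the curve at the corner, so
the conditions on the two arcs degenerate there to the same condition Im(ū(0)κ) = 0. The polynomial
x(3-x²)/2 is critical at ±1, which compensates the exponent 1/2 of Ψ and makes E Lipschitz at the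
corner. Finally β ≤ min(δ, 1-δ), so the errors θ^(2δ) and θ are both O(θ^(δ+β)). The outcome is
|Im(ū(0)κ)| ≤ C|θ|^β on the circle (`CornerBounds.abs_im_le`).

Boundary bounds for a real part enter the disc through the barrier (1 - ξ̄₀z)^α, whose real part is
comparable to |z-ξ₀|^α for α ≤ 1/2. Borel–Carathéodory on the ball of radius d = 1-|z| then bounds
the derivative at z. With ξ₀ = 1 this settles the nontangential region |z-1| ≤ 2d.

In the remaining region let ξ₀ be the radial projection of z, at angular distance θ₀ > d from the
corner. Linearizing the condition at the value κ(z) leaves an error θ₀^(β-1/2)|ξ-ξ₀|^(1/2) + k|h|²,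
where h is κ(ξ)-κ(z) times a unimodular constant. Only continuity of κ is known, so the quadratic
error is not small enough to be dropped. It is absorbed by passing from ±h to ±h + 4kh²
(`re_quadratic_le`), which has the same derivative at z up to sign because h vanishes there. The
result is |κ'(z)| ≤ Cθ₀^(β-1/2)d^(-1/2) ≤ Cd^(β-1). -/

/-! ### Derivative bounds from boundary bounds of a real part -/

theorem norm_deriv_le_of_re_le {q : ℂ → ℂ} {z : ℂ} {d B : ℝ} (hd : 0 < d) (hB : 0 < B)
    (hq : DifferentiableOn ℂ q (Metric.ball z d))
    (h : ∀ x ∈ Metric.ball z d, (q x).re ≤ B + (q z).re) : ‖deriv q z‖ ≤ 2 * B / d := by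
  have hz : DifferentiableAt ℂ q z := hq.differentiableAt (Metric.ball_mem_nhds z hd)
  -- Borel–Carathéodory for q - q(z), translated to the origin; dividing by |x-z| and letting x → z
  -- gives the derivative bound.
  have key : ∀ x ∈ Metric.ball z d, ‖q x - q z‖ ≤ 2 * B * ‖x - z‖ / (d - ‖x - z‖) := by
    intro x hx
    have hmaps : ∀ w ∈ Metric.ball (0 : ℂ) d, z + w ∈ Metric.ball z d := by
      intro w hw; simpa [Metric.mem_ball, dist_eq_norm] using hw
    have := borelCaratheodory_zero (f := fun w => q (z + w) - q z) (M := B) (R := d) (z := x - z) hB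
      ((hq.comp (by fun_prop) hmaps).sub_const _)
      (by
        intro w hw
        have := h _ (hmaps w hw)
        simp only [Set.mem_ofPred_eq, sub_re]; linarith)
      hd (by simpa [Metric.mem_ball, dist_eq_norm] using hx) (by simp)
    simpa using this
  have h1 : Tendsto (fun x => ‖slope q z x‖) (𝓝[≠] z) (𝓝 ‖deriv q z‖) :=
    (hasDerivAt_iff_tendsto_slope.1 hz.hasDerivAt).norm
  have h2 : Tendsto (fun x => 2 * B / (d - ‖x - z‖)) (𝓝[≠] z) (𝓝 (2 * B / d)) := by
    have : ContinuousAt (fun x : ℂ => 2 * B / (d - ‖x - z‖)) z := by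
      apply ContinuousAt.div (by fun_prop) (by fun_prop); simp [hd.ne']
    simpa using this.tendsto.mono_left nhdsWithin_le_nhds
  refine le_of_tendsto_of_tendsto h1 h2 ?_
  have : ∀ᶠ x in 𝓝[≠] z, x ∈ Metric.ball z d :=
    nhdsWithin_le_nhds (Metric.ball_mem_nhds z hd)
  filter_upwards [this, self_mem_nhdsWithin] with x hx hne
  have hx' : 0 < ‖x - z‖ := norm_pos_iff.2 (sub_ne_zero.2 hne)
  rw [slope_def_field, norm_div, div_le_iff₀ hx']
  calc _ ≤ _ := key x hx
    _ = _ := by ring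

theorem slitPlane_or_eq_zero {c z : ℂ} (hc : ‖c‖ = 1) (hz : ‖z‖ ≤ 1) :
    1 - c * z ∈ slitPlane ∨ 1 - c * z = 0 := by
  have hn : ‖c * z‖ ≤ 1 := by rw [norm_mul, hc, one_mul]; exact hz
  have hre := (abs_le.1 ((abs_re_le_norm (c * z)).trans hn)).2
  rcases hre.lt_or_eq with h | h
  · left; left; simp at h ⊢; linarith
  · right
    have : (c * z).im = 0 := by
      have h2 : ‖c * z‖ ^ 2 ≤ 1 := pow_le_one₀ (norm_nonneg _) hn
      rw [Complex.sq_norm, normSq_apply, h] at h2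
      nlinarith [mul_self_nonneg (c * z).im, mul_self_eq_zero (a := (c * z).im)]
    apply Complex.ext <;> simp at h this ⊢ <;> linarith

theorem re_one_sub_mul_nonneg {c z : ℂ} (hc : ‖c‖ = 1) (hz : ‖z‖ ≤ 1) : 0 ≤ (1 - c * z).re := by
  have hn : ‖c * z‖ ≤ 1 := by rw [norm_mul, hc, one_mul]; exact hz
  have hre := (abs_le.1 ((abs_re_le_norm (c * z)).trans hn)).2
  simp at hre ⊢; linarith

theorem one_sub_mul_mem_slitPlane {c z : ℂ} (hc : ‖c‖ = 1) (hz : ‖z‖ < 1) :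
    1 - c * z ∈ slitPlane := by
  rcases slitPlane_or_eq_zero hc hz.le with h | h
  · exact h
  · exfalso
    have : ‖c * z‖ = 1 := by rw [← sub_eq_zero.1 h]; simp
    rw [norm_mul, hc] at this; linarith

theorem inDiscAlgebra_cpow {c : ℂ} {α : ℝ} (hc : ‖c‖ = 1) (hα : 0 < α) :
    InDiscAlgebra (fun z => (1 - c * z) ^ (α : ℂ)) := by
  constructor
  · intro z hz
    have hz : ‖z‖ ≤ 1 := by simpa using hz
    apply ContinuousAt.continuousWithinAt
    have hcont : ContinuousAt (fun z => 1 - c * z) z := by fun_prop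
    rcases slitPlane_or_eq_zero hc hz with h | h
    · exact hcont.cpow continuousAt_const h
    · have h0 : ContinuousAt (fun x : ℂ => x ^ (α : ℂ)) (1 - c * z) := by
        rw [h]
        have := continuousAt_cpow_zero_of_re_pos (z := (α : ℂ)) (by simpa using hα)
        exact this.comp (f := fun x : ℂ => (x, (α : ℂ))) (by fun_prop)
      exact h0.comp (f := fun z => 1 - c * z) hcont
  · intro z hz
    have hz : ‖z‖ < 1 := by simpa using hz
    apply DifferentiableAt.differentiableWithinAt
    exact DifferentiableAt.cpow (by fun_prop) (by fun_prop) (one_sub_mul_mem_slitPlane hc hz)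

theorem InDiscAlgebra.diffContOnCl {q : ℂ → ℂ} (hq : InDiscAlgebra q) :
    DiffContOnCl ℂ q (Metric.ball 0 1) :=
  ⟨hq.2, by rw [closure_ball _ one_ne_zero]; exact hq.1⟩

/-- On the closed right half-plane |α arg x| ≤ π/4, so the cosine of this angle is at least 1/2.
This is the positivity of the barrier. -/
theorem half_norm_rpow_le_re_cpow {x : ℂ} {α : ℝ} (hx : 0 ≤ x.re) (h0 : 0 < α) (h1 : α ≤ 1 / 2) :
    1 / 2 * ‖x‖ ^ α ≤ (x ^ (α : ℂ)).re := by
  rw [cpow_ofReal_re, mul_comm]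
  have harg : |arg x| ≤ Real.pi / 2 := abs_arg_le_pi_div_two_iff.2 hx
  have hcos : (1 : ℝ) / 2 ≤ Real.cos (arg x * α) := by
    rw [← Real.cos_pi_div_three, ← Real.cos_abs (arg x * α)]
    apply Real.cos_le_cos_of_nonneg_of_le_pi (abs_nonneg _)
    · linarith [Real.pi_pos]
    · rw [abs_mul, abs_of_pos h0]
      nlinarith [Real.pi_pos, abs_nonneg (arg x)]
  gcongr

theorem norm_one_sub_conj_mul {ξ z : ℂ} (hξ : ‖ξ‖ = 1) :
    ‖1 - (starRingEnd ℂ) ξ * z‖ = ‖z - ξ‖ := by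
  have h : (starRingEnd ℂ) ξ * ξ = 1 := by
    rw [mul_comm, mul_conj, normSq_eq_norm_sq, hξ]; simp
  have : 1 - (starRingEnd ℂ) ξ * z = -((starRingEnd ℂ) ξ * (z - ξ)) := by
    rw [mul_sub, h]; ring
  rw [this, norm_neg, norm_mul, norm_conj, hξ, one_mul]

/-- A power barrier: a boundary bound `N‖ξ - ξ₀‖^α + B` for the real part propagates to the disc. -/
theorem re_le_of_re_le_on_circle {q : ℂ → ℂ} (hq : InDiscAlgebra q) {α N B : ℝ} (hα : 0 < α)
    (hα' : α ≤ 1 / 2) (hN : 0 ≤ N) {ξ₀ : ℂ} (hξ₀ : ‖ξ₀‖ = 1)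
    (h : ∀ ξ : ℂ, ‖ξ‖ = 1 → (q ξ).re ≤ N * ‖ξ - ξ₀‖ ^ α + B) {z : ℂ} (hz : ‖z‖ ≤ 1) :
    (q z).re ≤ 2 * N * ‖z - ξ₀‖ ^ α + B := by
  have hc : ‖(starRingEnd ℂ) ξ₀‖ = 1 := by rw [norm_conj, hξ₀]
  have hb := inDiscAlgebra_cpow hc hα
  set b : ℂ → ℂ := fun z => (1 - (starRingEnd ℂ) ξ₀ * z) ^ (α : ℂ) with hbdef
  -- The maximum principle for a real part, obtained from the maximum modulus principle by
  -- exponentiating. The factor 2 offsets the 1/2 in the lower bound for Re b.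
  have hF : DiffContOnCl ℂ (fun z => cexp (q z - 2 * N * b z)) (Metric.ball 0 1) :=
    Differentiable.comp_diffContOnCl differentiable_exp
      (hq.diffContOnCl.sub (hb.diffContOnCl.const_smul (2 * N : ℂ)))
  have hfr : ∀ x ∈ frontier (Metric.ball (0 : ℂ) 1),
      ‖cexp (q x - 2 * N * b x)‖ ≤ Real.exp B := by
    intro x hx
    rw [frontier_ball _ one_ne_zero] at hx
    have hx : ‖x‖ = 1 := by simpa using hx
    rw [norm_exp]
    apply Real.exp_le_exp.2
    have h1 := half_norm_rpow_le_re_cpow (re_one_sub_mul_nonneg hc hx.le) hα hα'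
    rw [norm_one_sub_conj_mul hξ₀] at h1
    have h2 := h x hx
    have h3 : (q x - 2 * N * b x).re = (q x).re - 2 * N * (b x).re := by
      have : (2 * N * b x : ℂ) = ((2 * N : ℝ) : ℂ) * b x := by push_cast; ring
      rw [this, sub_re, re_ofReal_mul]
    rw [h3]
    nlinarith [mul_le_mul_of_nonneg_left h1 hN]
  have hcl : z ∈ closure (Metric.ball (0 : ℂ) 1) := by
    rw [closure_ball _ one_ne_zero]; simpa using hz
  have := norm_le_of_forall_mem_frontier_norm_le Metric.isBounded_ball hF hfr hcl
  rw [norm_exp, Real.exp_le_exp] at this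
  have h3 : (q z - 2 * N * b z).re = (q z).re - 2 * N * (b z).re := by
    have : (2 * N * b z : ℂ) = ((2 * N : ℝ) : ℂ) * b z := by push_cast; ring
    rw [this, sub_re, re_ofReal_mul]
  have h4 : (b z).re ≤ ‖z - ξ₀‖ ^ α := by
    refine (re_le_norm _).trans ?_
    rw [hbdef]; simp only
    rw [← norm_one_sub_conj_mul hξ₀]
    rcases eq_or_ne (1 - (starRingEnd ℂ) ξ₀ * z) 0 with h0 | h0
    · rw [h0, zero_cpow (by exact_mod_cast hα.ne')]; simp [Real.zero_rpow hα.ne']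
    · rw [norm_cpow_of_ne_zero h0]; simp
  rw [h3] at this
  nlinarith [mul_le_mul_of_nonneg_left h4 hN]

theorem mem_ball_zero_of_mem_ball {z x : ℂ} (hx : x ∈ Metric.ball z (1 - ‖z‖)) : ‖x‖ < 1 := by
  rw [Metric.mem_ball, dist_eq_norm] at hx
  have := norm_add_le (x - z) z
  rw [sub_add_cancel] at this; linarith

/-- Derivative bound in a nontangential region at a boundary point near which the real part
of `c κ` is small. -/
theorem norm_deriv_le_of_nontangential {κ : ℂ → ℂ} (hκ : InDiscAlgebra κ) {β N : ℝ} (hβ : 0 < β)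
    (hβ' : β ≤ 1 / 2) (hN : 0 < N) {c ξ₀ : ℂ} (hc : ‖c‖ = 1) (hξ₀ : ‖ξ₀‖ = 1)
    (h : ∀ ξ : ℂ, ‖ξ‖ = 1 → |(c * κ ξ).re| ≤ N * ‖ξ - ξ₀‖ ^ β) {z : ℂ} (hz : ‖z‖ < 1)
    (hz' : ‖z - ξ₀‖ ≤ 2 * (1 - ‖z‖)) : ‖deriv κ z‖ ≤ 24 * N * (1 - ‖z‖) ^ (β - 1) := by
  set d := 1 - ‖z‖ with hd
  have hd0 : 0 < d := by linarith
  have hcκ : InDiscAlgebra (fun x => c * κ x) :=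
    ⟨continuousOn_const.mul hκ.1, hκ.2.const_mul c⟩
  have hncκ : InDiscAlgebra (fun x => -(c * κ x)) := ⟨hcκ.1.neg, hcκ.2.neg⟩
  have hball : ∀ x ∈ Metric.ball z d, ‖x‖ < 1 := fun x hx => mem_ball_zero_of_mem_ball hx
  have h3 : ∀ x ∈ Metric.ball z d, ‖x - ξ₀‖ ^ β ≤ 3 * d ^ β := by
    intro x hx
    rw [Metric.mem_ball, dist_eq_norm] at hx
    have : ‖x - ξ₀‖ ≤ 3 * d := by
      calc ‖x - ξ₀‖ = ‖(x - z) + (z - ξ₀)‖ := by ring_nf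
        _ ≤ _ := norm_add_le _ _
        _ ≤ 3 * d := by linarith
    calc ‖x - ξ₀‖ ^ β ≤ (3 * d) ^ β := by gcongr
      _ = 3 ^ β * d ^ β := Real.mul_rpow (by norm_num) hd0.le
      _ ≤ 3 ^ (1 : ℝ) * d ^ β := by gcongr <;> linarith
      _ = _ := by simp
  have hup : ∀ x ∈ Metric.ball z d, (c * κ x).re ≤ 6 * N * d ^ β := by
    intro x hx
    have := re_le_of_re_le_on_circle hcκ (B := 0) hβ hβ' hN.le hξ₀
      (fun ξ hξ => by rw [add_zero]; exact (le_abs_self _).trans (h ξ hξ)) (hball x hx).le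
    nlinarith [mul_le_mul_of_nonneg_left (h3 x hx) hN.le]
  have hdn : -(6 * N * d ^ β) ≤ (c * κ z).re := by
    have := re_le_of_re_le_on_circle hncκ (B := 0) hβ hβ' hN.le hξ₀
      (fun ξ hξ => by rw [add_zero]; exact (neg_le_abs _).trans (h ξ hξ)) hz.le
    simp only [neg_re] at this
    nlinarith [mul_le_mul_of_nonneg_left (h3 z (Metric.mem_ball_self hd0)) hN.le]
  have := norm_deriv_le_of_re_le (q := fun x => c * κ x) (B := 12 * N * d ^ β) hd0 (by positivity)
    (hcκ.2.mono fun x hx => by simpa using hball x hx)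
    (fun x hx => by have := hup x hx; linarith)
  rw [deriv_const_mul_field, norm_mul, hc, one_mul] at this
  rw [Real.rpow_sub_one hd0.ne']
  calc _ ≤ _ := this
    _ = _ := by ring

/-- With h = a + ib, the real part is at most N - |s| + 5ka² - 3kb²: the term -4kb² of Re(4kh²)
beats the quadratic error. Smallness of h gives 5ka² ≤ |a|/4, and |a| ≤ |s| + N + k(a² + b²) lets
-|s| and -3kb² absorb all but a fraction of N. The unknown constant s is harmless because σ is
chosen to have its sign. -/
theorem re_quadratic_le {k η N s σ : ℝ} {h : ℂ} (hk : 0 < k) (hη : 20 * k * η ≤ 1)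
    (hσ : σ = 1 ∨ σ = -1) (hs : 0 ≤ σ * s) (hh : ‖h‖ ≤ η)
    (H : |s + h.re| ≤ N + k * ‖h‖ ^ 2) :
    (σ * h + 4 * k * h ^ 2 : ℂ).re ≤ 4 / 3 * N := by
  have hre : (σ * h + 4 * k * h ^ 2 : ℂ).re = σ * h.re + 4 * k * (h.re ^ 2 - h.im ^ 2) := by
    simp [pow_two]
  rw [hre]
  rw [Complex.sq_norm, normSq_apply] at H
  have ha : |h.re| ≤ η := (abs_re_le_norm h).trans hh
  set a := h.re
  set b := h.im
  have h1 : 20 * k * a ^ 2 ≤ |a| := by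
    rw [← sq_abs]
    nlinarith [abs_nonneg a, mul_le_mul_of_nonneg_left ha (mul_nonneg hk.le (abs_nonneg a)),
      mul_le_mul_of_nonneg_right hη (abs_nonneg a)]
  have h2 : |a| ≤ |s| + N + k * (a * a + b * b) := by
    have : |a| ≤ |s + a| + |s| := by
      calc |a| = |(s + a) - s| := by ring_nf
        _ ≤ _ := abs_sub _ _
    linarith
  have h3 : σ * (s + a) ≤ |s + a| := by
    rcases hσ with rfl | rfl
    · simpa using le_abs_self (s + a)
    · simpa using neg_le_abs (s + a)
  have h4 : σ * s = |s| := by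
    rcases hσ with rfl | rfl
    · rw [abs_of_nonneg (by linarith)]; ring
    · rw [abs_of_nonpos (by linarith)]; ring
  have h5 : 0 ≤ k * b ^ 2 := by positivity
  have h6 := abs_nonneg s
  have h7 := abs_nonneg a
  nlinarith

/-- Derivative bound at a point `z` whose radial projection to the circle is `ξ₀`, when
`κ - κ z` satisfies on the circle a linear condition up to `N‖ξ - ξ₀‖^(1/2)` and up to a
quadratic error. -/
theorem exists_norm_deriv_le_of_almost_linear {κ : ℂ → ℂ} (hκ : InDiscAlgebra κ) {k : ℝ}
    (hk : 0 < k) : ∃ d₀ > 0, ∃ C > 0, ∀ z ξ₀ A : ℂ, ∀ s N : ℝ, ‖z‖ < 1 → 1 - ‖z‖ ≤ d₀ →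
      ‖ξ₀‖ = 1 → ‖z - ξ₀‖ = 1 - ‖z‖ → ‖A‖ = 1 → 1 ≤ N →
      (∀ ξ : ℂ, ‖ξ‖ = 1 → |s + (A * (κ ξ - κ z)).re| ≤
        N * ‖ξ - ξ₀‖ ^ (1 / 2 : ℝ) + k * ‖κ ξ - κ z‖ ^ 2) →
      ‖deriv κ z‖ ≤ C * N * (1 - ‖z‖) ^ (-1 / 2 : ℝ) := by
  have hcomp : IsCompact (Metric.closedBall (0 : ℂ) 1) := isCompact_closedBall 0 1
  obtain ⟨M, hM⟩ := hcomp.exists_bound_of_continuousOn hκ.1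
  have hM0 : 0 ≤ M := (norm_nonneg _).trans (hM 0 (by simp))
  have huc := hcomp.uniformContinuousOn_of_continuous hκ.1
  rw [Metric.uniformContinuousOn_iff] at huc
  obtain ⟨ε, hε, huc⟩ := huc (1 / (20 * k)) (by positivity)
  have hd₀ : 0 < ε / 3 := by positivity
  set d₀ := ε / 3
  -- The first summand serves the arc near ξ₀, where `re_quadratic_le` applies. The second serves
  -- the arc |ξ-ξ₀| ≥ d₀, where |h| ≤ 2M and the quadratic terms total at most 5k(2M)².
  set c₁ := 4 / 3 + 20 * k * M ^ 2 / d₀ ^ (1 / 2 : ℝ) with hc₁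
  have hc₁0 : 0 < c₁ := by positivity
  refine ⟨d₀, hd₀, 8 * c₁, by positivity, ?_⟩
  intro z ξ₀ A s N hz hzd hξ₀ hfoot hA hN H
  set d := 1 - ‖z‖ with hd
  have hd0 : 0 < d := by linarith
  have hN0 : 0 < N := by linarith
  obtain ⟨σ, hσ, hs⟩ : ∃ σ : ℝ, (σ = 1 ∨ σ = -1) ∧ 0 ≤ σ * s := by
    rcases le_total 0 s with h | h
    · exact ⟨1, Or.inl rfl, by simpa⟩
    · exact ⟨-1, Or.inr rfl, by linarith⟩
  -- The square vanishes to second order at z, so q'(z) = σAκ'(z), of modulus |κ'(z)|, and q(z) = 0.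
  set q : ℂ → ℂ := fun x => σ * (A * (κ x - κ z)) + 4 * k * (A * (κ x - κ z)) ^ 2 with hq
  have hqd : InDiscAlgebra q := by
    have h1 := hκ.1
    have h2 := hκ.2
    constructor
    · simp only [hq]; fun_prop
    · simp only [hq]; fun_prop
  have hcirc : ∀ ξ : ℂ, ‖ξ‖ = 1 → (q ξ).re ≤ c₁ * N * ‖ξ - ξ₀‖ ^ (1 / 2 : ℝ) + 0 := by
    intro ξ hξ
    have hH := H ξ hξ
    have hnA : ‖A * (κ ξ - κ z)‖ = ‖κ ξ - κ z‖ := by rw [norm_mul, hA, one_mul]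
    rw [← hnA] at hH
    have ht0 : 0 ≤ ‖ξ - ξ₀‖ ^ (1 / 2 : ℝ) := by positivity
    rw [add_zero]
    rcases lt_or_ge ‖ξ - ξ₀‖ d₀ with hlt | hge
    · have hsmall : ‖A * (κ ξ - κ z)‖ ≤ 1 / (20 * k) := by
        rw [hnA, ← dist_eq_norm]
        refine (huc ξ (by simp [hξ]) z (by simpa using hz.le) ?_).le
        rw [dist_eq_norm]
        calc ‖ξ - z‖ = ‖(ξ - ξ₀) - (z - ξ₀)‖ := by ring_nf
          _ ≤ _ := norm_sub_le _ _
          _ < ε := by rw [hfoot]; simp only [d₀] at *; linarith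
      have := re_quadratic_le hk (by field_simp; rfl) hσ hs hsmall hH
      refine this.trans ?_
      rw [hc₁]
      have : 0 ≤ 20 * k * M ^ 2 / d₀ ^ (1 / 2 : ℝ) := by positivity
      nlinarith [mul_nonneg (mul_nonneg this hN0.le) ht0]
    · have hbig : ‖A * (κ ξ - κ z)‖ ≤ 2 * M := by
        rw [hnA]
        have := norm_sub_le (κ ξ) (κ z)
        have h1 := hM ξ (by simp [hξ])
        have h2 := hM z (by simpa using hz.le)
        linarith
      set h := A * (κ ξ - κ z)
      have hre : (q ξ).re = σ * h.re + 4 * k * (h ^ 2).re := by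
        simp only [hq]
        have : (4 * k * h ^ 2 : ℂ) = ((4 * k : ℝ) : ℂ) * h ^ 2 := by push_cast; ring
        rw [this, add_re, re_ofReal_mul, re_ofReal_mul]
      have h3 : σ * (s + h.re) ≤ |s + h.re| := by
        rcases hσ with rfl | rfl
        · simpa using le_abs_self (s + h.re)
        · simpa using neg_le_abs (s + h.re)
      have h4 : (h ^ 2).re ≤ ‖h‖ ^ 2 := by rw [← norm_pow]; exact re_le_norm _
      have h5 : ‖h‖ ^ 2 ≤ (2 * M) ^ 2 := by gcongr
      have h6 : 20 * k * M ^ 2 ≤ 20 * k * M ^ 2 / d₀ ^ (1 / 2 : ℝ) * ‖ξ - ξ₀‖ ^ (1 / 2 : ℝ) := by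
        rw [div_mul_eq_mul_div, le_div_iff₀ (by positivity)]
        gcongr
      have h7 : 20 * k * M ^ 2 ≤
          20 * k * M ^ 2 / d₀ ^ (1 / 2 : ℝ) * N * ‖ξ - ξ₀‖ ^ (1 / 2 : ℝ) := by
        have h0 : 0 ≤ 20 * k * M ^ 2 / d₀ ^ (1 / 2 : ℝ) * ‖ξ - ξ₀‖ ^ (1 / 2 : ℝ) := by positivity
        nlinarith [mul_le_mul_of_nonneg_left hN h0]
      rw [hre, hc₁]
      nlinarith [mul_nonneg hN0.le ht0, mul_le_mul_of_nonneg_left h4 hk.le,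
        mul_le_mul_of_nonneg_left h5 hk.le]
  have hball : ∀ x ∈ Metric.ball z d, ‖x‖ < 1 := fun x hx => mem_ball_zero_of_mem_ball hx
  have hqz : q z = 0 := by simp [hq]
  have hd2 : d ^ (1 / 2 : ℝ) / d = d ^ (-1 / 2 : ℝ) := by
    rw [← Real.rpow_sub_one hd0.ne']; norm_num
  have hup : ∀ x ∈ Metric.ball z d, (q x).re ≤ 4 * c₁ * N * d ^ (1 / 2 : ℝ) + (q z).re := by
    intro x hx
    have h1 := re_le_of_re_le_on_circle hqd (by norm_num) (by norm_num) (by positivity) hξ₀ hcirc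
      (hball x hx).le
    rw [Metric.mem_ball, dist_eq_norm] at hx
    have h2 : ‖x - ξ₀‖ ≤ 4 * d := by
      calc ‖x - ξ₀‖ = ‖(x - z) + (z - ξ₀)‖ := by ring_nf
        _ ≤ _ := norm_add_le _ _
        _ ≤ 4 * d := by rw [hfoot]; linarith
    have h3 : ‖x - ξ₀‖ ^ (1 / 2 : ℝ) ≤ 2 * d ^ (1 / 2 : ℝ) := by
      calc ‖x - ξ₀‖ ^ (1 / 2 : ℝ) ≤ (4 * d) ^ (1 / 2 : ℝ) := by gcongr
        _ = 4 ^ (1 / 2 : ℝ) * d ^ (1 / 2 : ℝ) := Real.mul_rpow (by norm_num) hd0.le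
        _ = _ := by
          rw [show (4 : ℝ) = 2 ^ (2 : ℝ) by norm_num, ← Real.rpow_mul (by norm_num)]; norm_num
    rw [hqz]
    simp only [zero_re, add_zero]
    have : 0 ≤ c₁ * N := by positivity
    nlinarith [mul_le_mul_of_nonneg_left h3 this]
  have hder := norm_deriv_le_of_re_le (q := q) hd0 (by positivity)
    (hqd.2.mono fun x hx => by simpa using hball x hx) hup
  have hκz : DifferentiableAt ℂ κ z :=
    hκ.2.differentiableAt (Metric.isOpen_ball.mem_nhds (by simpa using hz))
  have hdq : HasDerivAt q (σ * (A * deriv κ z)) z := by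
    have h1 : HasDerivAt (fun x => A * (κ x - κ z)) (A * deriv κ z) z :=
      (hκz.hasDerivAt.sub_const _).const_mul A
    have h2 := (h1.const_mul (σ : ℂ)).add ((h1.pow 2).const_mul (4 * k : ℂ))
    exact h2.congr_deriv (by simp)
  rw [hdq.deriv, norm_mul, norm_mul, hA] at hder
  have hσ1 : ‖(σ : ℂ)‖ = 1 := by rcases hσ with rfl | rfl <;> simp
  rw [hσ1, one_mul, one_mul] at hder
  calc _ ≤ _ := hder
    _ = 8 * c₁ * N * (d ^ (1 / 2 : ℝ) / d) := by ring
    _ = _ := by rw [hd2]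

/-! ### Hölder continuity from the growth of the derivative -/

/-- At (1-s)z the distance to the circle is at least s, so the derivative along the radius is at
most Cs^(β-1), which is integrable at 0. -/
theorem norm_sub_radial_le {κ : ℂ → ℂ} (hκ : InDiscAlgebra κ) {β C : ℝ} (hβ : 0 < β)
    (hβ' : β ≤ 1) (hC : 0 ≤ C)
    (h : ∀ z : ℂ, ‖z‖ < 1 → ‖deriv κ z‖ ≤ C * (1 - ‖z‖) ^ (β - 1)) {z : ℂ} (hz : ‖z‖ ≤ 1) {t : ℝ}
    (ht : 0 < t) (ht1 : t ≤ 1) : ‖κ ((1 - t) * z) - κ z‖ ≤ C / β * t ^ β := by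
  set φ : ℝ → ℂ := fun s => κ ((1 - s) * z) with hφ
  have hnorm : ∀ s ∈ Icc (0 : ℝ) 1, ‖(1 - s) * z‖ ≤ 1 - s := by
    intro s hs
    have : ‖(1 - s : ℂ)‖ = 1 - s := by
      rw [← ofReal_one, ← ofReal_sub, norm_real, Real.norm_of_nonneg (by linarith [hs.2])]
    rw [norm_mul, this]
    exact mul_le_of_le_one_right (by linarith [hs.2]) hz
  have hcont : ContinuousOn φ (Icc 0 t) := by
    apply hκ.1.comp (by fun_prop)
    intro s hs
    have := hnorm s ⟨hs.1, hs.2.trans ht1⟩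
    simp only [Metric.mem_closedBall, dist_zero_right]; linarith [hs.1]
  have hder : ∀ s : ℝ, 0 < s → s ≤ 1 →
      HasDerivAt φ (deriv κ ((1 - s) * z) * (-z)) s := by
    intro s hs hs1
    have h1 : DifferentiableAt ℂ κ ((1 - s) * z) := by
      apply hκ.2.differentiableAt (Metric.isOpen_ball.mem_nhds _)
      have := hnorm s ⟨hs.le, hs1⟩
      simp only [Metric.mem_ball, dist_zero_right]; linarith
    have h2 : HasDerivAt (fun s : ℂ => (1 - s) * z) (-z) (s : ℂ) := by
      simpa using ((hasDerivAt_id (s : ℂ)).const_sub 1).mul_const z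
    exact (HasDerivAt.comp (s : ℂ) h1.hasDerivAt h2).comp_ofReal
  -- The comparison starts at ε > 0 because z may lie on the circle, where no derivative is
  -- available; ε → 0 follows by continuity.
  have key : ∀ ε ∈ Ioc 0 t, ‖φ t - φ ε‖ ≤ C / β * t ^ β := by
    intro ε hε
    have hB : ∀ s : ℝ, 0 < s → HasDerivAt (fun s : ℝ => C / β * s ^ β) (C * s ^ (β - 1)) s := by
      intro s hs
      have := (Real.hasDerivAt_rpow_const (p := β) (Or.inl hs.ne')).const_mul (C / β)
      exact this.congr_deriv (by rw [← mul_assoc, div_mul_cancel₀ _ hβ.ne'])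
    have := image_norm_le_of_norm_deriv_right_le_deriv_boundary' (a := ε) (b := t)
      (f := fun s => φ s - φ ε) (f' := fun s => deriv κ ((1 - s) * z) * (-z))
      (B := fun s => C / β * s ^ β) (B' := fun s => C * s ^ (β - 1))
      ((hcont.mono (Icc_subset_Icc hε.1.le le_rfl)).sub continuousOn_const)
      (fun s hs => ((hder s (hε.1.trans_le hs.1) (hs.2.le.trans ht1)).sub_const _).hasDerivWithinAt)
      (by simp only [sub_self, norm_zero]; have := hε.1; positivity)
      (fun s hs => (hB s (hε.1.trans_le hs.1)).continuousAt.continuousWithinAt)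
      (fun s hs => (hB s (hε.1.trans_le hs.1)).hasDerivWithinAt)
      (by
        intro s hs
        have hs0 : 0 < s := hε.1.trans_le hs.1
        have hs1 : s ≤ 1 := hs.2.le.trans ht1
        have h1 := hnorm s ⟨hs0.le, hs1⟩
        rw [norm_mul, norm_neg]
        calc _ ≤ ‖deriv κ ((1 - s) * z)‖ * 1 := by gcongr
          _ ≤ C * (1 - ‖(1 - s) * z‖) ^ (β - 1) := by
              rw [mul_one]; exact h _ (by linarith)
          _ ≤ C * s ^ (β - 1) := by
              gcongr 1
              exact Real.rpow_le_rpow_of_nonpos hs0 (by linarith) (by linarith))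
    exact this ⟨hε.2, le_rfl⟩
  have h0 : Tendsto (fun ε => ‖φ t - φ ε‖) (𝓝[>] 0) (𝓝 ‖φ t - φ 0‖) := by
    have h1 : ContinuousWithinAt φ (Icc 0 t) 0 := hcont 0 ⟨le_rfl, ht.le⟩
    have h2 : Tendsto φ (𝓝[>] 0) (𝓝 (φ 0)) := by
      refine h1.tendsto.mono_left ?_
      rw [← nhdsWithin_Ioc_eq_nhdsGT ht]
      exact nhdsWithin_mono _ Ioc_subset_Icc_self
    exact (h2.const_sub _).norm
  have h1 := le_of_tendsto h0 (by
    filter_upwards [Ioc_mem_nhdsGT ht] with ε hε using key ε hε)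
  simpa [hφ] using h1

/-- Hardy and Littlewood: a bound for the derivative gives Hölder continuity up to the boundary. -/
theorem inHolderDiscAlgebra_of_deriv_le {κ : ℂ → ℂ} (hκ : InDiscAlgebra κ) {β C : ℝ} (hβ : 0 < β)
    (hβ' : β ≤ 1) (h : ∀ z : ℂ, ‖z‖ < 1 → ‖deriv κ z‖ ≤ C * (1 - ‖z‖) ^ (β - 1)) :
    InHolderDiscAlgebra β κ := by
  have hC : 0 ≤ C := by have := (norm_nonneg _).trans (h 0 (by simp)); simpa using this
  obtain ⟨M, hM⟩ := (isCompact_closedBall (0 : ℂ) 1).exists_bound_of_continuousOn hκ.1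
  have hM0 : 0 ≤ M := (norm_nonneg _).trans (hM 0 (by simp))
  refine ⟨hκ, 2 * M + (C / β + C / β + C), ?_⟩
  intro z hz w hw
  have hz' : ‖z‖ ≤ 1 := by simpa using hz
  have hw' : ‖w‖ ≤ 1 := by simpa using hw
  rcases eq_or_ne z w with rfl | hne
  · simp [Real.zero_rpow hβ.ne']
  set t := ‖z - w‖ with ht
  have ht0 : 0 < t := norm_pos_iff.2 (sub_ne_zero.2 hne)
  have htβ : 0 < t ^ β := by positivity
  have hCβ : 0 ≤ C / β := by positivity
  rcases le_or_gt t 1 with ht1 | ht1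
  · have h1 := norm_sub_radial_le hκ hβ hβ' hC h hz' ht0 ht1
    have h2 := norm_sub_radial_le hκ hβ hβ' hC h hw' ht0 ht1
    have hnt : ‖(1 - t : ℂ)‖ = 1 - t := by
      rw [← ofReal_one, ← ofReal_sub, norm_real, Real.norm_of_nonneg (by linarith)]
    -- The path from z to w goes inward by t = |z-w|, across, and outward again. The crossing stays
    -- in the disc of radius 1-t, where the derivative is at most Ct^(β-1).
    have h3 : ‖κ ((1 - t) * z) - κ ((1 - t) * w)‖ ≤ C * t ^ β := by
      rcases ht1.lt_or_eq with ht1 | ht1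
      · have hin : ∀ x : ℂ, ‖x‖ ≤ 1 → (1 - t) * x ∈ Metric.closedBall (0 : ℂ) (1 - t) := by
          intro x hx
          simp only [Metric.mem_closedBall, dist_zero_right, norm_mul, hnt]
          exact mul_le_of_le_one_right (by linarith) hx
        have := (convex_closedBall (0 : ℂ) (1 - t)).norm_image_sub_le_of_norm_deriv_le
          (f := κ) (C := C * t ^ (β - 1)) (x := (1 - t) * w) (y := (1 - t) * z)
          (fun x hx => by
            have hx : ‖x‖ ≤ 1 - t := by simpa using hx
            exact hκ.2.differentiableAt (Metric.isOpen_ball.mem_nhds (by simp; linarith)))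
          (fun x hx => by
            have hx : ‖x‖ ≤ 1 - t := by simpa using hx
            refine (h x (by linarith)).trans ?_
            gcongr 1
            exact Real.rpow_le_rpow_of_nonpos ht0 (by linarith) (by linarith))
          (hin w hw') (hin z hz')
        refine this.trans ?_
        have h4 : ‖(1 - t) * z - (1 - t) * w‖ ≤ t := by
          rw [← mul_sub, norm_mul, hnt, ← ht]
          exact mul_le_of_le_one_left ht0.le (by linarith)
        calc _ ≤ C * t ^ (β - 1) * t := by gcongr
          _ = C * (t ^ (β - 1) * t) := by ring
          _ = _ := by rw [Real.rpow_sub_one ht0.ne', div_mul_cancel₀ _ ht0.ne']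
      · rw [ht1]; simp [hC]
    have : κ z - κ w = -(κ ((1 - t) * z) - κ z) + (κ ((1 - t) * w) - κ w)
        + (κ ((1 - t) * z) - κ ((1 - t) * w)) := by ring
    rw [this]
    calc _ ≤ ‖-(κ ((1 - t) * z) - κ z)‖ + ‖κ ((1 - t) * w) - κ w‖
        + ‖κ ((1 - t) * z) - κ ((1 - t) * w)‖ := norm_add₃_le
      _ ≤ C / β * t ^ β + C / β * t ^ β + C * t ^ β := by rw [norm_neg]; gcongr
      _ ≤ _ := by nlinarith
  · have h1 : 1 ≤ t ^ β := Real.one_le_rpow ht1.le hβ.le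
    calc _ ≤ ‖κ z‖ + ‖κ w‖ := norm_sub_le _ _
      _ ≤ 2 * M := by linarith [hM z hz, hM w hw]
      _ ≤ (2 * M + (C / β + C / β + C)) * 1 := by nlinarith
      _ ≤ _ := by gcongr

/-! Second order Taylor bounds on compact convex sets. -/

/-- Compactness bounds the first two derivatives on K and convexity allows the mean value
inequality. Derivatives within S are needed because in the application S has boundary at θ = 0 and θ
= π. -/
theorem exists_taylor_bounds {V : Type*} [NormedAddCommGroup V] [NormedSpace ℝ V] {g : V → ℝ}
    {S K : Set V} (hS : UniqueDiffOn ℝ S) (hg : ContDiffOn ℝ 2 g S) (hK : IsCompact K)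
    (hKc : Convex ℝ K) (hKS : K ⊆ S) :
    ∃ Λ : ℝ, 1 ≤ Λ ∧ ∀ x ∈ K, ∀ y ∈ K, ‖fderivWithin ℝ g S x‖ ≤ Λ ∧
      ‖fderivWithin ℝ g S x - fderivWithin ℝ g S y‖ ≤ Λ * ‖x - y‖ ∧
      |g x - g y - fderivWithin ℝ g S y (x - y)| ≤ Λ * ‖x - y‖ ^ 2 := by
  have hG : ContDiffOn ℝ 1 (fderivWithin ℝ g S) S := hg.fderivWithin hS (by norm_num)
  have hG' : ContinuousOn (fderivWithin ℝ (fderivWithin ℝ g S) S) S :=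
    hG.continuousOn_fderivWithin hS le_rfl
  obtain ⟨Λ₁, h₁⟩ := hK.exists_bound_of_continuousOn (hG.continuousOn.mono hKS)
  obtain ⟨Λ₂, h₂⟩ := hK.exists_bound_of_continuousOn (E := V →L[ℝ] V →L[ℝ] ℝ) (hG'.mono hKS)
  have hlip : ∀ x ∈ K, ∀ y ∈ K,
      ‖fderivWithin ℝ g S x - fderivWithin ℝ g S y‖ ≤ |Λ₂| * ‖x - y‖ := by
    intro x hx y hy
    exact hKc.norm_image_sub_le_of_norm_hasFDerivWithin_le
      (fun z hz => (((hG.differentiableOn one_ne_zero) z (hKS hz)).hasFDerivWithinAt).mono hKS)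
      (fun z hz => (h₂ z hz).trans (le_abs_self _)) hy hx
  refine ⟨1 + |Λ₁| + |Λ₂|, by linarith [abs_nonneg Λ₁, abs_nonneg Λ₂], ?_⟩
  intro x hx y hy
  have hL : |Λ₂| ≤ 1 + |Λ₁| + |Λ₂| := by linarith [abs_nonneg Λ₁]
  refine ⟨(h₁ x hx).trans (by linarith [le_abs_self Λ₁, abs_nonneg Λ₂]), ?_, ?_⟩
  · exact (hlip x hx y hy).trans (by gcongr)
  · have hseg : segment ℝ y x ⊆ K := hKc.segment_subset hy hx
    have := (convex_segment y x).norm_image_sub_le_of_norm_hasFDerivWithin_le'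
      (f := g) (f' := fderivWithin ℝ g S) (φ := fderivWithin ℝ g S y) (C := |Λ₂| * ‖x - y‖)
      (fun z hz => (((hg.differentiableOn two_ne_zero) z
        (hKS (hseg hz))).hasFDerivWithinAt).mono (hseg.trans hKS))
      (fun z hz => (hlip z (hseg hz) y hy).trans (by
        have := norm_sub_le_of_mem_segment hz
        gcongr))
      (left_mem_segment ℝ y x) (right_mem_segment ℝ y x)
    rw [Real.norm_eq_abs] at this
    refine this.trans ?_
    rw [mul_assoc, ← pow_two]
    gcongr

/-! Polar form of the points of the circle and of the powers of `1 - ξ`. -/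

theorem cpow_polar {r φ δ : ℝ} (hr : 0 ≤ r) (hφ : -Real.pi < φ) (hφ' : φ ≤ Real.pi) (hδ : δ ≠ 0) :
    ((r : ℂ) * cexp (φ * I)) ^ (δ : ℂ) = ((r ^ δ : ℝ) : ℂ) * cexp ((δ * φ : ℝ) * I) := by
  rcases hr.eq_or_lt with rfl | hr
  · rw [Real.zero_rpow hδ, ofReal_zero, zero_mul, zero_mul, zero_cpow (by exact_mod_cast hδ)]
  · have hne : cexp (φ * I) ≠ 0 := exp_ne_zero _
    rw [cpow_def_of_ne_zero (mul_ne_zero (by exact_mod_cast hr.ne') hne), log_ofReal_mul hr hne,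
      log_exp (by simpa using hφ) (by simpa using hφ'), add_mul, exp_add, Real.rpow_def_of_pos hr]
    push_cast
    ring_nf

theorem one_sub_exp_eq (θ : ℝ) :
    1 - cexp (θ * I) = ((2 * Real.sin (θ / 2) : ℝ) : ℂ) * cexp ((θ / 2 - Real.pi / 2 : ℝ) * I) := by
  have h1 : (θ : ℂ) = ((θ / 2 : ℝ) : ℂ) + ((θ / 2 : ℝ) : ℂ) := by push_cast; ring
  rw [h1]
  set x := θ / 2
  have h2 : cexp ((x - Real.pi / 2 : ℝ) * I) = -I * cexp (x * I) := by
    rw [ofReal_sub, sub_mul, sub_eq_add_neg, exp_add, mul_comm]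
    congr 1
    rw [show -(((Real.pi / 2 : ℝ) : ℂ) * I) = -((Real.pi : ℂ) / 2 * I) by push_cast; ring, exp_neg,
      exp_pi_div_two_mul_I]
    simp
  rw [h2, add_mul, exp_add, exp_mul_I, ← ofReal_cos, ← ofReal_sin]
  have h3 : ((Real.cos x : ℝ) : ℂ) ^ 2 + (Real.sin x : ℂ) ^ 2 = 1 := by
    exact_mod_cast Real.cos_sq_add_sin_sq x
  push_cast at h3 ⊢
  linear_combination (-1) * h3 + (Complex.sin x ^ 2) * I_sq

/-- The modulus of `(1 - e^{iθ})^δ`. -/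
noncomputable def chordPow (δ θ : ℝ) : ℝ := (2 * Real.sin (θ / 2)) ^ δ

/-- The direction of `(1 - e^{iθ})^δ` for `0 ≤ θ ≤ π`. -/
noncomputable def chordDir (δ θ : ℝ) : ℂ := cexp ((δ * (θ / 2 - Real.pi / 2) : ℝ) * I)

theorem norm_chordDir (δ θ : ℝ) : ‖chordDir δ θ‖ = 1 := norm_exp_ofReal_mul_I _

theorem one_sub_exp_cpow {δ θ : ℝ} (hδ : δ ≠ 0) (h0 : 0 ≤ θ) (hθ : θ ≤ Real.pi) :
    (1 - cexp (θ * I)) ^ (δ : ℂ) = chordPow δ θ * chordDir δ θ := by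
  have := Real.pi_pos
  rw [one_sub_exp_eq, cpow_polar _ (by linarith) (by linarith) hδ, chordPow, chordDir]
  have := Real.sin_nonneg_of_nonneg_of_le_pi (x := θ / 2) (by linarith) (by linarith)
  linarith

theorem one_sub_exp_neg_cpow {δ θ : ℝ} (hδ : δ ≠ 0) (h0 : 0 ≤ θ) (hθ : θ ≤ Real.pi) :
    (1 - cexp ((-θ : ℝ) * I)) ^ (δ : ℂ) = chordPow δ θ * (starRingEnd ℂ) (chordDir δ θ) := by
  have hpi := Real.pi_pos
  have h : 1 - cexp ((-θ : ℝ) * I) = (starRingEnd ℂ) (1 - cexp (θ * I)) := by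
    rw [map_sub, map_one, ← exp_conj, map_mul, conj_ofReal, conj_I]; congr 2; push_cast; ring
  have harg : (1 - cexp (θ * I)).arg ≠ Real.pi := by
    intro hh
    have h1 : ((1 : ℂ) - cexp (θ * I)).re < 0 := (arg_eq_pi_iff.1 hh).1
    rw [sub_re, one_re, exp_ofReal_mul_I_re] at h1
    linarith [Real.cos_le_one θ]
  rw [h, conj_cpow _ _ harg, conj_ofReal, one_sub_exp_cpow hδ h0 hθ, map_mul, conj_ofReal]

theorem two_mul_sin_half_bounds {θ : ℝ} (h0 : 0 ≤ θ) (hθ : θ ≤ Real.pi) :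
    θ / 2 ≤ 2 * Real.sin (θ / 2) ∧ 2 * Real.sin (θ / 2) ≤ θ := by
  constructor
  · have h1 := Real.mul_le_sin (x := θ / 2) (by linarith) (by linarith)
    have h2 : θ / 4 ≤ 2 / Real.pi * (θ / 2) := by
      rw [show 2 / Real.pi * (θ / 2) = θ / Real.pi by ring]
      exact div_le_div_of_nonneg_left h0 Real.pi_pos Real.pi_le_four
    linarith
  · linarith [Real.sin_le (x := θ / 2) (by linarith)]

theorem chordPow_le {δ θ : ℝ} (hδ : 0 < δ) (h0 : 0 ≤ θ) (hθ : θ ≤ Real.pi) :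
    chordPow δ θ ≤ θ ^ δ := by
  have h := two_mul_sin_half_bounds h0 hθ
  exact Real.rpow_le_rpow (by linarith [h.1]) h.2 hδ.le

theorem half_rpow_le {δ θ : ℝ} (hδ1 : δ < 1) (h0 : 0 ≤ θ) :
    1 / 2 * θ ^ δ ≤ (θ / 2) ^ δ := by
  rw [div_eq_mul_one_div θ 2, mul_comm θ, Real.mul_rpow (by norm_num) h0]
  gcongr
  calc (1 / 2 : ℝ) = (1 / 2) ^ (1 : ℝ) := by simp
    _ ≤ _ := Real.rpow_le_rpow_of_exponent_ge (by norm_num) (by norm_num) hδ1.le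

theorem le_chordPow {δ θ : ℝ} (hδ : 0 < δ) (hδ1 : δ < 1) (h0 : 0 ≤ θ) (hθ : θ ≤ Real.pi) :
    1 / 2 * θ ^ δ ≤ chordPow δ θ :=
  (half_rpow_le hδ1 h0).trans
    (Real.rpow_le_rpow (by linarith) (two_mul_sin_half_bounds h0 hθ).1 hδ.le)

/-- By homogeneity this is |q^δ - 1| ≤ |q - 1| for q = x/y ≥ 0. Only y has to stay away from 0. -/
theorem abs_rpow_sub_rpow_le {δ x y : ℝ} (hδ : 0 < δ) (hδ1 : δ < 1) (hx : 0 ≤ x) (hy : 0 < y) :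
    |x ^ δ - y ^ δ| ≤ y ^ (δ - 1) * |x - y| := by
  have hq : 0 ≤ x / y := by positivity
  have e1 : x ^ δ - y ^ δ = y ^ δ * ((x / y) ^ δ - 1) := by
    rw [Real.div_rpow hx hy.le, mul_sub, mul_div_cancel₀ _ (by positivity), mul_one]
  have e2 : y ^ (δ - 1) * |x - y| = y ^ δ * |x / y - 1| := by
    rw [Real.rpow_sub_one hy.ne', div_sub_one hy.ne', abs_div, abs_of_pos hy]; ring
  rw [e1, e2, abs_mul, abs_of_pos (by positivity : 0 < y ^ δ)]
  refine mul_le_mul_of_nonneg_left ?_ (by positivity)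
  rcases le_total 1 (x / y) with h | h
  · have h1 : 1 ≤ (x / y) ^ δ := Real.one_le_rpow h hδ.le
    have h2 : (x / y) ^ δ ≤ x / y := by
      simpa using Real.rpow_le_rpow_of_exponent_le h hδ1.le
    rw [abs_of_nonneg (by linarith), abs_of_nonneg (by linarith)]; linarith
  · have h1 : (x / y) ^ δ ≤ 1 := Real.rpow_le_one hq h hδ.le
    have h2 : x / y ≤ (x / y) ^ δ := by
      rcases hq.eq_or_lt with h0 | h0
      · rw [← h0]; positivity
      · simpa using Real.rpow_le_rpow_of_exponent_ge h0 h hδ1.le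
    rw [abs_of_nonpos (by linarith), abs_of_nonpos (by linarith)]; linarith

theorem abs_chordPow_sub_le {δ θ θ₀ : ℝ} (hδ : 0 < δ) (hδ1 : δ < 1) (h0 : 0 ≤ θ)
    (hθ : θ ≤ Real.pi) (h0' : 0 < θ₀) (hθ' : θ₀ ≤ Real.pi) :
    |chordPow δ θ - chordPow δ θ₀| ≤ 2 * (θ₀ ^ δ / θ₀) * |θ - θ₀| := by
  have hx := two_mul_sin_half_bounds h0 hθ
  have hy := two_mul_sin_half_bounds h0'.le hθ'
  have hy0 : 0 < 2 * Real.sin (θ₀ / 2) := by linarith [hy.1]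
  refine (abs_rpow_sub_rpow_le hδ hδ1 (by linarith [hx.1]) hy0).trans ?_
  have h1 : |2 * Real.sin (θ / 2) - 2 * Real.sin (θ₀ / 2)| ≤ |θ - θ₀| := by
    have := Real.abs_sin_sub_sin_le (θ / 2) (θ₀ / 2)
    rw [← mul_sub, abs_mul, abs_two]
    calc _ ≤ 2 * |θ / 2 - θ₀ / 2| := by gcongr
      _ = _ := by rw [← sub_div, abs_div, abs_two]; ring
  have h2 : (2 * Real.sin (θ₀ / 2)) ^ (δ - 1) ≤ 2 * (θ₀ ^ δ / θ₀) := by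
    calc _ ≤ (θ₀ / 2) ^ (δ - 1) :=
          Real.rpow_le_rpow_of_nonpos (by linarith) hy.1 (by linarith)
      _ = 2 * ((θ₀ / 2) ^ δ / θ₀) := by
          rw [Real.rpow_sub_one (by linarith)]; field_simp
      _ ≤ _ := by gcongr; linarith
  gcongr

theorem norm_exp_ofReal_mul_I_sub_le (x y : ℝ) : ‖cexp (x * I) - cexp (y * I)‖ ≤ |x - y| := by
  have h : cexp (x * I) - cexp (y * I) = cexp (y * I) * (cexp (I * ((x - y : ℝ) : ℂ)) - 1) := by
    rw [mul_sub, ← exp_add, mul_one]; congr 2; push_cast; ring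
  rw [h, norm_mul, norm_exp_ofReal_mul_I, one_mul]
  exact Real.norm_exp_I_mul_ofReal_sub_one_le

theorem norm_chordDir_sub_le {δ : ℝ} (hδ : 0 < δ) (hδ1 : δ < 1) (θ θ₀ : ℝ) :
    ‖chordDir δ θ - chordDir δ θ₀‖ ≤ |θ - θ₀| := by
  refine (norm_exp_ofReal_mul_I_sub_le _ _).trans ?_
  rw [← mul_sub, abs_mul, abs_of_pos hδ]
  have : θ / 2 - Real.pi / 2 - (θ₀ / 2 - Real.pi / 2) = (θ - θ₀) / 2 := by ring
  rw [this, abs_div, abs_two]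
  nlinarith [abs_nonneg (θ - θ₀)]

/-- The chord is 2|sin((θ-θ₀)/2)|. With θ₀ in the right half-circle the half-angle is at most 3π/4
in modulus, so the sine vanishes only at 0 and the jump of the argument at -1 does no harm. -/
theorem abs_sub_le_five_mul_norm {θ θ₀ : ℝ} (hθ : |θ| ≤ Real.pi) (hθ₀ : |θ₀| ≤ Real.pi / 2) :
    |θ - θ₀| ≤ 5 * ‖cexp (θ * I) - cexp (θ₀ * I)‖ := by
  have h : cexp (θ * I) - cexp (θ₀ * I) =
      cexp (θ₀ * I) * (cexp (I * ((θ - θ₀ : ℝ) : ℂ)) - 1) := by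
    rw [mul_sub, ← exp_add, mul_one]; congr 2; push_cast; ring
  rw [h, norm_mul, norm_exp_ofReal_mul_I, one_mul, norm_exp_I_mul_ofReal_sub_one, Real.norm_eq_abs,
    abs_mul, abs_two]
  have hpi := Real.pi_pos
  have key : ∀ y : ℝ, 0 ≤ y → y ≤ 3 * Real.pi / 4 → y ≤ 5 * |Real.sin y| := by
    intro y h0 hy
    rw [abs_of_nonneg (Real.sin_nonneg_of_nonneg_of_le_pi h0 (by linarith))]
    rcases le_total y (Real.pi / 2) with h | h
    · have h1 := Real.mul_le_sin h0 h
      have h2 : y / 2 ≤ 2 / Real.pi * y := by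
        rw [div_mul_eq_mul_div, div_le_div_iff₀ two_pos hpi]
        nlinarith [Real.pi_le_four]
      linarith
    · have h1 := Real.mul_le_sin (x := Real.pi - y) (by linarith) (by linarith)
      rw [Real.sin_pi_sub] at h1
      have h2 : 1 / 2 ≤ 2 / Real.pi * (Real.pi - y) := by
        rw [div_mul_eq_mul_div, le_div_iff₀ hpi]; linarith
      linarith [Real.pi_lt_d2]
  have h1 : |(θ - θ₀) / 2| ≤ 3 * Real.pi / 4 := by
    rw [abs_div, abs_two]
    have := abs_sub θ θ₀
    linarith
  have h2 := key _ (abs_nonneg _) h1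
  have h3 : |Real.sin (|(θ - θ₀) / 2|)| = |Real.sin ((θ - θ₀) / 2)| := by
    rcases abs_choice ((θ - θ₀) / 2) with h | h <;> rw [h]
    rw [Real.sin_neg, abs_neg]
  rw [h3, abs_div, abs_two] at h2
  linarith

/-! Estimates at a corner. -/

/-- The point `(θ, E(ξ) + (1 - ξ)^δ p)`, `ξ = e^{iθ}`. -/
noncomputable def cornerPoint (δ : ℝ) (E : ℂ → ℂ) (θ : ℝ) (p : ℂ) : ℝ × ℂ :=
  (θ, E (cexp (θ * I)) + chordPow δ θ * chordDir δ θ * p)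

/-- Quantitative data of the boundary value problem for `κ`, where `E(ξ) + (1 - ξ)^δ κ(ξ)` is a
zero of `g(θ, ·)` on the upper semicircle, `G` is the derivative of `g`, and `c` is a common
bound. -/
structure CornerBounds (β δ M c : ℝ) (g : ℝ × ℂ → ℝ) (G : ℝ × ℂ → ℝ × ℂ →L[ℝ] ℝ) (E κ : ℂ → ℂ) :
    Prop where
  β_pos : 0 < β
  β_le_half : β ≤ 1 / 2
  β_le : β ≤ δ
  β_le_one_sub : β ≤ 1 - δ
  one_le : 1 ≤ c
  le_bound : M ≤ c
  norm_le : ∀ z, ‖z‖ ≤ 1 → ‖κ z‖ ≤ M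
  E_sub : ∀ θ ∈ Icc 0 Real.pi, ∀ θ' ∈ Icc 0 Real.pi, ‖E (cexp (θ * I)) - E (cexp (θ' * I))‖ ≤
    c * (√θ + √θ') * √|θ - θ'|
  norm_G_le : ∀ θ ∈ Icc 0 Real.pi, ∀ p, ‖p‖ ≤ M → ‖G (cornerPoint δ E θ p)‖ ≤ c
  G_sub : ∀ θ ∈ Icc 0 Real.pi, ∀ p, ‖p‖ ≤ M → ∀ θ' ∈ Icc 0 Real.pi, ∀ p', ‖p'‖ ≤ M →
    ‖G (cornerPoint δ E θ p) - G (cornerPoint δ E θ' p')‖ ≤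
      c * ‖cornerPoint δ E θ p - cornerPoint δ E θ' p'‖
  taylor : ∀ θ ∈ Icc 0 Real.pi, ∀ p, ‖p‖ ≤ M → ∀ θ' ∈ Icc 0 Real.pi, ∀ p', ‖p'‖ ≤ M →
    |g (cornerPoint δ E θ p) - g (cornerPoint δ E θ' p') -
      G (cornerPoint δ E θ' p') (cornerPoint δ E θ p - cornerPoint δ E θ' p')| ≤
      c * ‖cornerPoint δ E θ p - cornerPoint δ E θ' p'‖ ^ 2
  upper : ∀ θ ∈ Icc 0 Real.pi, g (cornerPoint δ E θ (κ (cexp (θ * I)))) = 0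
  lower : ∀ θ ∈ Ioc 0 Real.pi,
    ((starRingEnd ℂ) (chordDir δ θ) * κ (cexp ((-θ : ℝ) * I))).im = 0
  tangent : ∃ l : ℝ, l ≠ 0 ∧ ∀ k : ℂ, G (cornerPoint δ E 0 0) (0, chordDir δ 0 * k) =
    l * ((starRingEnd ℂ) (chordDir δ 0) * k).im

theorem rpow_le_four {x a : ℝ} (hx : 0 < x) (hx4 : x ≤ 4) (ha : 0 ≤ a) (ha1 : a ≤ 1) :
    x ^ a ≤ 4 :=
  calc x ^ a ≤ 4 ^ a := by gcongr
    _ ≤ 4 ^ (1 : ℝ) := Real.rpow_le_rpow_of_exponent_le (by norm_num) ha1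
    _ = 4 := by simp

theorem mul_sq_le_of_mul_sq_le_four {β θ₀ r : ℝ} (hβ0 : 0 < β) (hβ : β ≤ 1 / 2)
    (h0 : 0 < θ₀) (h4 : θ₀ ≤ 4) (hr : 0 ≤ r) (h : θ₀ * r ^ 2 ≤ 4) :
    θ₀ * r ^ 2 ≤ 8 * (θ₀ ^ β * r) := by
  have hs : √θ₀ * √θ₀ = θ₀ := Real.mul_self_sqrt h0.le
  have hs0 : 0 < √θ₀ := Real.sqrt_pos.2 h0
  have h1 : √θ₀ * r ≤ 2 := by
    apply (sq_le_sq₀ (by positivity) (by norm_num)).1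
    rw [mul_pow, Real.sq_sqrt h0.le]; linarith
  have h2 : √θ₀ ≤ 4 * θ₀ ^ β := by
    rw [Real.sqrt_eq_rpow]
    have : θ₀ ^ (1 / 2 : ℝ) = θ₀ ^ (1 / 2 - β) * θ₀ ^ β := by
      rw [← Real.rpow_add h0]; ring_nf
    rw [this]
    have hb : 0 ≤ θ₀ ^ β := by positivity
    gcongr
    exact rpow_le_four h0 h4 (by linarith) (by linarith)
  calc θ₀ * r ^ 2 = (√θ₀ * r) * (√θ₀ * r) := by nlinarith
    _ ≤ 2 * ((4 * θ₀ ^ β) * r) := by gcongr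
    _ = _ := by ring

/-! ### Orders of magnitude near the corner -/

namespace CornerBounds

variable {β δ M c : ℝ} {g : ℝ × ℂ → ℝ} {G : ℝ × ℂ → ℝ × ℂ →L[ℝ] ℝ} {E κ : ℂ → ℂ}

theorem δ_pos (h : CornerBounds β δ M c g G E κ) : 0 < δ := h.β_pos.trans_le h.β_le

theorem δ_lt_one (h : CornerBounds β δ M c g G E κ) : δ < 1 := by
  linarith [h.β_pos, h.β_le_one_sub]

theorem c_pos (h : CornerBounds β δ M c g G E κ) : 0 < c := by linarith [h.one_le]

theorem chordPow_zero (h : CornerBounds β δ M c g G E κ) : chordPow δ 0 = 0 := by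
  simp [chordPow, Real.zero_rpow h.δ_pos.ne']

/-- The first inequality uses β ≤ 1-δ and the second β ≤ δ; they make linear errors and errors
θ^(2δ) of order θ^(β+δ). -/
theorem rpow_bounds (h : CornerBounds β δ M c g G E κ) {θ : ℝ} (h0 : 0 < θ) (h4 : θ ≤ 4) :
    θ ≤ 4 * (θ ^ β * θ ^ δ) ∧ θ ^ δ ≤ 4 * θ ^ β ∧ θ ^ β ≤ 4 ∧ θ ^ δ ≤ 4 := by
  have := h.β_pos
  have := h.β_le
  have := h.β_le_one_sub
  refine ⟨?_, ?_, rpow_le_four h0 h4 (by linarith) (by linarith),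
    rpow_le_four h0 h4 (by linarith) (by linarith)⟩
  · calc θ = θ ^ (1 - β - δ) * (θ ^ β * θ ^ δ) := by
          rw [← Real.rpow_add h0, ← Real.rpow_add h0]; simp
      _ ≤ _ := by gcongr; exact rpow_le_four h0 h4 (by linarith) (by linarith)
  · calc θ ^ δ = θ ^ (δ - β) * θ ^ β := by rw [← Real.rpow_add h0]; simp
      _ ≤ _ := by gcongr; exact rpow_le_four h0 h4 (by linarith) (by linarith)

theorem norm_E_sub_zero_le (h : CornerBounds β δ M c g G E κ) {θ : ℝ} (hθ : θ ∈ Icc 0 Real.pi) :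
    ‖E (cexp (θ * I)) - E (cexp ((0 : ℝ) * I))‖ ≤ c * θ := by
  have := h.E_sub θ hθ 0 ⟨le_rfl, Real.pi_pos.le⟩
  rwa [Real.sqrt_zero, add_zero, sub_zero, abs_of_nonneg hθ.1, mul_assoc,
    Real.mul_self_sqrt hθ.1] at this

theorem norm_chord_le (h : CornerBounds β δ M c g G E κ) {θ : ℝ} (hθ : θ ∈ Icc 0 Real.pi) :
    ‖(chordPow δ θ * chordDir δ θ : ℂ)‖ ≤ θ ^ δ := by
  rw [norm_mul, norm_chordDir, mul_one, norm_real, Real.norm_eq_abs, abs_of_nonneg]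
  · exact chordPow_le h.δ_pos hθ.1 hθ.2
  · refine le_trans ?_ (le_chordPow h.δ_pos h.δ_lt_one hθ.1 hθ.2)
    have := hθ.1
    positivity

theorem norm_cornerPoint_sub_zero_le (h : CornerBounds β δ M c g G E κ) {θ : ℝ}
    (hθ : θ ∈ Ioc 0 Real.pi) {p : ℂ} (hp : ‖p‖ ≤ M) :
    ‖cornerPoint δ E θ p - cornerPoint δ E 0 0‖ ≤ 17 * c * θ ^ δ := by
  have hc := h.one_le
  have hpc := hp.trans h.le_bound
  have h4 : θ ≤ 4 := hθ.2.trans Real.pi_le_four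
  obtain ⟨e1, e2, e3, e4⟩ := h.rpow_bounds hθ.1 h4
  have hD : 0 < θ ^ δ := Real.rpow_pos_of_pos hθ.1 _
  have hb : 0 < θ ^ β := Real.rpow_pos_of_pos hθ.1 _
  have hθD : θ ≤ 16 * θ ^ δ := by nlinarith
  have hE := h.norm_E_sub_zero_le (Ioc_subset_Icc_self hθ)
  have hP := h.norm_chord_le (Ioc_subset_Icc_self hθ)
  rw [Prod.norm_def, max_le_iff]
  constructor
  · simp only [cornerPoint, Prod.fst_sub, sub_zero, Real.norm_eq_abs, abs_of_pos hθ.1]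
    nlinarith
  · simp only [cornerPoint, Prod.snd_sub, mul_zero, add_zero]
    calc _ = ‖(E (cexp (θ * I)) - E (cexp ((0 : ℝ) * I))) + chordPow δ θ * chordDir δ θ * p‖ := by
          ring_nf
      _ ≤ _ := norm_add_le _ _
      _ ≤ c * θ + θ ^ δ * c := by rw [norm_mul]; gcongr
      _ ≤ _ := by nlinarith

/-- The parameter r = √(|θ-θ₀|/θ₀) measures distance relative to the corner. In these terms E,
although only Hölder of exponent 1/2, varies by O(θ₀r). -/
theorem norm_E_sub_near_le (h : CornerBounds β δ M c g G E κ) {θ θ₀ r : ℝ}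
    (hθ : θ ∈ Icc 0 Real.pi) (hθ₀ : θ₀ ∈ Ioc 0 Real.pi) (hr : 0 ≤ r) (hr1 : r ≤ 1)
    (hd : |θ - θ₀| = θ₀ * r ^ 2) :
    ‖E (cexp (θ * I)) - E (cexp (θ₀ * I))‖ ≤ 3 * c * (θ₀ * r) := by
  have hc := h.c_pos
  have h1 := h.E_sub θ hθ θ₀ (Ioc_subset_Icc_self hθ₀)
  have hs : √θ₀ * √θ₀ = θ₀ := Real.mul_self_sqrt hθ₀.1.le
  have h2 : √|θ - θ₀| = √θ₀ * r := by
    rw [hd, Real.sqrt_mul hθ₀.1.le, Real.sqrt_sq hr]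
  have h3 : √θ ≤ 2 * √θ₀ := by
    rw [show (2 : ℝ) = √4 by rw [show (4 : ℝ) = 2 ^ 2 by norm_num]; simp, ← Real.sqrt_mul (by norm_num)]
    apply Real.sqrt_le_sqrt
    have := le_abs_self (θ - θ₀)
    have : r ^ 2 ≤ 1 := pow_le_one₀ hr hr1
    nlinarith [hθ₀.1]
  rw [h2] at h1
  calc _ ≤ _ := h1
    _ ≤ c * (2 * √θ₀ + √θ₀) * (√θ₀ * r) := by gcongr
    _ = 3 * c * ((√θ₀ * √θ₀) * r) := by ring
    _ = _ := by rw [hs]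

theorem norm_chord_sub_le (h : CornerBounds β δ M c g G E κ) {θ θ₀ r : ℝ}
    (hθ : θ ∈ Icc 0 Real.pi) (hθ₀ : θ₀ ∈ Ioc 0 Real.pi)
    (hd : |θ - θ₀| = θ₀ * r ^ 2) :
    ‖(chordPow δ θ * chordDir δ θ - chordPow δ θ₀ * chordDir δ θ₀ : ℂ)‖ ≤
      6 * (θ₀ ^ δ * r ^ 2) := by
  have hm := abs_chordPow_sub_le h.δ_pos h.δ_lt_one hθ.1 hθ.2 hθ₀.1 hθ₀.2
  have hu := norm_chordDir_sub_le h.δ_pos h.δ_lt_one θ θ₀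
  have hP := h.norm_chord_le (Ioc_subset_Icc_self hθ₀)
  rw [norm_mul, norm_chordDir, mul_one] at hP
  have h4 : θ₀ ≤ 4 := hθ₀.2.trans Real.pi_le_four
  have e : 2 * (θ₀ ^ δ / θ₀) * (θ₀ * r ^ 2) = 2 * (θ₀ ^ δ * r ^ 2) := by
    have := hθ₀.1.ne'
    field_simp
  rw [hd, e] at hm
  rw [hd] at hu
  have : (chordPow δ θ * chordDir δ θ - chordPow δ θ₀ * chordDir δ θ₀ : ℂ) =
      ((chordPow δ θ - chordPow δ θ₀ : ℝ) : ℂ) * chordDir δ θ +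
        chordPow δ θ₀ * (chordDir δ θ - chordDir δ θ₀) := by push_cast; ring
  rw [this]
  have hD : 0 < θ₀ ^ δ := Real.rpow_pos_of_pos hθ₀.1 _
  calc _ ≤ _ := norm_add_le _ _
    _ ≤ 2 * (θ₀ ^ δ * r ^ 2) * 1 + θ₀ ^ δ * (θ₀ * r ^ 2) := by
        rw [norm_mul, norm_mul, norm_chordDir, norm_real, Real.norm_eq_abs]; gcongr
    _ ≤ 2 * (θ₀ ^ δ * r ^ 2) * 1 + θ₀ ^ δ * (4 * r ^ 2) := by gcongr
    _ = _ := by ring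

theorem norm_cornerPoint_sub_le (h : CornerBounds β δ M c g G E κ) {θ θ₀ r : ℝ}
    (hθ : θ ∈ Icc 0 Real.pi) (hθ₀ : θ₀ ∈ Ioc 0 Real.pi) (hr : 0 ≤ r) (hr1 : r ≤ 1)
    (hd : |θ - θ₀| = θ₀ * r ^ 2) {p : ℂ} (hp : ‖p‖ ≤ M) :
    ‖cornerPoint δ E θ p - cornerPoint δ E θ₀ p‖ ≤ 54 * c * (θ₀ ^ δ * r) := by
  have hc := h.one_le
  have hpc := hp.trans h.le_bound
  have h4 : θ₀ ≤ 4 := hθ₀.2.trans Real.pi_le_four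
  obtain ⟨e1, e2, e3, e4⟩ := h.rpow_bounds hθ₀.1 h4
  have hD : 0 < θ₀ ^ δ := Real.rpow_pos_of_pos hθ₀.1 _
  have hθD : θ₀ ≤ 16 * θ₀ ^ δ := by nlinarith
  have hr2 : r ^ 2 ≤ r := by nlinarith
  have hE := h.norm_E_sub_near_le hθ hθ₀ hr hr1 hd
  have hP := h.norm_chord_sub_le hθ hθ₀ hd
  have hDr : 0 ≤ θ₀ ^ δ * r := by positivity
  rw [Prod.norm_def, max_le_iff]
  constructor
  · simp only [cornerPoint, Prod.fst_sub, Real.norm_eq_abs, hd]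
    calc θ₀ * r ^ 2 ≤ (16 * θ₀ ^ δ) * r := by gcongr
      _ ≤ _ := by nlinarith
  · simp only [cornerPoint, Prod.snd_sub]
    calc _ = ‖(E (cexp (θ * I)) - E (cexp (θ₀ * I))) +
          (chordPow δ θ * chordDir δ θ - chordPow δ θ₀ * chordDir δ θ₀ : ℂ) * p‖ := by ring_nf
      _ ≤ _ := norm_add_le _ _
      _ ≤ 3 * c * (θ₀ * r) + 6 * (θ₀ ^ δ * r ^ 2) * c := by rw [norm_mul]; gcongr
      _ ≤ 3 * c * ((16 * θ₀ ^ δ) * r) + 6 * (θ₀ ^ δ * r) * c := by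
          have := h.c_pos
          gcongr
      _ = _ := by ring

/-- The part of `g` at a corner point that is of higher order at the corner. -/
noncomputable def remainder (δ : ℝ) (g : ℝ × ℂ → ℝ) (G : ℝ × ℂ → ℝ × ℂ →L[ℝ] ℝ) (E : ℂ → ℂ)
    (θ : ℝ) (p : ℂ) : ℝ :=
  g (cornerPoint δ E θ p) - G (cornerPoint δ E 0 0) (0, chordPow δ θ * chordDir δ θ * p)

theorem abs_apply_le (L : ℝ × ℂ →L[ℝ] ℝ) {a : ℝ} (ha : ‖L‖ ≤ a) {x : ℝ × ℂ} {b : ℝ}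
    (hb : ‖x‖ ≤ b) : |L x| ≤ a * b := by
  rw [← Real.norm_eq_abs]
  exact (L.le_opNorm x).trans (mul_le_mul ha hb (norm_nonneg _) ((norm_nonneg _).trans ha))

theorem zero_mem (_ : CornerBounds β δ M c g G E κ) : (0 : ℝ) ∈ Icc 0 Real.pi :=
  ⟨le_rfl, Real.pi_pos.le⟩

theorem norm_zero_le (h : CornerBounds β δ M c g G E κ) : ‖(0 : ℂ)‖ ≤ M := by
  exact norm_zero.trans_le ((norm_nonneg _).trans (h.norm_le 0 (by simp)))

theorem norm_G_zero_le (h : CornerBounds β δ M c g G E κ) : ‖G (cornerPoint δ E 0 0)‖ ≤ c :=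
  h.norm_G_le 0 h.zero_mem 0 h.norm_zero_le

theorem g_zero (h : CornerBounds β δ M c g G E κ) : g (cornerPoint δ E 0 0) = 0 := by
  have := h.upper 0 h.zero_mem
  simpa [cornerPoint, h.chordPow_zero] using this

/-- The Taylor error is the square of a displacement O(θ^δ), and the increments of θ and of E
contribute O(θ). -/
theorem abs_remainder_le (h : CornerBounds β δ M c g G E κ) :
    ∃ C > 0, ∀ θ ∈ Ioc 0 Real.pi, ∀ p, ‖p‖ ≤ M → |remainder δ g G E θ p| ≤ C * (θ ^ β * θ ^ δ) := by
  have hc := h.one_le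
  have hc0 := h.c_pos
  refine ⟨c * (17 * c) ^ 2 * 4 + c * c * 4, by positivity, ?_⟩
  intro θ hθ p hp
  have h4 : θ ≤ 4 := hθ.2.trans Real.pi_le_four
  obtain ⟨e1, e2, e3, e4⟩ := h.rpow_bounds hθ.1 h4
  have hD : 0 < θ ^ δ := Real.rpow_pos_of_pos hθ.1 _
  have hb : 0 < θ ^ β := Real.rpow_pos_of_pos hθ.1 _
  have hθ' := Ioc_subset_Icc_self hθ
  have t := h.taylor θ hθ' p hp 0 h.zero_mem 0 h.norm_zero_le
  rw [h.g_zero] at t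
  have hx := h.norm_cornerPoint_sub_zero_le hθ hp
  have hsplit : cornerPoint δ E θ p - cornerPoint δ E 0 0 =
      (θ, E (cexp (θ * I)) - E (cexp ((0 : ℝ) * I))) +
        ((0 : ℝ), chordPow δ θ * chordDir δ θ * p) := by
    ext1 <;> simp [cornerPoint]
    ring
  have hn : ‖((θ, E (cexp (θ * I)) - E (cexp ((0 : ℝ) * I))) : ℝ × ℂ)‖ ≤ c * θ := by
    rw [Prod.norm_def, max_le_iff]
    refine ⟨?_, h.norm_E_sub_zero_le hθ'⟩
    simp only [Real.norm_eq_abs, abs_of_pos hθ.1]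
    nlinarith [hθ.1]
  have hl := abs_apply_le _ h.norm_G_zero_le hn
  have hr : remainder δ g G E θ p = (g (cornerPoint δ E θ p) - 0 -
      G (cornerPoint δ E 0 0) (cornerPoint δ E θ p - cornerPoint δ E 0 0)) +
      G (cornerPoint δ E 0 0) (θ, E (cexp (θ * I)) - E (cexp ((0 : ℝ) * I))) := by
    rw [hsplit, map_add, remainder]; ring
  rw [hr]
  calc _ ≤ _ := abs_add_le _ _
    _ ≤ c * (17 * c * θ ^ δ) ^ 2 + c * (c * θ) := by
        refine add_le_add (t.trans ?_) hl
        gcongr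
    _ = c * (17 * c) ^ 2 * (θ ^ δ * θ ^ δ) + c * c * θ := by ring
    _ ≤ c * (17 * c) ^ 2 * ((4 * θ ^ β) * θ ^ δ) + c * c * (4 * (θ ^ β * θ ^ δ)) := by gcongr
    _ = _ := by ring

/-- Expanding at θ₀, where G differs from its corner value by O(θ₀^δ), while the displacement is
O(θ₀^δ r), produces θ₀^(2δ)r. The increments of θ and of E give θ₀r. -/
theorem abs_remainder_sub_le (h : CornerBounds β δ M c g G E κ) :
    ∃ C > 0, ∀ θ ∈ Icc 0 Real.pi, ∀ θ₀ ∈ Ioc 0 Real.pi, ∀ r : ℝ, 0 ≤ r → r ≤ 1 →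
      |θ - θ₀| = θ₀ * r ^ 2 → ∀ p, ‖p‖ ≤ M →
      |remainder δ g G E θ p - remainder δ g G E θ₀ p| ≤ C * (θ₀ ^ β * θ₀ ^ δ * r) := by
  have hc := h.one_le
  have hc0 := h.c_pos
  refine ⟨c * (54 * c) ^ 2 * 4 + c * (17 * c) * (54 * c) * 4 + c * (3 * c) * 4, by positivity, ?_⟩
  intro θ hθ θ₀ hθ₀ r hr hr1 hd p hp
  have h4 : θ₀ ≤ 4 := hθ₀.2.trans Real.pi_le_four
  obtain ⟨e1, e2, e3, e4⟩ := h.rpow_bounds hθ₀.1 h4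
  have hD : 0 < θ₀ ^ δ := Real.rpow_pos_of_pos hθ₀.1 _
  have hb : 0 < θ₀ ^ β := Real.rpow_pos_of_pos hθ₀.1 _
  have hθ₀' := Ioc_subset_Icc_self hθ₀
  have t := h.taylor θ hθ p hp θ₀ hθ₀' p hp
  have hxy := h.norm_cornerPoint_sub_le hθ hθ₀ hr hr1 hd hp
  have hG := h.G_sub θ₀ hθ₀' p hp 0 h.zero_mem 0 h.norm_zero_le
  have hy := h.norm_cornerPoint_sub_zero_le hθ₀ hp
  have hr2 : r ^ 2 ≤ r := by nlinarith
  have hsplit : cornerPoint δ E θ p - cornerPoint δ E θ₀ p =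
      (θ - θ₀, E (cexp (θ * I)) - E (cexp (θ₀ * I))) +
        ((0 : ℝ), chordPow δ θ * chordDir δ θ * p) -
        ((0 : ℝ), chordPow δ θ₀ * chordDir δ θ₀ * p) := by
    ext1 <;> simp [cornerPoint]
    ring
  have hn : ‖((θ - θ₀, E (cexp (θ * I)) - E (cexp (θ₀ * I))) : ℝ × ℂ)‖ ≤ 3 * c * (θ₀ * r) := by
    rw [Prod.norm_def, max_le_iff]
    refine ⟨?_, h.norm_E_sub_near_le hθ hθ₀ hr hr1 hd⟩
    simp only [Real.norm_eq_abs, hd]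
    have : 0 ≤ θ₀ * r := mul_nonneg hθ₀.1.le hr
    calc θ₀ * r ^ 2 ≤ θ₀ * r := mul_le_mul_of_nonneg_left hr2 hθ₀.1.le
      _ ≤ _ := by nlinarith
  have hl := abs_apply_le _ h.norm_G_zero_le hn
  have hl2 := abs_apply_le _ (hG.trans (mul_le_mul_of_nonneg_left hy hc0.le)) hxy
  have hr : remainder δ g G E θ p - remainder δ g G E θ₀ p =
      (g (cornerPoint δ E θ p) - g (cornerPoint δ E θ₀ p) -
      G (cornerPoint δ E θ₀ p) (cornerPoint δ E θ p - cornerPoint δ E θ₀ p)) +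
      (G (cornerPoint δ E θ₀ p) - G (cornerPoint δ E 0 0))
        (cornerPoint δ E θ p - cornerPoint δ E θ₀ p) +
      G (cornerPoint δ E 0 0) (θ - θ₀, E (cexp (θ * I)) - E (cexp (θ₀ * I))) := by
    have : G (cornerPoint δ E 0 0) (cornerPoint δ E θ p - cornerPoint δ E θ₀ p) =
      G (cornerPoint δ E 0 0) (θ - θ₀, E (cexp (θ * I)) - E (cexp (θ₀ * I))) +
      G (cornerPoint δ E 0 0) ((0 : ℝ), chordPow δ θ * chordDir δ θ * p) -
      G (cornerPoint δ E 0 0) ((0 : ℝ), chordPow δ θ₀ * chordDir δ θ₀ * p) := by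
      rw [hsplit, map_sub, map_add]
    rw [sub_apply, this, remainder, remainder]; ring
  rw [hr]
  calc _ ≤ _ := abs_add_three _ _ _
    _ ≤ c * (54 * c * (θ₀ ^ δ * r)) ^ 2 + c * (17 * c * θ₀ ^ δ) * (54 * c * (θ₀ ^ δ * r)) +
        c * (3 * c * (θ₀ * r)) := by
        refine add_le_add (add_le_add (t.trans ?_) hl2) hl
        gcongr
    _ = c * (54 * c) ^ 2 * (θ₀ ^ δ * θ₀ ^ δ * r ^ 2) +
        c * (17 * c) * (54 * c) * (θ₀ ^ δ * θ₀ ^ δ * r) + c * (3 * c) * (θ₀ * r) := by ring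
    _ ≤ c * (54 * c) ^ 2 * ((4 * θ₀ ^ β) * θ₀ ^ δ * r) +
        c * (17 * c) * (54 * c) * ((4 * θ₀ ^ β) * θ₀ ^ δ * r) +
        c * (3 * c) * (4 * (θ₀ ^ β * θ₀ ^ δ) * r) := by gcongr
    _ = _ := by ring

end CornerBounds

/-! ### The boundary condition divided by the modulus of the power, and its linearization -/

namespace CornerBounds

variable {β δ M c : ℝ} {g : ℝ × ℂ → ℝ} {G : ℝ × ℂ → ℝ × ℂ →L[ℝ] ℝ} {E κ : ℂ → ℂ}

theorem chordPow_pos (h : CornerBounds β δ M c g G E κ) {θ : ℝ} (hθ : θ ∈ Ioc 0 Real.pi) :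
    0 < chordPow δ θ := by
  have := le_chordPow h.δ_pos h.δ_lt_one hθ.1.le hθ.2
  have : 0 < θ ^ δ := Real.rpow_pos_of_pos hθ.1 _
  linarith

theorem apply_real_mul (L : ℝ × ℂ →L[ℝ] ℝ) (m : ℝ) (u p : ℂ) :
    L ((0 : ℝ), (m : ℂ) * u * p) = m * L (0, u * p) := by
  have : (((0 : ℝ), (m : ℂ) * u * p) : ℝ × ℂ) = m • ((0 : ℝ), u * p) := by
    ext1
    · simp
    · simp [mul_assoc]
  rw [this, map_smul, smul_eq_mul]

theorem apply_zero_sub (L : ℝ × ℂ →L[ℝ] ℝ) (v w : ℂ) :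
    L ((0 : ℝ), v - w) = L (0, v) - L (0, w) := by
  rw [← map_sub]; congr 1; ext1 <;> simp

theorem abs_apply_zero_le (L : ℝ × ℂ →L[ℝ] ℝ) {a : ℝ} (ha : ‖L‖ ≤ a) {v : ℂ} {b : ℝ}
    (hb : ‖v‖ ≤ b) : |L ((0 : ℝ), v)| ≤ a * b :=
  abs_apply_le L ha (by rw [Prod.norm_def]; simpa using hb)

theorem div_chordPow_eq (h : CornerBounds β δ M c g G E κ) {θ : ℝ} (hθ : θ ∈ Ioc 0 Real.pi) (p : ℂ) :
    g (cornerPoint δ E θ p) / chordPow δ θ = remainder δ g G E θ p / chordPow δ θ +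
      G (cornerPoint δ E 0 0) (0, chordDir δ θ * p) := by
  have hm := (h.chordPow_pos hθ).ne'
  rw [remainder, apply_real_mul]
  field_simp
  ring

theorem abs_remainder_div_le (h : CornerBounds β δ M c g G E κ) :
    ∃ C > 0, ∀ θ ∈ Ioc 0 Real.pi, ∀ p, ‖p‖ ≤ M →
      |remainder δ g G E θ p / chordPow δ θ| ≤ C * θ ^ β := by
  obtain ⟨C, hC, hX⟩ := h.abs_remainder_le
  refine ⟨2 * C, by positivity, fun θ hθ p hp => ?_⟩
  have hm := h.chordPow_pos hθ
  have hm' := le_chordPow h.δ_pos h.δ_lt_one hθ.1.le hθ.2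
  have hb : 0 < θ ^ β := Real.rpow_pos_of_pos hθ.1 _
  rw [abs_div, abs_of_pos hm, div_le_iff₀ hm]
  calc _ ≤ _ := hX θ hθ p hp
    _ = 2 * C * θ ^ β * (1 / 2 * θ ^ δ) := by ring
    _ ≤ _ := by gcongr

theorem abs_remainder_div_sub_le (h : CornerBounds β δ M c g G E κ) :
    ∃ C > 0, ∀ θ ∈ Ioc 0 Real.pi, ∀ θ₀ ∈ Ioc 0 Real.pi, ∀ r : ℝ, 0 ≤ r → r ≤ 1 → θ₀ / 2 ≤ θ →
      |θ - θ₀| = θ₀ * r ^ 2 → ∀ p, ‖p‖ ≤ M →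
      |remainder δ g G E θ p / chordPow δ θ - remainder δ g G E θ₀ p / chordPow δ θ₀| ≤
        C * (θ₀ ^ β * r) := by
  obtain ⟨C₁, hC₁, hX⟩ := h.abs_remainder_div_le
  obtain ⟨C₂, hC₂, hXX⟩ := h.abs_remainder_sub_le
  refine ⟨4 * C₂ + 8 * C₁, by positivity, ?_⟩
  intro θ hθ θ₀ hθ₀ r hr hr1 hθθ hd p hp
  have hm := h.chordPow_pos hθ
  have hm0 := h.chordPow_pos hθ₀
  have hD : 0 < θ₀ ^ δ := Real.rpow_pos_of_pos hθ₀.1 _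
  have hb : 0 < θ₀ ^ β := Real.rpow_pos_of_pos hθ₀.1 _
  have hml : 1 / 4 * θ₀ ^ δ ≤ chordPow δ θ := by
    have h1 := le_chordPow h.δ_pos h.δ_lt_one hθ.1.le hθ.2
    have h2 := half_rpow_le h.δ_lt_one hθ₀.1.le
    have h3 : (θ₀ / 2) ^ δ ≤ θ ^ δ :=
      Real.rpow_le_rpow (by linarith [hθ₀.1]) hθθ h.δ_pos.le
    linarith
  have hmm := abs_chordPow_sub_le h.δ_pos h.δ_lt_one hθ.1.le hθ.2 hθ₀.1 hθ₀.2
  have e : 2 * (θ₀ ^ δ / θ₀) * (θ₀ * r ^ 2) = 2 * (θ₀ ^ δ * r ^ 2) := by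
    have := hθ₀.1.ne'
    field_simp
  rw [hd, e] at hmm
  have hr2 : r ^ 2 ≤ r := by nlinarith
  have h1 := hXX θ (Ioc_subset_Icc_self hθ) θ₀ hθ₀ r hr hr1 hd p hp
  have h2 := hX θ₀ hθ₀ p hp
  set X := remainder δ g G E θ p
  set X₀ := remainder δ g G E θ₀ p
  set m := chordPow δ θ
  set m₀ := chordPow δ θ₀
  have key : X / m - X₀ / m₀ = ((X - X₀) - X₀ / m₀ * (m - m₀)) / m := by
    field_simp; ring
  rw [key, abs_div, abs_of_pos hm, div_le_iff₀ hm]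
  calc |(X - X₀) - X₀ / m₀ * (m - m₀)| ≤ |X - X₀| + |X₀ / m₀| * |m - m₀| := by
        rw [← abs_mul]; exact abs_sub _ _
    _ ≤ C₂ * (θ₀ ^ β * θ₀ ^ δ * r) + (C₁ * θ₀ ^ β) * (2 * (θ₀ ^ δ * r)) := by
        refine add_le_add h1 (mul_le_mul h2 (hmm.trans ?_) (abs_nonneg _) (by positivity))
        gcongr
    _ = (4 * C₂ + 8 * C₁) * (θ₀ ^ β * r) * (1 / 4 * θ₀ ^ δ) := by ring
    _ ≤ _ := by gcongr

theorem abs_im_conj_chordDir_sub_le (h : CornerBounds β δ M c g G E κ) (θ θ₀ : ℝ) {k : ℂ}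
    (hk : ‖k‖ ≤ M) : |((starRingEnd ℂ) (chordDir δ θ) * k).im -
      ((starRingEnd ℂ) (chordDir δ θ₀) * k).im| ≤ |θ - θ₀| * c := by
  rw [← sub_im, ← sub_mul, ← map_sub]
  refine (abs_im_le_norm _).trans ?_
  rw [norm_mul, norm_conj]
  exact mul_le_mul (norm_chordDir_sub_le h.δ_pos h.δ_lt_one _ _) (hk.trans h.le_bound) (norm_nonneg _) (abs_nonneg _)

theorem norm_κ_exp_le (h : CornerBounds β δ M c g G E κ) (θ : ℝ) : ‖κ (cexp (θ * I))‖ ≤ M :=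
  h.norm_le _ (norm_exp_ofReal_mul_I θ).le

/-- Both arcs give the same condition at the corner up to O(|θ|^β). Above, the divided equation is a
remainder plus G(0, uκ), and `tangent` identifies the latter at u(0) with a multiple of this
imaginary part. Below, the exact condition changes by O(|θ|) when u(θ) is replaced by u(0). -/
theorem abs_im_le (h : CornerBounds β δ M c g G E κ) (hκ : InDiscAlgebra κ) :
    ∃ C > 0, ∀ θ ∈ Icc (-Real.pi) Real.pi,
      |((starRingEnd ℂ) (chordDir δ 0) * κ (cexp (θ * I))).im| ≤ C * |θ| ^ β := by
  obtain ⟨C₁, hC₁, hX⟩ := h.abs_remainder_div_le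
  obtain ⟨l, hl, htan⟩ := h.tangent
  have hc := h.c_pos
  have hl0 : 0 < |l| := abs_pos.2 hl
  set C := (C₁ + c * c * 16) / |l| + 16 * c with hCdef
  have hθb : ∀ θ ∈ Ioc 0 Real.pi, θ ≤ 16 * θ ^ β := by
    intro θ hθ
    obtain ⟨e1, e2, e3, e4⟩ := h.rpow_bounds hθ.1 (hθ.2.trans Real.pi_le_four)
    have hb : 0 < θ ^ β := Real.rpow_pos_of_pos hθ.1 _
    nlinarith
  have hpos : ∀ θ ∈ Ioc 0 Real.pi,
      |((starRingEnd ℂ) (chordDir δ 0) * κ (cexp (θ * I))).im| ≤ C * |θ| ^ β := by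
    intro θ hθ
    set k := κ (cexp (θ * I)) with hk
    have hkc : ‖k‖ ≤ M := h.norm_κ_exp_le θ
    have hb : 0 < θ ^ β := Real.rpow_pos_of_pos hθ.1 _
    have h0 := h.div_chordPow_eq hθ k
    rw [h.upper θ (Ioc_subset_Icc_self hθ), zero_div] at h0
    have h1 := hX θ hθ k hkc
    have h2 : |G (cornerPoint δ E 0 0) (0, chordDir δ 0 * k - chordDir δ θ * k)| ≤
        c * (θ * c) := by
      apply abs_apply_zero_le _ h.norm_G_zero_le
      rw [← sub_mul, norm_mul]
      have := norm_chordDir_sub_le h.δ_pos h.δ_lt_one 0 θ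
      rw [zero_sub, abs_neg, abs_of_pos hθ.1] at this
      exact mul_le_mul this (hkc.trans h.le_bound) (norm_nonneg _) hθ.1.le
    rw [apply_zero_sub] at h2
    have h3 := htan k
    have h4 : |l| * |((starRingEnd ℂ) (chordDir δ 0) * k).im| ≤ (C₁ + c * c * 16) * θ ^ β := by
      rw [← abs_mul, ← h3]
      have : G (cornerPoint δ E 0 0) (0, chordDir δ 0 * k) =
        (G (cornerPoint δ E 0 0) (0, chordDir δ 0 * k) -
          G (cornerPoint δ E 0 0) (0, chordDir δ θ * k)) -
          remainder δ g G E θ k / chordPow δ θ := by linarith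
      rw [this]
      calc _ ≤ _ := abs_sub _ _
        _ ≤ c * (θ * c) + C₁ * θ ^ β := add_le_add h2 h1
        _ ≤ c * ((16 * θ ^ β) * c) + C₁ * θ ^ β := by gcongr; exact hθb θ hθ
        _ = _ := by ring
    rw [abs_of_pos hθ.1]
    have h5 : |((starRingEnd ℂ) (chordDir δ 0) * k).im| ≤ (C₁ + c * c * 16) / |l| * θ ^ β := by
      rw [div_mul_eq_mul_div, le_div_iff₀ hl0]; linarith
    refine h5.trans ?_
    rw [hCdef]
    have : 0 ≤ 16 * c * θ ^ β := by positivity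
    linarith
  refine ⟨C, by positivity, ?_⟩
  intro θ hθ
  rcases lt_trichotomy θ 0 with hneg | rfl | hp
  · have hφ : -θ ∈ Ioc 0 Real.pi := ⟨by linarith, by linarith [hθ.1]⟩
    have h1 := h.lower (-θ) hφ
    rw [neg_neg] at h1
    have h2 := h.abs_im_conj_chordDir_sub_le 0 (-θ) (h.norm_κ_exp_le θ)
    rw [h1, sub_zero, zero_sub, neg_neg] at h2
    have hb : 0 < |θ| ^ β := Real.rpow_pos_of_pos (abs_pos.2 hneg.ne) _
    have h3 := hθb (-θ) hφ
    rw [← abs_of_neg hneg] at h3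
    calc _ ≤ _ := h2
      _ ≤ (16 * |θ| ^ β) * c := by gcongr
      _ ≤ _ := by
        rw [hCdef]
        have : 0 ≤ (C₁ + c * c * 16) / |l| * |θ| ^ β := by positivity
        linarith
  -- At θ = 0 the power vanishes and the boundary equation says nothing about κ; the bound there is
  -- a limit from θ > 0.
  · have hcl : closure (Ioc 0 Real.pi) = Icc 0 Real.pi := closure_Ioc Real.pi_pos.ne
    have hcont : ContinuousOn (fun θ : ℝ => κ (cexp (θ * I))) (Icc 0 Real.pi) :=
      hκ.1.comp (by fun_prop) (fun θ _ => by simp [norm_exp_ofReal_mul_I])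
    exact le_on_closure hpos
      (by
        rw [hcl]
        exact (continuous_im.comp_continuousOn (continuousOn_const.mul hcont)).abs)
      (by
        refine (continuous_const.mul ?_).continuousOn
        exact continuous_abs.rpow_const (fun x => Or.inr h.β_pos.le))
      (by rw [hcl]; exact h.zero_mem)
  · exact hpos θ ⟨hp, hθ.2⟩

theorem sq_rpow_le (h : CornerBounds β δ M c g G E κ) {r : ℝ} (hr : 0 ≤ r) (hr2 : 1 / 2 ≤ r ^ 2) :
    (r ^ 2) ^ β ≤ 2 * r := by
  rcases le_total r 1 with h1 | h1
  · have : (r ^ 2) ^ β ≤ 1 := Real.rpow_le_one (by positivity) (pow_le_one₀ hr h1) h.β_pos.le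
    nlinarith
  · have h2 : (1 : ℝ) ≤ r ^ 2 := one_le_pow₀ h1
    calc (r ^ 2) ^ β ≤ (r ^ 2) ^ (1 / 2 : ℝ) :=
          Real.rpow_le_rpow_of_exponent_le h2 h.β_le_half
      _ = r := by rw [← Real.sqrt_eq_rpow, Real.sqrt_sq hr]
      _ ≤ _ := by linarith

/-- Linearized boundary condition at a point of the lower semicircle near the corner. -/
theorem abs_linear_lower_le (h : CornerBounds β δ M c g G E κ) (hκ : InDiscAlgebra κ) :
    ∃ C > 0, ∀ θ₀ ∈ Ioc 0 (Real.pi / 2), ∀ θ ∈ Icc (-Real.pi) Real.pi, ∀ r : ℝ, 0 ≤ r →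
      |θ + θ₀| = θ₀ * r ^ 2 →
      |((starRingEnd ℂ) (chordDir δ θ₀) * κ (cexp (θ * I))).im| ≤ C * (θ₀ ^ β * r) := by
  obtain ⟨C, hC, hV⟩ := h.abs_im_le hκ
  have hc := h.c_pos
  refine ⟨2 * C + 16 * c, by positivity, ?_⟩
  intro θ₀ hθ₀ θ hθ r hr hd
  have hpi := Real.pi_pos
  have hpi4 := Real.pi_le_four
  have h4 : θ₀ ≤ 4 := by linarith [hθ₀.2]
  have hb : 0 < θ₀ ^ β := Real.rpow_pos_of_pos hθ₀.1 _
  have hbr : 0 ≤ θ₀ ^ β * r := by positivity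
  rcases lt_or_ge θ 0 with hneg | hp
  · have hφ : -θ ∈ Ioc 0 Real.pi := ⟨by linarith, by linarith [hθ.1]⟩
    have h1 := h.lower (-θ) hφ
    rw [neg_neg] at h1
    have h2 := h.abs_im_conj_chordDir_sub_le θ₀ (-θ) (h.norm_κ_exp_le θ)
    rw [h1, sub_zero, sub_neg_eq_add, add_comm θ₀, hd] at h2
    have h3 : θ₀ * r ^ 2 ≤ 4 := by
      rw [← hd, abs_le]; constructor <;> linarith [hθ₀.1, hθ₀.2, hθ.1]
    have h5 := mul_sq_le_of_mul_sq_le_four h.β_pos h.β_le_half hθ₀.1 h4 hr h3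
    calc _ ≤ _ := h2
      _ ≤ (8 * (θ₀ ^ β * r)) * c := by gcongr
      _ ≤ _ := by nlinarith [mul_nonneg hC.le hbr, mul_nonneg hc.le hbr]
  -- The point lies across the corner from e^{-iθ₀}. Hence r ≥ 1, and the corner bound suffices
  -- because θ ≤ θ₀r².
  · rw [abs_of_nonneg (by linarith [hθ₀.1])] at hd
    have hr1 : 1 ≤ r ^ 2 := by
      have := hθ₀.1
      by_contra hcon
      nlinarith
    have hr1' : 1 ≤ r := by nlinarith
    have h1 := hV θ hθ
    rw [abs_of_nonneg hp] at h1
    have h2 : θ ^ β ≤ θ₀ ^ β * (2 * r) := by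
      calc θ ^ β ≤ (θ₀ * r ^ 2) ^ β :=
            Real.rpow_le_rpow hp (by linarith [hθ₀.1]) h.β_pos.le
        _ = θ₀ ^ β * (r ^ 2) ^ β := Real.mul_rpow hθ₀.1.le (by positivity)
        _ ≤ _ := by gcongr; exact h.sq_rpow_le hr (by linarith)
    have h3 := h.abs_im_conj_chordDir_sub_le θ₀ 0 (h.norm_κ_exp_le θ)
    rw [sub_zero, abs_of_pos hθ₀.1] at h3
    obtain ⟨e1, e2, e3, e4⟩ := h.rpow_bounds hθ₀.1 h4
    have hθb : θ₀ ≤ 16 * (θ₀ ^ β * r) := by nlinarith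
    have h5 := abs_sub_abs_le_abs_sub ((starRingEnd ℂ) (chordDir δ θ₀) * κ (cexp (θ * I))).im
      ((starRingEnd ℂ) (chordDir δ 0) * κ (cexp (θ * I))).im
    calc _ ≤ C * θ ^ β + θ₀ * c := by linarith
      _ ≤ C * (θ₀ ^ β * (2 * r)) + (16 * (θ₀ ^ β * r)) * c := by gcongr
      _ = _ := by ring

/-- Taylor expansion in the second variable at (θ, p), divided by m(θ), leaves the quadratic error
m|κ-p|². Replacing θ by θ₀ in each remaining term costs O(θ₀^β r). The condition θ ≥ θ₀/2 keeps m(θ)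
comparable to m(θ₀). -/
theorem abs_linear_upper_near_le (h : CornerBounds β δ M c g G E κ) :
    ∃ C > 0, ∀ θ₀ ∈ Ioc 0 Real.pi, ∀ θ ∈ Ioc 0 Real.pi, ∀ r : ℝ, 0 ≤ r → r ≤ 1 → θ₀ / 2 ≤ θ →
      |θ - θ₀| = θ₀ * r ^ 2 → ∀ p, ‖p‖ ≤ M →
      |g (cornerPoint δ E θ₀ p) / chordPow δ θ₀ +
        G (cornerPoint δ E θ₀ p) (0, chordDir δ θ₀ * (κ (cexp (θ * I)) - p))| ≤
        C * (θ₀ ^ β * r + ‖κ (cexp (θ * I)) - p‖ ^ 2) := by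
  obtain ⟨C, hC, hXX⟩ := h.abs_remainder_div_sub_le
  have hc := h.one_le
  have hc0 := h.c_pos
  refine ⟨c * 4 + (C + c * 16 * c + c * (54 * c) * 4 * (2 * c) + c * (16 * (2 * c))),
    by positivity, ?_⟩
  intro θ₀ hθ₀ θ hθ r hr hr1 hθθ hd p hp
  set k := κ (cexp (θ * I)) with hk
  have hkc : ‖k‖ ≤ M := h.norm_κ_exp_le θ
  have hpc := hp.trans h.le_bound
  have hkc' := hkc.trans h.le_bound
  have hkp : ‖k - p‖ ≤ 2 * c := by have := norm_sub_le k p; linarith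
  have h4 : θ₀ ≤ 4 := hθ₀.2.trans Real.pi_le_four
  obtain ⟨e1, e2, e3, e4⟩ := h.rpow_bounds hθ₀.1 h4
  have hD : 0 < θ₀ ^ δ := Real.rpow_pos_of_pos hθ₀.1 _
  have hb : 0 < θ₀ ^ β := Real.rpow_pos_of_pos hθ₀.1 _
  have hm := h.chordPow_pos hθ
  have hθ' := Ioc_subset_Icc_self hθ
  have hθ₀' := Ioc_subset_Icc_self hθ₀
  have hr2 : r ^ 2 ≤ r := by nlinarith
  have hθr : θ₀ * r ^ 2 ≤ 16 * (θ₀ ^ β * r) := by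
    calc θ₀ * r ^ 2 ≤ (4 * (θ₀ ^ β * θ₀ ^ δ)) * r := by gcongr
      _ ≤ (4 * (θ₀ ^ β * 4)) * r := by gcongr
      _ = _ := by ring
  have hu := norm_chordDir_sub_le h.δ_pos h.δ_lt_one θ θ₀
  rw [hd] at hu
  -- the Taylor expansion at `(θ, p)`
  have t := h.taylor θ hθ' k hkc θ hθ' p hp
  rw [h.upper θ hθ'] at t
  have hdiff : cornerPoint δ E θ k - cornerPoint δ E θ p =
      ((0 : ℝ), (chordPow δ θ : ℂ) * chordDir δ θ * (k - p)) := by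
    ext1 <;> simp [cornerPoint]
    ring
  have hnd : ‖cornerPoint δ E θ k - cornerPoint δ E θ p‖ = chordPow δ θ * ‖k - p‖ := by
    rw [hdiff, Prod.norm_def]
    simp only [norm_zero, norm_mul, norm_chordDir, mul_one, norm_real, Real.norm_eq_abs,
      abs_of_pos hm]
    exact max_eq_right (by positivity)
  rw [hnd, hdiff, apply_real_mul] at t
  have hmc : chordPow δ θ ≤ 4 := by
    refine (chordPow_le h.δ_pos hθ.1.le hθ.2).trans ?_
    exact (h.rpow_bounds hθ.1 (hθ.2.trans Real.pi_le_four)).2.2.2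
  have t1 : |g (cornerPoint δ E θ p) / chordPow δ θ +
      G (cornerPoint δ E θ p) (0, chordDir δ θ * (k - p))| ≤ c * 4 * ‖k - p‖ ^ 2 := by
    have : g (cornerPoint δ E θ p) / chordPow δ θ +
        G (cornerPoint δ E θ p) (0, chordDir δ θ * (k - p)) =
        -(0 - g (cornerPoint δ E θ p) - chordPow δ θ *
          G (cornerPoint δ E θ p) (0, chordDir δ θ * (k - p))) / chordPow δ θ := by
      field_simp; ring
    rw [this, abs_div, abs_neg, abs_of_pos hm, div_le_iff₀ hm]
    calc _ ≤ _ := t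
      _ = c * chordPow δ θ * ‖k - p‖ ^ 2 * chordPow δ θ := by ring
      _ ≤ _ := by gcongr
  have t2 := hXX θ hθ θ₀ hθ₀ r hr hr1 hθθ hd p hp
  have t3 : |G (cornerPoint δ E 0 0) (0, chordDir δ θ * p - chordDir δ θ₀ * p)| ≤
      c * (16 * (θ₀ ^ β * r) * c) := by
    apply abs_apply_zero_le _ h.norm_G_zero_le
    rw [← sub_mul, norm_mul]
    have := hu.trans hθr
    gcongr
  rw [apply_zero_sub] at t3
  have t4 : |(G (cornerPoint δ E θ p) - G (cornerPoint δ E θ₀ p))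
      (0, chordDir δ θ * (k - p))| ≤ c * (54 * c * (4 * θ₀ ^ β * r)) * (2 * c) := by
    apply abs_apply_zero_le
    · refine (h.G_sub θ hθ' p hp θ₀ hθ₀' p hp).trans ?_
      refine mul_le_mul_of_nonneg_left ?_ hc0.le
      refine (h.norm_cornerPoint_sub_le hθ' hθ₀ hr hr1 hd hp).trans ?_
      gcongr
    · rw [norm_mul, norm_chordDir, one_mul]; exact hkp
  have t5 : |G (cornerPoint δ E θ₀ p)
      (0, chordDir δ θ * (k - p) - chordDir δ θ₀ * (k - p))| ≤
      c * (16 * (θ₀ ^ β * r) * (2 * c)) := by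
    apply abs_apply_zero_le _ (h.norm_G_le θ₀ hθ₀' p hp)
    rw [← sub_mul, norm_mul]
    have := hu.trans hθr
    gcongr
  rw [apply_zero_sub] at t5
  rw [sub_apply] at t4
  have s1 := h.div_chordPow_eq hθ p
  have s2 := h.div_chordPow_eq hθ₀ p
  have key : g (cornerPoint δ E θ₀ p) / chordPow δ θ₀ +
        G (cornerPoint δ E θ₀ p) (0, chordDir δ θ₀ * (k - p)) =
      (g (cornerPoint δ E θ p) / chordPow δ θ +
        G (cornerPoint δ E θ p) (0, chordDir δ θ * (k - p))) -
      (remainder δ g G E θ p / chordPow δ θ - remainder δ g G E θ₀ p / chordPow δ θ₀) -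
      (G (cornerPoint δ E 0 0) (0, chordDir δ θ * p) -
        G (cornerPoint δ E 0 0) (0, chordDir δ θ₀ * p)) -
      (G (cornerPoint δ E θ p) (0, chordDir δ θ * (k - p)) -
        G (cornerPoint δ E θ₀ p) (0, chordDir δ θ * (k - p))) -
      (G (cornerPoint δ E θ₀ p) (0, chordDir δ θ * (k - p)) -
        G (cornerPoint δ E θ₀ p) (0, chordDir δ θ₀ * (k - p))) := by
    rw [s1, s2]; ring
  have tri : ∀ a b c d e : ℝ, |a - b - c - d - e| ≤ |a| + |b| + |c| + |d| + |e| := by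
    intro a b c d e
    have h1 := abs_sub (a - b - c - d) e
    have h2 := abs_sub (a - b - c) d
    have h3 := abs_sub (a - b) c
    have h4 := abs_sub a b
    linarith
  rw [key]
  refine (tri _ _ _ _ _).trans ?_
  set K := C + c * 16 * c + c * (54 * c) * 4 * (2 * c) + c * (16 * (2 * c)) with hK
  have hK0 : 0 ≤ K := by positivity
  calc _ ≤ c * 4 * ‖k - p‖ ^ 2 + C * (θ₀ ^ β * r) + c * (16 * (θ₀ ^ β * r) * c) +
        c * (54 * c * (4 * θ₀ ^ β * r)) * (2 * c) + c * (16 * (θ₀ ^ β * r) * (2 * c)) := by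
        gcongr
    _ = c * 4 * ‖k - p‖ ^ 2 + K * (θ₀ ^ β * r) := by rw [hK]; ring
    _ ≤ _ := by
        have h1 : 0 ≤ K * ‖k - p‖ ^ 2 := by positivity
        have h2 : 0 ≤ c * 4 * (θ₀ ^ β * r) := by positivity
        linarith

/-- Here θ₀^β ≤ 2θ₀^β r, so all coefficients may be moved from θ₀ to the corner. The remaining term
is controlled by `abs_im_le` and |θ| ≤ 3θ₀r². The point may lie on either arc. -/
theorem abs_linear_upper_far_le (h : CornerBounds β δ M c g G E κ) (hκ : InDiscAlgebra κ) :
    ∃ C > 0, ∀ θ₀ ∈ Ioc 0 Real.pi, ∀ θ ∈ Icc (-Real.pi) Real.pi, ∀ r : ℝ, 0 ≤ r → 1 / 2 ≤ r ^ 2 →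
      |θ - θ₀| = θ₀ * r ^ 2 → ∀ p, ‖p‖ ≤ M →
      |g (cornerPoint δ E θ₀ p) / chordPow δ θ₀ +
        G (cornerPoint δ E θ₀ p) (0, chordDir δ θ₀ * (κ (cexp (θ * I)) - p))| ≤
        C * (θ₀ ^ β * r) := by
  obtain ⟨C₁, hC₁, hX⟩ := h.abs_remainder_div_le
  obtain ⟨C₂, hC₂, hV⟩ := h.abs_im_le hκ
  obtain ⟨l, hl, htan⟩ := h.tangent
  have hl0 : 0 < |l| := abs_pos.2 hl
  have hc := h.one_le
  have hc0 := h.c_pos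
  refine ⟨2 * C₁ + 2 * (c * (17 * c * 4) * (2 * c)) + 2 * (c * (16 * c)) + |l| * (C₂ * 6),
    by positivity, ?_⟩
  intro θ₀ hθ₀ θ hθ r hr hr2 hd p hp
  set k := κ (cexp (θ * I)) with hk
  have hkc : ‖k‖ ≤ M := h.norm_κ_exp_le θ
  have hpc := hp.trans h.le_bound
  have hkc' := hkc.trans h.le_bound
  have hkp : ‖k - p‖ ≤ 2 * c := by have := norm_sub_le k p; linarith
  have h4 : θ₀ ≤ 4 := hθ₀.2.trans Real.pi_le_four
  obtain ⟨e1, e2, e3, e4⟩ := h.rpow_bounds hθ₀.1 h4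
  have hD : 0 < θ₀ ^ δ := Real.rpow_pos_of_pos hθ₀.1 _
  have hb : 0 < θ₀ ^ β := Real.rpow_pos_of_pos hθ₀.1 _
  have hθ₀' := Ioc_subset_Icc_self hθ₀
  have hr1 : 1 ≤ 2 * r := by nlinarith
  have hθb : θ₀ ≤ 16 * θ₀ ^ β := by nlinarith
  have t1 := hX θ₀ hθ₀ p hp
  have t2 : |(G (cornerPoint δ E θ₀ p) - G (cornerPoint δ E 0 0))
      (0, chordDir δ θ₀ * (k - p))| ≤ c * (17 * c * (4 * θ₀ ^ β)) * (2 * c) := by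
    apply abs_apply_zero_le
    · refine (h.G_sub θ₀ hθ₀' p hp 0 h.zero_mem 0 h.norm_zero_le).trans ?_
      refine mul_le_mul_of_nonneg_left ?_ hc0.le
      refine (h.norm_cornerPoint_sub_zero_le hθ₀ hp).trans ?_
      gcongr
    · rw [norm_mul, norm_chordDir, one_mul]; exact hkp
  have t3 : |G (cornerPoint δ E 0 0) (0, chordDir δ θ₀ * k - chordDir δ 0 * k)| ≤
      c * (16 * θ₀ ^ β * c) := by
    apply abs_apply_zero_le _ h.norm_G_zero_le
    rw [← sub_mul, norm_mul]
    have := norm_chordDir_sub_le h.δ_pos h.δ_lt_one θ₀ 0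
    rw [sub_zero, abs_of_pos hθ₀.1] at this
    have := this.trans hθb
    gcongr
  rw [apply_zero_sub] at t3
  have t4 : |G (cornerPoint δ E 0 0) (0, chordDir δ 0 * k)| ≤
      |l| * (C₂ * (6 * (θ₀ ^ β * r))) := by
    rw [htan, abs_mul]
    refine mul_le_mul_of_nonneg_left ((hV θ hθ).trans (mul_le_mul_of_nonneg_left ?_ hC₂.le)) hl0.le
    have h1 : |θ| ≤ 3 * θ₀ * r ^ 2 := by
      have := abs_add_le (θ - θ₀) θ₀
      rw [sub_add_cancel, hd, abs_of_pos hθ₀.1] at this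
      nlinarith [hθ₀.1]
    have h3 : (3 : ℝ) ^ β ≤ 3 :=
      (Real.rpow_le_rpow_of_exponent_le (by norm_num) (by linarith [h.β_le_half] : β ≤ 1)).trans
        (by simp)
    calc |θ| ^ β ≤ (3 * θ₀ * r ^ 2) ^ β := Real.rpow_le_rpow (abs_nonneg _) h1 h.β_pos.le
      _ = 3 ^ β * θ₀ ^ β * (r ^ 2) ^ β := by
          rw [Real.mul_rpow (by linarith [hθ₀.1]) (by positivity),
            Real.mul_rpow (by norm_num) hθ₀.1.le]
      _ ≤ 3 * θ₀ ^ β * (2 * r) := by gcongr; exact h.sq_rpow_le hr hr2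
      _ = _ := by ring
  rw [sub_apply] at t2
  have s2 := h.div_chordPow_eq hθ₀ p
  have hsp : G (cornerPoint δ E 0 0) (0, chordDir δ θ₀ * (k - p)) =
      G (cornerPoint δ E 0 0) (0, chordDir δ θ₀ * k) -
        G (cornerPoint δ E 0 0) (0, chordDir δ θ₀ * p) := by
    rw [mul_sub, apply_zero_sub]
  have key : g (cornerPoint δ E θ₀ p) / chordPow δ θ₀ +
        G (cornerPoint δ E θ₀ p) (0, chordDir δ θ₀ * (k - p)) =
      remainder δ g G E θ₀ p / chordPow δ θ₀ +
      (G (cornerPoint δ E θ₀ p) (0, chordDir δ θ₀ * (k - p)) -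
        G (cornerPoint δ E 0 0) (0, chordDir δ θ₀ * (k - p))) +
      (G (cornerPoint δ E 0 0) (0, chordDir δ θ₀ * k) -
        G (cornerPoint δ E 0 0) (0, chordDir δ 0 * k)) +
      G (cornerPoint δ E 0 0) (0, chordDir δ 0 * k) := by
    rw [s2, hsp]; ring
  have tri : ∀ a b c d : ℝ, |a + b + c + d| ≤ |a| + |b| + |c| + |d| := by
    intro a b c d
    have h1 := abs_add_le (a + b + c) d
    have h2 := abs_add_three a b c
    linarith
  rw [key]
  refine (tri _ _ _ _).trans ?_
  have hbr : θ₀ ^ β ≤ 2 * (θ₀ ^ β * r) := by nlinarith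
  calc _ ≤ C₁ * θ₀ ^ β + c * (17 * c * (4 * θ₀ ^ β)) * (2 * c) + c * (16 * θ₀ ^ β * c) +
        |l| * (C₂ * (6 * (θ₀ ^ β * r))) := by gcongr
    _ ≤ C₁ * (2 * (θ₀ ^ β * r)) + c * (17 * c * (4 * (2 * (θ₀ ^ β * r)))) * (2 * c) +
        c * (16 * (2 * (θ₀ ^ β * r)) * c) + |l| * (C₂ * (6 * (θ₀ ^ β * r))) := by gcongr
    _ = _ := by ring

/-- Linearized boundary condition at a point of the upper semicircle near the corner. -/
theorem abs_linear_upper_le (h : CornerBounds β δ M c g G E κ) (hκ : InDiscAlgebra κ) :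
    ∃ C > 0, ∀ θ₀ ∈ Ioc 0 Real.pi, ∀ θ ∈ Icc (-Real.pi) Real.pi, ∀ r : ℝ, 0 ≤ r →
      |θ - θ₀| = θ₀ * r ^ 2 → ∀ p, ‖p‖ ≤ M →
      |g (cornerPoint δ E θ₀ p) / chordPow δ θ₀ +
        G (cornerPoint δ E θ₀ p) (0, chordDir δ θ₀ * (κ (cexp (θ * I)) - p))| ≤
        C * (θ₀ ^ β * r + ‖κ (cexp (θ * I)) - p‖ ^ 2) := by
  obtain ⟨C₁, hC₁, h₁⟩ := h.abs_linear_upper_near_le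
  obtain ⟨C₂, hC₂, h₂⟩ := h.abs_linear_upper_far_le hκ
  refine ⟨C₁ + C₂, by positivity, ?_⟩
  intro θ₀ hθ₀ θ hθ r hr hd p hp
  have hbr : 0 ≤ θ₀ ^ β * r := mul_nonneg (Real.rpow_nonneg hθ₀.1.le _) hr
  have hq : 0 ≤ ‖κ (cexp (θ * I)) - p‖ ^ 2 := by positivity
  rcases le_or_gt (1 / 2) (r ^ 2) with hr2 | hr2
  · refine (h₂ θ₀ hθ₀ θ hθ r hr hr2 hd p hp).trans ?_
    nlinarith [mul_nonneg hC₁.le hbr, mul_nonneg hC₁.le hq, mul_nonneg hC₂.le hq]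
  · have hθθ : θ₀ / 2 ≤ θ := by
      have := neg_abs_le (θ - θ₀)
      rw [hd] at this
      nlinarith [hθ₀.1]
    refine (h₁ θ₀ hθ₀ θ ⟨by linarith [hθ₀.1], hθ.2⟩ r hr (by nlinarith) hθθ hd p hp).trans ?_
    gcongr
    linarith

end CornerBounds

/-! ### Derivative bounds in the half-disc Re z ≥ 0 -/

theorem exists_mul_re_eq (L : ℂ →L[ℝ] ℝ) : ∃ A : ℂ, (∀ k, (A * k).re = L k) ∧ ‖L‖ ≤ ‖A‖ := by
  have h : ∀ k : ℂ, (((L 1 : ℝ) - (L I : ℝ) * I : ℂ) * k).re = L k := by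
    intro k
    have hk : k = k.re • (1 : ℂ) + k.im • I := by simp [re_add_im]
    conv_rhs => rw [hk, map_add, map_smul, map_smul]
    simp; ring
  refine ⟨_, h, L.opNorm_le_bound (norm_nonneg _) fun k => ?_⟩
  rw [← h k, Real.norm_eq_abs, ← norm_mul]
  exact abs_re_le_norm _

theorem exp_arg_mul_I {ξ : ℂ} (hξ : ‖ξ‖ = 1) : cexp (arg ξ * I) = ξ := by
  have := norm_mul_exp_arg_mul_I ξ
  rwa [hξ, ofReal_one, one_mul] at this

theorem rpow_mul_sqrt_div_le {β θ₀ τ x : ℝ} (h0 : 0 < θ₀) (hx : 0 ≤ x)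
    (h : τ ≤ 5 * x) : θ₀ ^ β * √(τ / θ₀) ≤ 3 * (θ₀ ^ (β - 1 / 2) * x ^ (1 / 2 : ℝ)) := by
  have h1 : √(τ / θ₀) ≤ 3 * √x / √θ₀ := by
    rw [Real.sqrt_div' _ h0.le]
    gcongr
    calc √τ ≤ √(3 ^ 2 * x) := Real.sqrt_le_sqrt (by linarith)
      _ = 3 * √x := by rw [Real.sqrt_mul (by norm_num), Real.sqrt_sq (by norm_num)]
  have h2 : θ₀ ^ (β - 1 / 2) = θ₀ ^ β / √θ₀ := by
    rw [Real.rpow_sub h0, Real.sqrt_eq_rpow]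
  rw [h2, ← Real.sqrt_eq_rpow]
  calc _ ≤ θ₀ ^ β * (3 * √x / √θ₀) := by gcongr
    _ = _ := by ring

theorem half_le_rpow {β θ₀ : ℝ} (hβ : 0 < β) (hβ' : β ≤ 1 / 2) (h0 : 0 < θ₀) (h2 : θ₀ ≤ 2) :
    1 / 2 ≤ θ₀ ^ (β - 1 / 2) :=
  calc (1 / 2 : ℝ) = 2 ^ (-1 : ℝ) := by rw [Real.rpow_neg_one]; norm_num
    _ ≤ 2 ^ (β - 1 / 2) := Real.rpow_le_rpow_of_exponent_le (by norm_num) (by linarith)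
    _ ≤ _ := Real.rpow_le_rpow_of_nonpos h0 h2 (by linarith)

theorem exists_norm_deriv_le_of_norm_le {κ : ℂ → ℂ} (hκ : InDiscAlgebra κ) {β R : ℝ}
    (hβ1 : β ≤ 1) (hR : R < 1) :
    ∃ C ≥ 0, ∀ z : ℂ, ‖z‖ ≤ R → ‖deriv κ z‖ ≤ C * (1 - ‖z‖) ^ (β - 1) := by
  have hd : DifferentiableOn ℂ (deriv κ) (Metric.ball 0 1) := hκ.2.deriv Metric.isOpen_ball
  obtain ⟨C, hC⟩ := (isCompact_closedBall (0 : ℂ) R).exists_bound_of_continuousOn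
    (hd.continuousOn.mono (Metric.closedBall_subset_ball hR))
  refine ⟨|C|, abs_nonneg _, fun z hz => ?_⟩
  have h1 : 1 ≤ (1 - ‖z‖) ^ (β - 1) :=
    Real.one_le_rpow_of_pos_of_le_one_of_nonpos (by linarith) (by linarith [norm_nonneg z])
      (by linarith)
  calc _ ≤ |C| * 1 := by rw [mul_one]; exact (hC z (by simpa using hz)).trans (le_abs_self _)
    _ ≤ _ := by gcongr

namespace CornerBounds

variable {β δ M c : ℝ} {g : ℝ × ℂ → ℝ} {G : ℝ × ℂ → ℝ × ℂ →L[ℝ] ℝ} {E κ : ℂ → ℂ}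

theorem exists_norm_deriv_le_nontangential (h : CornerBounds β δ M c g G E κ)
    (hκ : InDiscAlgebra κ) : ∃ C ≥ 0, ∀ z : ℂ, ‖z‖ < 1 → ‖z - 1‖ ≤ 2 * (1 - ‖z‖) →
      ‖deriv κ z‖ ≤ C * (1 - ‖z‖) ^ (β - 1) := by
  obtain ⟨C, hC, hV⟩ := h.abs_im_le hκ
  refine ⟨24 * (C * 5), by positivity, fun z hz hz1 => ?_⟩
  refine norm_deriv_le_of_nontangential hκ h.β_pos h.β_le_half (by positivity)
    (c := -I * (starRingEnd ℂ) (chordDir δ 0)) (by simp [norm_chordDir]) (norm_one (α := ℂ))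
    (fun ξ hξ => ?_) hz hz1
  have h1 := hV (arg ξ) ⟨(neg_pi_lt_arg ξ).le, arg_le_pi ξ⟩
  have h2 := abs_sub_le_five_mul_norm (abs_arg_le_pi ξ) (θ₀ := 0)
    (by rw [abs_zero]; linarith [Real.pi_pos])
  rw [exp_arg_mul_I hξ] at h1 h2
  rw [sub_zero, ofReal_zero, zero_mul, Complex.exp_zero] at h2
  have e : (-I * (starRingEnd ℂ) (chordDir δ 0) * κ ξ).re =
      ((starRingEnd ℂ) (chordDir δ 0) * κ ξ).im := by
    rw [mul_assoc]; simp
  rw [e]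
  have h5 : (5 : ℝ) ^ β ≤ 5 :=
    (Real.rpow_le_rpow_of_exponent_le (by norm_num) (by linarith [h.β_le_half] : β ≤ 1)).trans
      (by simp)
  calc _ ≤ _ := h1
    _ ≤ C * (5 * ‖ξ - 1‖) ^ β := by
        have := h.β_pos.le
        gcongr
    _ = C * (5 ^ β * ‖ξ - 1‖ ^ β) := by rw [Real.mul_rpow (by norm_num) (norm_nonneg _)]
    _ ≤ C * (5 * ‖ξ - 1‖ ^ β) := by gcongr
    _ = _ := by ring

/-- The gradient in the second variable is bounded below on the curves only; the linearization is
made at κ(z), slightly off the curve, so the Lipschitz bound of G is used. -/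
theorem le_norm_comp_inr (h : CornerBounds β δ M c g G E κ) {c₁ : ℝ}
    (hgrad : ∀ θ ∈ Icc 0 Real.pi, c₁ ≤
      ‖(G (cornerPoint δ E θ (κ (cexp (θ * I))))).comp (ContinuousLinearMap.inr ℝ ℝ ℂ)‖)
    {θ : ℝ} (hθ : θ ∈ Ioc 0 Real.pi) {p : ℂ} (hp : ‖p‖ ≤ M) :
    c₁ - 4 * c * ‖p - κ (cexp (θ * I))‖ ≤
      ‖(G (cornerPoint δ E θ p)).comp (ContinuousLinearMap.inr ℝ ℝ ℂ)‖ := by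
  have hc := h.c_pos
  have hθ' := Ioc_subset_Icc_self hθ
  have h1 := hgrad θ hθ'
  set k := κ (cexp (θ * I))
  have h2 := h.G_sub θ hθ' k (h.norm_κ_exp_le θ) θ hθ' p hp
  have hdiff : cornerPoint δ E θ k - cornerPoint δ E θ p =
      ((0 : ℝ), (chordPow δ θ : ℂ) * chordDir δ θ * (k - p)) := by
    ext1 <;> simp [cornerPoint]
    ring
  have hn : ‖cornerPoint δ E θ k - cornerPoint δ E θ p‖ ≤ 4 * ‖p - k‖ := by
    have h3 := (h.norm_chord_le hθ').trans
      (h.rpow_bounds hθ.1 (hθ.2.trans Real.pi_le_four)).2.2.2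
    rw [hdiff, Prod.norm_def, norm_sub_rev p]
    apply max_le
    · rw [norm_zero]; positivity
    · rw [norm_mul]; gcongr
  have h4 : ‖(G (cornerPoint δ E θ k)).comp (ContinuousLinearMap.inr ℝ ℝ ℂ) -
      (G (cornerPoint δ E θ p)).comp (ContinuousLinearMap.inr ℝ ℝ ℂ)‖ ≤ c * (4 * ‖p - k‖) := by
    rw [← ContinuousLinearMap.sub_comp]
    refine (ContinuousLinearMap.opNorm_comp_le _ _).trans ?_
    calc _ ≤ ‖G (cornerPoint δ E θ k) - G (cornerPoint δ E θ p)‖ * 1 := by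
          gcongr; exact ContinuousLinearMap.norm_inr_le_one ℝ ℝ ℂ
      _ ≤ _ := by rw [mul_one]; exact h2.trans (mul_le_mul_of_nonneg_left hn hc.le)
  have h5 := norm_sub_norm_le ((G (cornerPoint δ E θ k)).comp (ContinuousLinearMap.inr ℝ ℝ ℂ))
    ((G (cornerPoint δ E θ p)).comp (ContinuousLinearMap.inr ℝ ℝ ℂ))
  linarith

theorem exists_norm_deriv_le_tangential (h : CornerBounds β δ M c g G E κ)
    (hκ : InDiscAlgebra κ) {c₁ : ℝ} (hc₁ : 0 < c₁)
    (hgrad : ∀ θ ∈ Icc 0 Real.pi, c₁ ≤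
      ‖(G (cornerPoint δ E θ (κ (cexp (θ * I))))).comp (ContinuousLinearMap.inr ℝ ℝ ℂ)‖) :
    ∃ d₀ > 0, ∃ C ≥ 0, ∀ z : ℂ, ‖z‖ < 1 → 1 - ‖z‖ ≤ d₀ → ∀ θ : ℝ, |θ| ≤ Real.pi / 2 →
      z = ‖z‖ * cexp (θ * I) → 1 - ‖z‖ < |θ| → ‖deriv κ z‖ ≤ C * (1 - ‖z‖) ^ (β - 1) := by
  have hc := h.c_pos
  obtain ⟨CU, hCU, hU⟩ := h.abs_linear_upper_le hκ
  obtain ⟨CL, hCL, hL⟩ := h.abs_linear_lower_le hκ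
  obtain ⟨d₁, hd₁, C, hC, hF⟩ := exists_norm_deriv_le_of_almost_linear hκ
    (k := CU / (c₁ / 2)) (by positivity)
  have huc := (isCompact_closedBall (0 : ℂ) 1).uniformContinuousOn_of_continuous hκ.1
  rw [Metric.uniformContinuousOn_iff] at huc
  obtain ⟨ε, hε, huc⟩ := huc (c₁ / (8 * c)) (by positivity)
  -- The first two summands dominate the errors of the two arcs, the upper one after normalizing a
  -- gradient of size at least c₁/2. The summand 2 ensures N ≥ 1, as θ₀^(β-1/2) ≥ 1/2.
  set W := 3 * CU / (c₁ / 2) + 3 * CL + 2 with hW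
  have hW0 : 0 < W := by positivity
  refine ⟨min d₁ (ε / 2), by positivity, C * W, by positivity, ?_⟩
  intro z hz hzd θ hθ hzθ hdθ
  have hpi := Real.pi_pos
  set d := 1 - ‖z‖ with hd
  have hd0 : 0 < d := by linarith
  set ξ₀ := cexp (θ * I) with hξ₀
  have hξ₀n : ‖ξ₀‖ = 1 := norm_exp_ofReal_mul_I θ
  have hfoot : ‖z - ξ₀‖ = d := by
    have : z - ξ₀ = -((d : ℝ) : ℂ) * ξ₀ := by
      rw [hd]; push_cast; linear_combination hzθ
    rw [this, norm_mul, norm_neg, hξ₀n, mul_one, norm_real, Real.norm_of_nonneg hd0.le]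
  set θ₀ := |θ| with hθ₀
  have hθ₀0 : 0 < θ₀ := by linarith
  have hpow := half_le_rpow h.β_pos h.β_le_half hθ₀0 (by linarith [Real.pi_le_four])
  set N := W * θ₀ ^ (β - 1 / 2) with hN
  have hN1 : 1 ≤ N := by
    have : 2 ≤ W := by
      have : 0 ≤ 3 * CU / (c₁ / 2) + 3 * CL := by positivity
      linarith
    nlinarith
  have hzc : ‖κ z‖ ≤ M := h.norm_le z hz.le
  -- comparison of the size of the boundary error
  have herr : ∀ ξ : ℂ, ‖ξ‖ = 1 →
      θ₀ ^ β * √(|arg ξ - θ| / θ₀) ≤ 3 * (θ₀ ^ (β - 1 / 2) * ‖ξ - ξ₀‖ ^ (1 / 2 : ℝ)) := by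
    intro ξ hξ
    apply rpow_mul_sqrt_div_le hθ₀0 (norm_nonneg _)
    have := abs_sub_le_five_mul_norm (abs_arg_le_pi ξ) hθ
    rwa [exp_arg_mul_I hξ] at this
  have hr2 : ∀ x : ℝ, |x| = θ₀ * √(|x| / θ₀) ^ 2 := by
    intro x
    rw [Real.sq_sqrt (by positivity), mul_div_cancel₀ _ hθ₀0.ne']
  have hmain : ‖deriv κ z‖ ≤ C * N * d ^ (-1 / 2 : ℝ) := by
    rcases le_or_gt θ 0 with hneg | hpos
    · have hθe : θ = -θ₀ := by rw [hθ₀, abs_of_nonpos hneg]; ring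
      set A := -I * (starRingEnd ℂ) (chordDir δ θ₀) with hA
      have hAre : ∀ k, (A * k).re = ((starRingEnd ℂ) (chordDir δ θ₀) * k).im := by
        intro k; rw [hA, mul_assoc]; simp
      -- The condition on the lower arc is linear in κ, so s = Re(Aκ(z)) merely undoes the
      -- subtraction of κ(z).
      refine hF z ξ₀ A (A * κ z).re N hz (hzd.trans (min_le_left _ _)) hξ₀n hfoot
        (by simp [hA, norm_chordDir]) hN1 (fun ξ hξ => ?_)
      rw [← add_re, ← mul_add, add_sub_cancel, hAre]
      have h1 := hL θ₀ ⟨hθ₀0, hθ⟩ (arg ξ) ⟨(neg_pi_lt_arg ξ).le, arg_le_pi ξ⟩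
        (√(|arg ξ + θ₀| / θ₀)) (Real.sqrt_nonneg _) (hr2 _)
      have h2 := herr ξ hξ
      rw [exp_arg_mul_I hξ] at h1
      rw [hθe, sub_neg_eq_add] at h2
      have h3 : 0 ≤ CU / (c₁ / 2) * ‖κ ξ - κ z‖ ^ 2 := by positivity
      have h4 : 0 ≤ θ₀ ^ (β - 1 / 2) * ‖ξ - ξ₀‖ ^ (1 / 2 : ℝ) := by positivity
      have h5 : 3 * CL ≤ W := by
        have : 0 ≤ 3 * CU / (c₁ / 2) := by positivity
        linarith
      calc _ ≤ _ := h1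
        _ ≤ CL * (3 * (θ₀ ^ (β - 1 / 2) * ‖ξ - ξ₀‖ ^ (1 / 2 : ℝ))) := by gcongr
        _ = 3 * CL * (θ₀ ^ (β - 1 / 2) * ‖ξ - ξ₀‖ ^ (1 / 2 : ℝ)) := by ring
        _ ≤ W * (θ₀ ^ (β - 1 / 2) * ‖ξ - ξ₀‖ ^ (1 / 2 : ℝ)) := by gcongr
        _ = N * ‖ξ - ξ₀‖ ^ (1 / 2 : ℝ) := by rw [hN]; ring
        _ ≤ _ := by linarith
    · have hθe : θ₀ = θ := abs_of_pos hpos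
      rw [hθe] at hθ hθ₀0 herr hr2
      have hθm : θ ∈ Ioc 0 Real.pi := ⟨hpos, by linarith⟩
      set L := (G (cornerPoint δ E θ (κ z))).comp (ContinuousLinearMap.inr ℝ ℝ ℂ) with hLdef
      obtain ⟨A, hAre, hAn⟩ := exists_mul_re_eq L
      have hlow : c₁ / 2 ≤ ‖A‖ := by
        have h1 := h.le_norm_comp_inr hgrad hθm hzc
        have h2 : ‖κ z - κ ξ₀‖ ≤ c₁ / (8 * c) := by
          rw [← dist_eq_norm]
          refine (huc z (by simpa using hz.le) ξ₀ (by simp [hξ₀n]) ?_).le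
          rw [dist_eq_norm, hfoot]
          linarith [hzd.trans (min_le_right _ _)]
        have h3 : 4 * c * ‖κ z - κ ξ₀‖ ≤ c₁ / 2 := by
          calc _ ≤ 4 * c * (c₁ / (8 * c)) := by gcongr
            _ = _ := by field_simp; norm_num
        linarith
      have hA0 : 0 < ‖A‖ := by linarith
      set B := A * chordDir δ θ with hB
      have hBn : ‖B‖ = ‖A‖ := by rw [hB, norm_mul, norm_chordDir, mul_one]
      have hBre : ∀ k, (B * k).re = G (cornerPoint δ E θ (κ z)) (0, chordDir δ θ * k) := by
        intro k; rw [hB, mul_assoc, hAre]; simp [hLdef]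
      have hscale : ∀ k, (B / ‖A‖ * k : ℂ).re = (B * k).re / ‖A‖ := by
        intro k
        rw [div_mul_eq_mul_div, div_ofReal_re]
      refine hF z ξ₀ (B / ‖A‖) (g (cornerPoint δ E θ (κ z)) / chordPow δ θ / ‖A‖) N hz
        (hzd.trans (min_le_left _ _)) hξ₀n hfoot
        (by rw [norm_div, hBn, norm_real, norm_norm, div_self hA0.ne']) hN1 (fun ξ hξ => ?_)
      have h1 := hU θ hθm (arg ξ) ⟨(neg_pi_lt_arg ξ).le, arg_le_pi ξ⟩
        (√(|arg ξ - θ| / θ)) (Real.sqrt_nonneg _) (hr2 _) (κ z) hzc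
      have h2 := herr ξ hξ
      rw [exp_arg_mul_I hξ, ← hBre] at h1
      rw [hscale, ← add_div, abs_div, abs_of_pos hA0, div_le_iff₀ hA0]
      have h4 : 0 ≤ θ ^ (β - 1 / 2) * ‖ξ - ξ₀‖ ^ (1 / 2 : ℝ) := by positivity
      have h5 : 3 * CU / (c₁ / 2) ≤ W := by linarith
      have h6 : 0 ≤ N * ‖ξ - ξ₀‖ ^ (1 / 2 : ℝ) + CU / (c₁ / 2) * ‖κ ξ - κ z‖ ^ 2 := by
        have : 0 ≤ N := by linarith
        positivity
      calc _ ≤ _ := h1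
        _ ≤ CU * (3 * (θ ^ (β - 1 / 2) * ‖ξ - ξ₀‖ ^ (1 / 2 : ℝ)) + ‖κ ξ - κ z‖ ^ 2) := by gcongr
        _ = (3 * CU / (c₁ / 2) * (θ ^ (β - 1 / 2) * ‖ξ - ξ₀‖ ^ (1 / 2 : ℝ)) +
            CU / (c₁ / 2) * ‖κ ξ - κ z‖ ^ 2) * (c₁ / 2) := by field_simp
        _ ≤ (W * (θ ^ (β - 1 / 2) * ‖ξ - ξ₀‖ ^ (1 / 2 : ℝ)) +
            CU / (c₁ / 2) * ‖κ ξ - κ z‖ ^ 2) * (c₁ / 2) := by gcongr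
        _ = (N * ‖ξ - ξ₀‖ ^ (1 / 2 : ℝ) + CU / (c₁ / 2) * ‖κ ξ - κ z‖ ^ 2) * (c₁ / 2) := by
            rw [hN, hθe]; ring
        _ ≤ _ := by gcongr
  calc _ ≤ _ := hmain
    -- Here d < θ₀ and β ≤ 1/2 are used: the exponent β - 1/2 is not positive.
    _ ≤ C * (W * d ^ (β - 1 / 2)) * d ^ (-1 / 2 : ℝ) := by
        rw [hN]
        have : θ₀ ^ (β - 1 / 2) ≤ d ^ (β - 1 / 2) :=
          Real.rpow_le_rpow_of_nonpos hd0 hdθ.le (by linarith [h.β_le_half])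
        gcongr
    _ = C * W * (d ^ (β - 1 / 2) * d ^ (-1 / 2 : ℝ)) := by ring
    _ = _ := by rw [← Real.rpow_add hd0]; ring_nf

theorem exists_norm_deriv_le (h : CornerBounds β δ M c g G E κ)
    (hκ : InDiscAlgebra κ) {c₁ : ℝ} (hc₁ : 0 < c₁)
    (hgrad : ∀ θ ∈ Icc 0 Real.pi, c₁ ≤
      ‖(G (cornerPoint δ E θ (κ (cexp (θ * I))))).comp (ContinuousLinearMap.inr ℝ ℝ ℂ)‖) :
    ∃ C ≥ 0, ∀ z : ℂ, ‖z‖ < 1 → 0 ≤ z.re → ‖deriv κ z‖ ≤ C * (1 - ‖z‖) ^ (β - 1) := by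
  obtain ⟨d₀, hd₀, C₁, hC₁, h₁⟩ := h.exists_norm_deriv_le_tangential hκ hc₁ hgrad
  obtain ⟨C₂, hC₂, h₂⟩ := h.exists_norm_deriv_le_nontangential hκ
  obtain ⟨C₃, hC₃, h₃⟩ := exists_norm_deriv_le_of_norm_le hκ (β := β) (R := 1 - d₀)
    (by linarith [h.β_le_half]) (by linarith)
  refine ⟨C₁ + C₂ + C₃, by positivity, ?_⟩
  intro z hz hre
  have hp : 0 ≤ (1 - ‖z‖) ^ (β - 1) := Real.rpow_nonneg (by linarith) _
  have e : (C₁ + C₂ + C₃) * (1 - ‖z‖) ^ (β - 1) = C₁ * (1 - ‖z‖) ^ (β - 1) +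
    C₂ * (1 - ‖z‖) ^ (β - 1) + C₃ * (1 - ‖z‖) ^ (β - 1) := by ring
  have p₁ := mul_nonneg hC₁ hp
  have p₂ := mul_nonneg hC₂ hp
  have p₃ := mul_nonneg hC₃ hp
  rw [e]
  rcases le_or_gt ‖z‖ (1 - d₀) with hzd | hzd
  · linarith [h₃ z hzd]
  have hpolar : z = ‖z‖ * cexp (arg z * I) := (norm_mul_exp_arg_mul_I z).symm
  -- If |arg z| ≤ 1-|z|, then |z-1| ≤ (1-|z|) + |arg z| ≤ 2(1-|z|), so the two regions cover the
  -- collar.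
  rcases lt_or_ge (1 - ‖z‖) |arg z| with hlt | hge
  · linarith [h₁ z hz (by linarith) (arg z) (abs_arg_le_pi_div_two_iff.2 hre) hpolar hlt]
  · have hn : ‖z - 1‖ ≤ 2 * (1 - ‖z‖) := by
      have h5 : z - 1 = -((1 - ‖z‖ : ℝ) : ℂ) * cexp (arg z * I) +
          (cexp (arg z * I) - cexp ((0 : ℝ) * I)) := by
        rw [ofReal_zero, zero_mul, Complex.exp_zero]
        push_cast; linear_combination hpolar
      have h6 := norm_exp_ofReal_mul_I_sub_le (arg z) 0
      rw [sub_zero] at h6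
      rw [h5]
      calc _ ≤ _ := norm_add_le _ _
        _ ≤ (1 - ‖z‖) + |arg z| := by
            rw [norm_mul, norm_neg, norm_exp_ofReal_mul_I, mul_one, norm_real,
              Real.norm_of_nonneg (by linarith)]
            gcongr
        _ ≤ _ := by linarith
    linarith [h₂ z hz hn]

end CornerBounds

/-! ### From a corner problem to its quantitative data -/

theorem fderivWithin_comp_inr {g : ℝ × ℂ → ℝ} {T : Set ℝ}
    {θ : ℝ} {w : ℂ} (hθ : θ ∈ T) (hg : DifferentiableWithinAt ℝ g (T ×ˢ univ) (θ, w)) :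
    (fderivWithin ℝ g (T ×ˢ univ) (θ, w)).comp (ContinuousLinearMap.inr ℝ ℝ ℂ) =
      fderiv ℝ (fun v => g (θ, v)) w := by
  have h1 : HasFDerivWithinAt (fun v : ℂ => ((θ, v) : ℝ × ℂ)) (ContinuousLinearMap.inr ℝ ℝ ℂ)
      univ w := (hasFDerivAt_prodMk_right θ w).hasFDerivWithinAt
  have h2 := hg.hasFDerivWithinAt.comp w h1 (fun v _ => ⟨hθ, mem_univ _⟩)
  rw [hasFDerivWithinAt_univ] at h2
  exact h2.fderiv.symm

theorem continuous_chordPow {δ : ℝ} (hδ : 0 ≤ δ) : Continuous (chordPow δ) := by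
  have : Continuous fun θ : ℝ => 2 * Real.sin (θ / 2) := by fun_prop
  exact this.rpow_const fun _ => Or.inr hδ

theorem continuous_chordDir (δ : ℝ) : Continuous (chordDir δ) := by
  unfold chordDir; fun_prop

theorem chordDir_zero_sq (δ : ℝ) :
    chordDir δ 0 * chordDir δ 0 = cexp ((-(Real.pi * δ) : ℝ) * I) := by
  rw [chordDir, ← exp_add]; congr 1; push_cast; ring

/-- In the orthonormal basis t, it only the coordinate along it contributes. -/
theorem real_linear_eq_of_apply_eq_zero {L : ℂ →L[ℝ] ℝ} {t : ℂ} (ht : ‖t‖ = 1) (hL : L t = 0)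
    (v : ℂ) : L v = L (I * t) * ((starRingEnd ℂ) t * v).im := by
  have hone : (starRingEnd ℂ) t * t = 1 := by
    rw [mul_comm, mul_conj, normSq_eq_norm_sq, ht]; simp
  set x := (starRingEnd ℂ) t * v with hx
  have hv : v = x.re • t + x.im • (I * t) := by
    have h1 : v = x * t := by rw [hx]; linear_combination (-v) * hone
    conv_lhs => rw [h1, ← re_add_im x]
    simp only [real_smul]; ring
  conv_lhs => rw [hv, map_add, map_smul, map_smul, hL]
  simp [mul_comm]

theorem exists_norm_deriv_le_of_corner {β δ : ℝ} {g : ℝ × ℂ → ℝ} {E κ : ℂ → ℂ}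
    (β_pos : 0 < β) (β_le_half : β ≤ 1 / 2) (β_le : β ≤ δ) (β_le_one_sub : β ≤ 1 - δ)
    (hg : ContDiffOn ℝ 2 g (Icc 0 Real.pi ×ˢ univ)) (hκ : InDiscAlgebra κ)
    (hE : ContinuousOn E (Metric.closedBall 0 1))
    (hE' : ∃ C : ℝ, ∀ ξ η : ℂ, ‖ξ‖ = 1 → ‖η‖ = 1 →
      ‖E ξ - E η‖ ≤ C * (√‖ξ - 1‖ + √‖η - 1‖) * √‖ξ - η‖)
    (lower : ∀ ξ ∈ lowerArc, ((1 - ξ) ^ (δ : ℂ) * κ ξ).im = 0)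
    (upper : ∀ θ ∈ Icc 0 Real.pi,
      g (θ, E (cexp (θ * I)) + (1 - cexp (θ * I)) ^ (δ : ℂ) * κ (cexp (θ * I))) = 0)
    (grad : ∀ θ ∈ Icc 0 Real.pi, fderiv ℝ (fun w => g (θ, w))
      (E (cexp (θ * I)) + (1 - cexp (θ * I)) ^ (δ : ℂ) * κ (cexp (θ * I))) ≠ 0)
    (tangent : fderiv ℝ (fun w => g (0, w)) (E 1) (cexp ((-(Real.pi * δ) : ℝ) * I)) = 0) :
    ∃ C ≥ 0, ∀ z : ℂ, ‖z‖ < 1 → 0 ≤ z.re → ‖deriv κ z‖ ≤ C * (1 - ‖z‖) ^ (β - 1) := by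
  have hδ : 0 < δ := by linarith
  have hδ1 : δ < 1 := by linarith
  have hpi := Real.pi_pos
  have hS : UniqueDiffOn ℝ (Icc 0 Real.pi ×ˢ (univ : Set ℂ)) :=
    (uniqueDiffOn_Icc hpi).prod uniqueDiffOn_univ
  set G := fderivWithin ℝ g (Icc 0 Real.pi ×ˢ (univ : Set ℂ)) with hG
  have hGg : ∀ θ ∈ Icc 0 Real.pi, ∀ w : ℂ, (G (θ, w)).comp (ContinuousLinearMap.inr ℝ ℝ ℂ) =
      fderiv ℝ (fun v => g (θ, v)) w := fun θ hθ w =>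
    fderivWithin_comp_inr hθ (hg.differentiableOn two_ne_zero _ ⟨hθ, mem_univ _⟩)
  have hpoint : ∀ θ ∈ Icc 0 Real.pi, cornerPoint δ E θ (κ (cexp (θ * I))) =
      (θ, E (cexp (θ * I)) + (1 - cexp (θ * I)) ^ (δ : ℂ) * κ (cexp (θ * I))) := by
    intro θ hθ
    rw [cornerPoint, one_sub_exp_cpow hδ.ne' hθ.1 hθ.2]
  have hpoint0 : cornerPoint δ E 0 0 = (0, E 1) := by simp [cornerPoint]
  obtain ⟨M, hM⟩ := (isCompact_closedBall (0 : ℂ) 1).exists_bound_of_continuousOn hκ.1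
  obtain ⟨ME, hME⟩ := (isCompact_closedBall (0 : ℂ) 1).exists_bound_of_continuousOn hE
  have hM0 : 0 ≤ M := (norm_nonneg _).trans (hM 0 (by simp))
  obtain ⟨CE, hCE⟩ := hE'
  -- The ball contains every corner point with |p| ≤ M, because |E| ≤ ME and the power has modulus
  -- at most 4.
  obtain ⟨Λ, hΛ, hT⟩ := exists_taylor_bounds hS hg
    (isCompact_Icc.prod (isCompact_closedBall (0 : ℂ) (ME + 4 * M)))
    ((convex_Icc 0 Real.pi).prod (convex_closedBall _ _)) (prod_mono_right (subset_univ _))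
  have hmem : ∀ θ ∈ Icc 0 Real.pi, ∀ p, ‖p‖ ≤ M → cornerPoint δ E θ p ∈
      Icc 0 Real.pi ×ˢ Metric.closedBall (0 : ℂ) (ME + 4 * M) := by
    intro θ hθ p hp
    refine ⟨hθ, ?_⟩
    have h1 : ‖(chordPow δ θ : ℂ) * chordDir δ θ‖ ≤ 4 := by
      rw [norm_mul, norm_chordDir, mul_one, norm_real, Real.norm_eq_abs, abs_of_nonneg]
      · rcases hθ.1.eq_or_lt with h0 | h0
        · rw [← h0]; simp [chordPow, Real.zero_rpow hδ.ne']
        · exact (chordPow_le hδ hθ.1 hθ.2).trans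
            (rpow_le_four h0 (hθ.2.trans Real.pi_le_four) hδ.le hδ1.le)
      · refine le_trans ?_ (le_chordPow hδ hδ1 hθ.1 hθ.2)
        have := hθ.1
        positivity
    simp only [cornerPoint, Metric.mem_closedBall, dist_zero_right]
    calc _ ≤ _ := norm_add_le _ _
      _ ≤ ME + 4 * M := by
        rw [norm_mul]
        gcongr
        exact hME _ (by simp [norm_exp_ofReal_mul_I])
  set c := Λ + M + |CE| with hc
  have hΛc : Λ ≤ c := by linarith [abs_nonneg CE]
  have hcont : ContinuousOn (fun θ : ℝ => (G (cornerPoint δ E θ (κ (cexp (θ * I))))).comp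
      (ContinuousLinearMap.inr ℝ ℝ ℂ)) (Icc 0 Real.pi) := by
    have h1 : ContinuousOn G (Icc 0 Real.pi ×ˢ (univ : Set ℂ)) :=
      hg.continuousOn_fderivWithin hS (by norm_num)
    have hexp : ∀ F : ℂ → ℂ, ContinuousOn F (Metric.closedBall 0 1) →
        ContinuousOn (fun θ : ℝ => F (cexp (θ * I))) (Icc 0 Real.pi) := fun F hF =>
      hF.comp (by fun_prop) (fun θ _ => by simp [norm_exp_ofReal_mul_I])
    have h2 : ContinuousOn (fun θ : ℝ => cornerPoint δ E θ (κ (cexp (θ * I))))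
        (Icc 0 Real.pi) := by
      have := (continuous_ofReal.comp (continuous_chordPow hδ.le)).continuousOn
        (s := Icc 0 Real.pi)
      exact continuousOn_id.prodMk ((hexp E hE).add
        ((this.mul (continuous_chordDir δ).continuousOn).mul (hexp κ hκ.1)))
    exact (h1.comp h2 (fun θ hθ => ⟨hθ, mem_univ _⟩)).clm_comp continuousOn_const
  obtain ⟨θm, hθm, hmin⟩ := isCompact_Icc.exists_isMinOn (nonempty_Icc.2 hpi.le) hcont.norm
  have hc₁ : 0 < ‖(G (cornerPoint δ E θm (κ (cexp (θm * I))))).comp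
      (ContinuousLinearMap.inr ℝ ℝ ℂ)‖ := by
    rw [norm_pos_iff, hpoint θm hθm, hGg θm hθm]
    exact grad θm hθm
  have hCB : CornerBounds β δ M c g G E κ :=
    { β_pos := β_pos
      β_le_half := β_le_half
      β_le := β_le
      β_le_one_sub := β_le_one_sub
      one_le := by linarith [abs_nonneg CE]
      le_bound := by linarith [abs_nonneg CE]
      norm_le := fun z hz => hM z (by simpa using hz)
      E_sub := by
        intro θ hθ θ' hθ'
        have h1 := hCE _ _ (norm_exp_ofReal_mul_I θ) (norm_exp_ofReal_mul_I θ')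
        have hone : ∀ x ∈ Icc 0 Real.pi, ‖cexp (x * I) - 1‖ ≤ x := by
          intro x hx
          have := norm_exp_ofReal_mul_I_sub_le x 0
          rwa [ofReal_zero, zero_mul, Complex.exp_zero, sub_zero, abs_of_nonneg hx.1] at this
        refine h1.trans ?_
        have e1 := Real.sqrt_le_sqrt (hone θ hθ)
        have e2 := Real.sqrt_le_sqrt (hone θ' hθ')
        have e3 := Real.sqrt_le_sqrt (norm_exp_ofReal_mul_I_sub_le θ θ')
        have e4 : CE ≤ c := by linarith [le_abs_self CE]
        gcongr
      norm_G_le := fun θ hθ p hp =>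
        ((hT _ (hmem θ hθ p hp) _ (hmem θ hθ p hp)).1).trans hΛc
      G_sub := fun θ hθ p hp θ' hθ' p' hp' =>
        ((hT _ (hmem θ hθ p hp) _ (hmem θ' hθ' p' hp')).2.1).trans (by gcongr)
      taylor := fun θ hθ p hp θ' hθ' p' hp' =>
        ((hT _ (hmem θ hθ p hp) _ (hmem θ' hθ' p' hp')).2.2).trans (by gcongr)
      upper := fun θ hθ => by rw [hpoint θ hθ]; exact upper θ hθ
      lower := by
        intro θ hθ
        have hξ : cexp ((-θ : ℝ) * I) ∈ lowerArc := by
          refine ⟨norm_exp_ofReal_mul_I _, ?_⟩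
          rw [exp_ofReal_mul_I_im, Real.sin_neg]
          linarith [Real.sin_nonneg_of_nonneg_of_le_pi hθ.1.le hθ.2]
        have h1 := lower _ hξ
        rw [one_sub_exp_neg_cpow hδ.ne' hθ.1.le hθ.2, mul_assoc, im_ofReal_mul] at h1
        have h2 := le_chordPow hδ hδ1 hθ.1.le hθ.2
        have h3 : 0 < θ ^ δ := Real.rpow_pos_of_pos hθ.1 _
        exact (mul_eq_zero.1 h1).resolve_left (by linarith)
      tangent := by
        set t := cexp ((-(Real.pi * δ) : ℝ) * I) with ht
        have h0 : (0 : ℝ) ∈ Icc 0 Real.pi := ⟨le_rfl, hpi.le⟩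
        have htn : ‖t‖ = 1 := norm_exp_ofReal_mul_I _
        have hlin := real_linear_eq_of_apply_eq_zero htn tangent
        refine ⟨fderiv ℝ (fun w => g (0, w)) (E 1) (I * t), ?_, ?_⟩
        · intro hzero
          refine grad 0 h0 (ContinuousLinearMap.ext fun v => ?_)
          have := hlin v
          rw [hzero, zero_mul] at this
          simpa [zero_cpow (ofReal_ne_zero.2 hδ.ne')] using this
        · intro k
          have h1 := hlin (chordDir δ 0 * k)
          -- Since t = u(0)², the differential on the curve at the corner sees exactly the quantity
          -- that is zero on the lower arc.
          have h2 : (starRingEnd ℂ) t * (chordDir δ 0 * k) = (starRingEnd ℂ) (chordDir δ 0) * k := by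
            have hone : (starRingEnd ℂ) (chordDir δ 0) * chordDir δ 0 = 1 := by
              rw [mul_comm, mul_conj, normSq_eq_norm_sq, norm_chordDir]; simp
            rw [ht, ← chordDir_zero_sq, map_mul]
            linear_combination ((starRingEnd ℂ) (chordDir δ 0) * k) * hone
          rw [h2] at h1
          rw [hpoint0, ← h1, ← hGg 0 h0]
          simp }
  exact hCB.exists_norm_deriv_le hκ hc₁ (fun θ hθ => hmin hθ)

/-! Algebra of the Hölder spaces. -/

theorem inDiscAlgebra_const (a : ℂ) : InDiscAlgebra fun _ => a :=
  ⟨continuousOn_const, differentiableOn_const a⟩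

theorem InDiscAlgebra.add {f g : ℂ → ℂ} (hf : InDiscAlgebra f) (hg : InDiscAlgebra g) :
    InDiscAlgebra fun z => f z + g z := ⟨hf.1.add hg.1, hf.2.add hg.2⟩

theorem InDiscAlgebra.mul {f g : ℂ → ℂ} (hf : InDiscAlgebra f) (hg : InDiscAlgebra g) :
    InDiscAlgebra fun z => f z * g z := ⟨hf.1.mul hg.1, hf.2.mul hg.2⟩

theorem inHolderDiscAlgebra_const (β : ℝ) (a : ℂ) : InHolderDiscAlgebra β fun _ => a :=
  ⟨inDiscAlgebra_const a, 0, fun z _ w _ => by simp⟩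

theorem InHolderDiscAlgebra.add {β : ℝ} {f g : ℂ → ℂ} (hf : InHolderDiscAlgebra β f)
    (hg : InHolderDiscAlgebra β g) : InHolderDiscAlgebra β fun z => f z + g z := by
  obtain ⟨hf0, C₁, h₁⟩ := hf
  obtain ⟨hg0, C₂, h₂⟩ := hg
  refine ⟨hf0.add hg0, C₁ + C₂, fun z hz w hw => ?_⟩
  rw [add_sub_add_comm, add_mul]
  exact (norm_add_le _ _).trans (add_le_add (h₁ z hz w hw) (h₂ z hz w hw))

theorem InHolderDiscAlgebra.mul {β : ℝ} {f g : ℂ → ℂ} (hf : InHolderDiscAlgebra β f)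
    (hg : InHolderDiscAlgebra β g) : InHolderDiscAlgebra β fun z => f z * g z := by
  obtain ⟨hf0, C₁, h₁⟩ := hf
  obtain ⟨hg0, C₂, h₂⟩ := hg
  obtain ⟨M₁, hM₁⟩ := (isCompact_closedBall (0 : ℂ) 1).exists_bound_of_continuousOn hf0.1
  obtain ⟨M₂, hM₂⟩ := (isCompact_closedBall (0 : ℂ) 1).exists_bound_of_continuousOn hg0.1
  refine ⟨hf0.mul hg0, M₁ * C₂ + C₁ * M₂, fun z hz w hw => ?_⟩
  have e : f z * g z - f w * g w = f z * (g z - g w) + (f z - f w) * g w := by ring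
  rw [e]
  calc _ ≤ ‖f z‖ * ‖g z - g w‖ + ‖f z - f w‖ * ‖g w‖ := by
        rw [← norm_mul, ← norm_mul]; exact norm_add_le _ _
    _ ≤ M₁ * (C₂ * ‖z - w‖ ^ β) + (C₁ * ‖z - w‖ ^ β) * M₂ := by
        refine add_le_add (mul_le_mul (hM₁ z hz) (h₂ z hz w hw) (norm_nonneg _)
          ((norm_nonneg _).trans (hM₁ z hz))) (mul_le_mul (h₁ z hz w hw) (hM₂ w hw)
          (norm_nonneg _) ((norm_nonneg _).trans (h₁ z hz w hw)))
    _ = _ := by ring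

theorem InHolderDiscAlgebra.mono {α β : ℝ} {f : ℂ → ℂ} (hf : InHolderDiscAlgebra α f)
    (hβ : 0 < β) (hβα : β ≤ α) : InHolderDiscAlgebra β f := by
  obtain ⟨hf0, C, hC⟩ := hf
  refine ⟨hf0, |C| * 2 ^ (α - β), fun z hz w hw => ?_⟩
  rcases eq_or_ne z w with rfl | hne
  · simp [Real.zero_rpow hβ.ne']
  have ht : 0 < ‖z - w‖ := norm_pos_iff.2 (sub_ne_zero.2 hne)
  have ht2 : ‖z - w‖ ≤ 2 := by
    have h1 : ‖z‖ ≤ 1 := by simpa using hz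
    have h2 : ‖w‖ ≤ 1 := by simpa using hw
    linarith [norm_sub_le z w]
  have e : ‖z - w‖ ^ α = ‖z - w‖ ^ (α - β) * ‖z - w‖ ^ β := by
    rw [← Real.rpow_add ht]; ring_nf
  calc _ ≤ C * ‖z - w‖ ^ α := hC z hz w hw
    _ ≤ |C| * ‖z - w‖ ^ α := by gcongr; exact le_abs_self C
    _ = |C| * (‖z - w‖ ^ (α - β) * ‖z - w‖ ^ β) := by rw [e]
    _ ≤ |C| * (2 ^ (α - β) * ‖z - w‖ ^ β) := by gcongr
    _ = _ := by ring

theorem one_sub_norm_le {c z : ℂ} (hc : ‖c‖ = 1) : 1 - ‖z‖ ≤ ‖1 - c * z‖ := by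
  have := norm_sub_norm_le (1 : ℂ) (c * z)
  rwa [norm_one, norm_mul, hc, one_mul] at this

theorem hasDerivAt_one_sub_mul_cpow {c z : ℂ} (hc : ‖c‖ = 1) (hz : ‖z‖ < 1) (δ : ℝ) :
    HasDerivAt (fun z => (1 - c * z) ^ (δ : ℂ)) (δ * (1 - c * z) ^ ((δ : ℂ) - 1) * -c) z := by
  have h1 : HasDerivAt (fun z => 1 - c * z) (-c) z := by
    simpa using ((hasDerivAt_id z).const_mul c).const_sub 1
  exact h1.cpow_const (one_sub_mul_mem_slitPlane hc hz)

theorem norm_cpow_sub_one_of_mem {x : ℂ} (hx : x ∈ slitPlane) (δ : ℝ) :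
    ‖x ^ ((δ : ℂ) - 1)‖ = ‖x‖ ^ (δ - 1) := by
  have : ((δ : ℂ) - 1) = ((δ - 1 : ℝ) : ℂ) := by push_cast; ring
  rw [this, norm_cpow_of_ne_zero (slitPlane_ne_zero hx)]; simp

theorem inHolderDiscAlgebra_cpow {c : ℂ} {β δ : ℝ} (hc : ‖c‖ = 1) (hβ : 0 < β) (hβδ : β ≤ δ)
    (hδ1 : δ ≤ 1) : InHolderDiscAlgebra β (fun z => (1 - c * z) ^ (δ : ℂ)) := by
  refine InHolderDiscAlgebra.mono (α := δ) ?_ hβ hβδ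
  have hδ : 0 < δ := hβ.trans_le hβδ
  refine inHolderDiscAlgebra_of_deriv_le (inDiscAlgebra_cpow hc hδ) (C := δ) hδ hδ1 ?_
  intro z hz
  have hs := one_sub_mul_mem_slitPlane hc hz
  rw [(hasDerivAt_one_sub_mul_cpow hc hz δ).deriv, norm_mul, norm_mul, norm_neg, hc, mul_one,
    norm_cpow_sub_one_of_mem hs, norm_real, Real.norm_of_nonneg hδ.le]
  gcongr 1
  exact Real.rpow_le_rpow_of_nonpos (by linarith) (one_sub_norm_le hc) (by linarith)

/-- A power factor may be divided out in derivative bounds away from its zero. -/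
theorem norm_deriv_le_of_mul_cpow {κ : ℂ → ℂ} (hκ : InDiscAlgebra κ) {a c : ℂ} {δ M : ℝ}
    (ha : ‖a‖ = 1) (hc : ‖c‖ = 1) (hδ : 0 < δ) (hδ1 : δ ≤ 1)
    (hM : ∀ z ∈ Metric.closedBall (0 : ℂ) 1, ‖κ z‖ ≤ M) {z : ℂ} (hz : ‖z‖ < 1)
    (hcz : 1 ≤ ‖1 - c * z‖) :
    ‖deriv κ z‖ ≤ ‖deriv (fun z => a * (1 - c * z) ^ (δ : ℂ) * κ z) z‖ + M := by
  have hs := one_sub_mul_mem_slitPlane hc hz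
  have hd : DifferentiableAt ℂ κ z :=
    hκ.2.differentiableAt (Metric.isOpen_ball.mem_nhds (by simpa using hz))
  have h1 := ((hasDerivAt_one_sub_mul_cpow hc hz δ).const_mul a).mul hd.hasDerivAt
  have h1' : deriv (fun z => a * (1 - c * z) ^ (δ : ℂ) * κ z) z = _ := h1.deriv
  rw [h1']
  have h2 : ‖a * (1 - c * z) ^ (δ : ℂ)‖ = ‖1 - c * z‖ ^ δ := by
    rw [norm_mul, ha, one_mul, norm_cpow_of_ne_zero (slitPlane_ne_zero hs)]; simp
  have h3 : 1 ≤ ‖1 - c * z‖ ^ δ := Real.one_le_rpow hcz hδ.le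
  have h4 : ‖a * (δ * (1 - c * z) ^ ((δ : ℂ) - 1) * -c) * κ z‖ ≤ M := by
    rw [norm_mul, norm_mul, norm_mul, norm_mul, norm_neg, hc, ha,
      norm_cpow_sub_one_of_mem hs, norm_real, Real.norm_of_nonneg hδ.le, one_mul, mul_one]
    have h5 : ‖1 - c * z‖ ^ (δ - 1) ≤ 1 := Real.rpow_le_one_of_one_le_of_nonpos hcz (by linarith)
    have h6 := hM z (by simpa using hz.le)
    have h7 : δ * ‖1 - c * z‖ ^ (δ - 1) ≤ 1 := mul_le_one₀ hδ1 (by positivity) h5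
    calc _ ≤ 1 * ‖κ z‖ := by gcongr
      _ ≤ M := by rw [one_mul]; exact h6
  calc ‖deriv κ z‖ ≤ ‖1 - c * z‖ ^ δ * ‖deriv κ z‖ :=
        le_mul_of_one_le_left (norm_nonneg _) h3
    _ = ‖a * (1 - c * z) ^ (δ : ℂ) * deriv κ z‖ := by rw [norm_mul _ (deriv κ z), h2]
    _ = ‖(a * (δ * (1 - c * z) ^ ((δ : ℂ) - 1) * -c) * κ z + a * (1 - c * z) ^ (δ : ℂ) *
          deriv κ z) - a * (δ * (1 - c * z) ^ ((δ : ℂ) - 1) * -c) * κ z‖ := by ring_nf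
    _ ≤ _ := (norm_sub_le _ _).trans (add_le_add le_rfl h4)

/-! Reflection in the imaginary axis. -/

theorem InDiscAlgebra.reflect {F : ℂ → ℂ} (hF : InDiscAlgebra F) :
    InDiscAlgebra fun z => (starRingEnd ℂ) (F (-(starRingEnd ℂ) z)) := by
  constructor
  · refine continuous_conj.comp_continuousOn (hF.1.comp (by fun_prop) fun z hz => ?_)
    simpa using hz
  · intro z hz
    have h1 : DifferentiableAt ℂ (fun x => F (-x)) ((starRingEnd ℂ) z) := by
      have : DifferentiableAt ℂ F (-(starRingEnd ℂ) z) :=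
        hF.2.differentiableAt (Metric.isOpen_ball.mem_nhds (by simpa using hz))
      exact this.comp _ (by fun_prop)
    have h2 := h1.conj_conj
    rw [conj_conj] at h2
    exact h2.differentiableWithinAt

theorem norm_deriv_reflect {F : ℂ → ℂ} (hF : InDiscAlgebra F) {z : ℂ} (hz : ‖z‖ < 1) :
    ‖deriv (fun z => (starRingEnd ℂ) (F (-(starRingEnd ℂ) z))) (-(starRingEnd ℂ) z)‖ =
      ‖deriv F z‖ := by
  have hd : HasDerivAt F (deriv F z) z :=
    (hF.2.differentiableAt (Metric.isOpen_ball.mem_nhds (by simpa using hz))).hasDerivAt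
  have h1 : HasDerivAt (fun x => F (-x)) (-deriv F z) (-z) := by
    have h3 : HasDerivAt F (deriv F z) (-(-z)) := by rwa [neg_neg]
    exact (h3.comp (-z) (hasDerivAt_neg (-z))).congr_deriv (by simp)
  have h2 := h1.conj_conj
  rw [map_neg] at h2
  have h3 : deriv (fun z => (starRingEnd ℂ) (F (-(starRingEnd ℂ) z))) (-(starRingEnd ℂ) z) = _ :=
    h2.deriv
  rw [h3, norm_neg, norm_conj]

/-! The function `ψ`. -/

theorem inHolderDiscAlgebra_psi {Ψ : ℂ → ℂ} (hΨ : IsHalfDiscMap Ψ) :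
    InHolderDiscAlgebra (1 / 2) (psi Ψ) := by
  have h := hΨ.inHolder
  have h2 := ((inHolderDiscAlgebra_const (1 / 2) (1 / 2)).mul h).mul
    ((inHolderDiscAlgebra_const (1 / 2) 3).add
      ((inHolderDiscAlgebra_const (1 / 2) (-1)).mul (h.mul h)))
  have e : psi Ψ = fun z => 1 / 2 * Ψ z * (3 + -1 * (Ψ z * Ψ z)) := by
    funext z; rw [psi]; ring
  rwa [e]

/-- The cubic is critical at s = ±1, so its difference quotient is O(|x-s| + |y-s|); both this and
|x-y| are then estimated by the 1/2-Hölder bound for Ψ. -/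
theorem psi_sub_le {Ψ : ℂ → ℂ} (hΨ : IsHalfDiscMap Ψ) {s : ℂ} (hs : s * s = 1) (hsΨ : Ψ s = s) :
    ∃ C ≥ 0, ∀ ξ η : ℂ, ‖ξ‖ = 1 → ‖η‖ = 1 →
      ‖psi Ψ ξ - psi Ψ η‖ ≤ C * (√‖ξ - s‖ + √‖η - s‖) * √‖ξ - η‖ := by
  have hsn : ‖s‖ = 1 := by
    have : ‖s‖ * ‖s‖ = 1 := by rw [← norm_mul, hs, norm_one]
    nlinarith [norm_nonneg s]
  obtain ⟨hd, C₀, hC₀⟩ := hΨ.inHolder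
  obtain ⟨B, hB⟩ := (isCompact_closedBall (0 : ℂ) 1).exists_bound_of_continuousOn hd.1
  have hB0 : 0 ≤ B := (norm_nonneg _).trans (hB 0 (by simp))
  have hC : ∀ ξ η : ℂ, ‖ξ‖ = 1 → ‖η‖ = 1 → ‖Ψ ξ - Ψ η‖ ≤ |C₀| * √‖ξ - η‖ := by
    intro ξ η hξ hη
    have := hC₀ ξ (by simp [hξ]) η (by simp [hη])
    rw [← Real.sqrt_eq_rpow] at this
    refine this.trans ?_
    gcongr
    exact le_abs_self C₀
  refine ⟨|C₀| * (2 + 2 * B) * |C₀|, by positivity, fun ξ η hξ hη => ?_⟩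
  have h1 := hC ξ η hξ hη
  have h2 := hC ξ s hξ hsn
  have h3 := hC η s hη hsn
  rw [hsΨ] at h2 h3
  have b1 := hB ξ (by simp [hξ])
  have b2 := hB η (by simp [hη])
  set x := Ψ ξ with hx
  set y := Ψ η with hy
  -- The last factor is 3 - x² - xy - y², split as (s²-x²) + (s²-xy) + (s²-y²).
  have e1 : psi Ψ ξ - psi Ψ η = 1 / 2 * (x - y) *
      (-((s + x) * (x - s)) + (-(s * (y - s)) - y * (x - s)) - (s + y) * (y - s)) := by
    simp only [psi, ← hx, ← hy]
    linear_combination (-3 / 2 * (x - y)) * hs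
  have e2 : ‖-((s + x) * (x - s)) + (-(s * (y - s)) - y * (x - s)) - (s + y) * (y - s)‖ ≤
      (2 + 2 * B) * (‖x - s‖ + ‖y - s‖) := by
    have n1 : ‖s + x‖ ≤ 1 + B := (norm_add_le _ _).trans (by linarith)
    have n2 : ‖s + y‖ ≤ 1 + B := (norm_add_le _ _).trans (by linarith)
    calc _ ≤ ‖(s + x) * (x - s)‖ + (‖s * (y - s)‖ + ‖y * (x - s)‖) + ‖(s + y) * (y - s)‖ := by
          refine (norm_sub_le _ _).trans (add_le_add ((norm_add_le _ _).trans (add_le_add ?_ ?_))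
            le_rfl)
          · rw [norm_neg]
          · exact (norm_sub_le _ _).trans (by rw [norm_neg])
      _ ≤ (1 + B) * ‖x - s‖ + (1 * ‖y - s‖ + B * ‖x - s‖) + (1 + B) * ‖y - s‖ := by
          rw [norm_mul, norm_mul, norm_mul, norm_mul, hsn]
          gcongr
      _ ≤ _ := by nlinarith [norm_nonneg (x - s), norm_nonneg (y - s),
          mul_nonneg hB0 (norm_nonneg (y - s))]
  rw [e1, norm_mul, norm_mul]
  have hhalf : ‖(1 / 2 : ℂ)‖ ≤ 1 := by norm_num
  calc _ ≤ 1 * (|C₀| * √‖ξ - η‖) * ((2 + 2 * B) * (|C₀| * √‖ξ - s‖ + |C₀| * √‖η - s‖)) := by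
        gcongr
        exact e2.trans (by gcongr)
    _ = _ := by ring

theorem psi_one {Ψ : ℂ → ℂ} (hΨ : IsHalfDiscMap Ψ) : psi Ψ 1 = 1 := by
  rw [psi, hΨ.map_one]; norm_num

theorem psi_neg_one {Ψ : ℂ → ℂ} (hΨ : IsHalfDiscMap Ψ) : psi Ψ (-1) = -1 := by
  rw [psi, hΨ.map_neg_one]; norm_num

theorem psi_im_eq_zero {Ψ : ℂ → ℂ} (hΨ : IsHalfDiscMap Ψ) {ξ : ℂ} (hξ : ξ ∈ lowerArc) :
    (psi Ψ ξ).im = 0 := by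
  have : Ψ ξ ∈ ofReal '' Icc (-1 : ℝ) 1 := hΨ.image_lower ▸ mem_image_of_mem Ψ hξ
  obtain ⟨x, -, hx⟩ := this
  rw [psi, ← hx]
  have : (1 / 2 * (x : ℂ) * (3 - (x : ℂ) ^ 2)) = ((1 / 2 * x * (3 - x ^ 2) : ℝ) : ℂ) := by
    push_cast; ring
  rw [this, ofReal_im]

/-! Tangents and angles. -/

theorem fderiv_ne_zero_of_dbar_ne_zero {u : ℂ → ℝ} {w : ℂ} (h : dbar u w ≠ 0) :
    fderiv ℝ u w ≠ 0 := by
  intro h0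
  apply h
  rw [dbar, h0]; simp

theorem fderiv_apply_tangent_eq_zero {u : ℂ → ℝ} {γ : Set ℂ} (hγ : γ = {w | u w = 0}) {w τ : ℂ}
    (hu : fderiv ℝ u w ≠ 0) (hτ : IsPositiveTangent γ w τ) : fderiv ℝ u w τ = 0 := by
  obtain ⟨-, ⟨c, hc0, hcγ, hc⟩, -⟩ := hτ
  have hd : DifferentiableAt ℝ u w := by
    by_contra hcon
    exact hu (fderiv_zero_of_not_differentiableAt hcon)
  have hd' : HasFDerivAt u (fderiv ℝ u w) (c 0) := by rw [hc0]; exact hd.hasFDerivAt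
  have h1 := hd'.comp_hasDerivAt 0 hc
  have h2 : (u ∘ c) =ᶠ[𝓝 0] fun _ => (0 : ℝ) := by
    filter_upwards [hcγ] with t ht
    rw [hγ] at ht
    exact ht
  exact h1.unique ((hasDerivAt_const (0 : ℝ) (0 : ℝ)).congr_of_eventuallyEq h2)

/-- This explains the two cases of δ: e^{-iπ(1-b)} = -e^{iπb}, and e^{-iπ|b|} = e^{iπb} for b < 0.
Only the tangent line matters, so the sign is irrelevant. -/
theorem exp_delta_eq {b : ℝ} (hb : b ≠ 0) {τ : ℂ} (hτ : τ ≠ 0) (harg : arg τ = Real.pi * b) :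
    ∃ x : ℝ, cexp ((-(Real.pi * delta b) : ℝ) * I) = x • τ := by
  have hn : (‖τ‖ : ℂ) ≠ 0 := by exact_mod_cast norm_ne_zero_iff.2 hτ
  have hpolar : cexp ((Real.pi * b : ℝ) * I) = (‖τ‖⁻¹ : ℝ) • τ := by
    have := norm_mul_exp_arg_mul_I τ
    rw [harg] at this
    rw [real_smul, ofReal_inv, eq_inv_mul_iff_mul_eq₀ hn, this]
  rw [delta]
  split_ifs with hpos
  · refine ⟨-‖τ‖⁻¹, ?_⟩
    rw [neg_smul, ← hpolar]
    have : ((-(Real.pi * (1 - b)) : ℝ) : ℂ) * I = ((Real.pi * b : ℝ) : ℂ) * I - Real.pi * I := by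
      push_cast; ring
    rw [this, exp_sub, exp_pi_mul_I, div_neg, div_one]
  · refine ⟨‖τ‖⁻¹, ?_⟩
    rw [← hpolar, abs_of_neg (lt_of_le_of_ne (not_lt.1 hpos) hb)]
    congr 2; push_cast; ring

theorem delta_bounds {b β : ℝ} (h1 : β < |b|) (h2 : β < 1 - |b|) :
    β ≤ delta b ∧ β ≤ 1 - delta b := by
  rw [delta]
  split_ifs with hb
  · rw [abs_of_pos hb] at h1 h2
    constructor <;> linarith
  · constructor <;> linarith

/-- The interpolating function `w₁(1 + ψ)/2 + w₂(1 - ψ)/2`. -/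
noncomputable def interp (Ψ : ℂ → ℂ) (w₁ w₂ : ℝ) (ξ : ℂ) : ℂ :=
  (w₁ : ℂ) * ((1 + psi Ψ ξ) / 2) + (w₂ : ℂ) * ((1 - psi Ψ ξ) / 2)

theorem inHolderDiscAlgebra_interp {Ψ : ℂ → ℂ} (hΨ : IsHalfDiscMap Ψ) (w₁ w₂ : ℝ) :
    InHolderDiscAlgebra (1 / 2) (interp Ψ w₁ w₂) := by
  have h := (inHolderDiscAlgebra_const (1 / 2) ((w₁ + w₂ : ℂ) / 2)).add
    ((inHolderDiscAlgebra_const (1 / 2) ((w₁ - w₂ : ℂ) / 2)).mul (inHolderDiscAlgebra_psi hΨ))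
  have e : interp Ψ w₁ w₂ = fun z => (w₁ + w₂ : ℂ) / 2 + (w₁ - w₂ : ℂ) / 2 * psi Ψ z := by
    funext z; rw [interp]; ring
  rwa [e]

theorem interp_sub_le {Ψ : ℂ → ℂ} (hΨ : IsHalfDiscMap Ψ) (w₁ w₂ : ℝ) {s : ℂ} (hs : s * s = 1)
    (hsΨ : Ψ s = s) : ∃ C : ℝ, ∀ ξ η : ℂ, ‖ξ‖ = 1 → ‖η‖ = 1 →
      ‖interp Ψ w₁ w₂ ξ - interp Ψ w₁ w₂ η‖ ≤ C * (√‖ξ - s‖ + √‖η - s‖) * √‖ξ - η‖ := by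
  obtain ⟨C, -, h⟩ := psi_sub_le hΨ hs hsΨ
  refine ⟨‖(w₁ - w₂ : ℂ) / 2‖ * C, fun ξ η hξ hη => ?_⟩
  have e : interp Ψ w₁ w₂ ξ - interp Ψ w₁ w₂ η = (w₁ - w₂ : ℂ) / 2 * (psi Ψ ξ - psi Ψ η) := by
    rw [interp, interp]; ring
  rw [e, norm_mul, mul_assoc, mul_assoc, ← mul_assoc C]
  exact mul_le_mul_of_nonneg_left (h ξ η hξ hη) (norm_nonneg _)

theorem interp_im_eq_zero {Ψ : ℂ → ℂ} (hΨ : IsHalfDiscMap Ψ) (w₁ w₂ : ℝ) {ξ : ℂ}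
    (hξ : ξ ∈ lowerArc) : (interp Ψ w₁ w₂ ξ).im = 0 := by
  have h : psi Ψ ξ = ((psi Ψ ξ).re : ℂ) :=
    Complex.ext (by simp) (by simpa using psi_im_eq_zero hΨ hξ)
  rw [interp, h]
  have : (w₁ : ℂ) * ((1 + ((psi Ψ ξ).re : ℂ)) / 2) + (w₂ : ℂ) * ((1 - ((psi Ψ ξ).re : ℂ)) / 2) =
      ((w₁ * ((1 + (psi Ψ ξ).re) / 2) + w₂ * ((1 - (psi Ψ ξ).re) / 2) : ℝ) : ℂ) := by
    push_cast; ring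
  rw [this, ofReal_im]

theorem interp_one {Ψ : ℂ → ℂ} (hΨ : IsHalfDiscMap Ψ) (w₁ w₂ : ℝ) : interp Ψ w₁ w₂ 1 = w₁ := by
  rw [interp, psi_one hΨ]; norm_num

theorem interp_neg_one {Ψ : ℂ → ℂ} (hΨ : IsHalfDiscMap Ψ) (w₁ w₂ : ℝ) :
    interp Ψ w₁ w₂ (-1) = w₂ := by
  rw [interp, psi_neg_one hΨ]; norm_num

/-! ### The two corners of the boundary value problem -/

theorem exp_mem_upperArc {θ : ℝ} (hθ : θ ∈ Icc 0 Real.pi) : cexp (θ * I) ∈ upperArc := by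
  refine ⟨norm_exp_ofReal_mul_I θ, ?_⟩
  rw [exp_ofReal_mul_I_im]
  exact Real.sin_nonneg_of_nonneg_of_le_pi hθ.1 hθ.2

theorem IsDefiningFunction.contDiffOn_two {k : ℕ} (hk : 3 ≤ k) {γ : ℂ → Set ℂ} {ρ : ℂ → ℂ → ℝ}
    (hρ : IsDefiningFunction k γ ρ) :
    ContDiffOn ℝ 2 (fun p : ℝ × ℂ => ρ (cexp ((p.1 : ℂ) * I)) p.2) (Icc 0 Real.pi ×ˢ univ) :=
  hρ.contDiffOn.of_le (by exact_mod_cast (by omega : 2 ≤ k))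

theorem IsDefiningFunction.fderiv_ne_zero {k : ℕ} {γ : ℂ → Set ℂ} {ρ : ℂ → ℂ → ℝ}
    (hρ : IsDefiningFunction k γ ρ) {ξ w : ℂ} (hξ : ξ ∈ upperArc) (hw : w ∈ γ ξ) :
    fderiv ℝ (ρ ξ) w ≠ 0 :=
  fderiv_ne_zero_of_dbar_ne_zero (hρ.dbar_ne_zero ξ hξ w hw)

theorem IsDefiningFunction.eq_zero {k : ℕ} {γ : ℂ → Set ℂ} {ρ : ℂ → ℂ → ℝ}
    (hρ : IsDefiningFunction k γ ρ) {ξ w : ℂ} (hξ : ξ ∈ upperArc) (hw : w ∈ γ ξ) :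
    ρ ξ w = 0 := by
  rw [hρ.curve_eq ξ hξ] at hw; exact hw

/-- Derivative bound near the corner `1`. -/
theorem exists_norm_deriv_le_at_one {k : ℕ} (hk : 3 ≤ k) {γ : ℂ → Set ℂ} {ρ : ℂ → ℂ → ℝ}
    (hρ : IsDefiningFunction k γ ρ) {w₁ w₂ : ℝ} (hw₁ : (w₁ : ℂ) ∈ γ 1) {b β : ℝ} (hb : b ≠ 0)
    {τ : ℂ} (hτ : IsPositiveTangent (γ 1) (w₁ : ℂ) τ) (hangle : orientedAngle 1 τ = Real.pi * b)
    (hβ : 0 < β) (hβ1 : β < |b|) (hβ2 : β < 1 - |b|) {Ψ : ℂ → ℂ} (hΨ : IsHalfDiscMap Ψ)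
    {f κ : ℂ → ℂ} (hf : IsSolution γ f) (hκ : InDiscAlgebra κ)
    (hform : ∀ ξ ∈ Metric.closedBall (0 : ℂ) 1,
      f ξ = interp Ψ w₁ w₂ ξ + (1 - ξ) ^ (delta b : ℂ) * κ ξ) :
    ∃ C ≥ 0, ∀ z : ℂ, ‖z‖ < 1 → 0 ≤ z.re → ‖deriv κ z‖ ≤ C * (1 - ‖z‖) ^ (β - 1) := by
  obtain ⟨hd1, hd2⟩ := delta_bounds hβ1 hβ2
  have hfc : ∀ ξ : ℂ, ‖ξ‖ = 1 → interp Ψ w₁ w₂ ξ + (1 - ξ) ^ (delta b : ℂ) * κ ξ = f ξ :=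
    fun ξ hξ => (hform ξ (by simp [hξ])).symm
  have hone : (1 : ℂ) ∈ upperArc := by simp [upperArc]
  refine exists_norm_deriv_le_of_corner (E := interp Ψ w₁ w₂) hβ (by linarith) hd1 hd2
    (hρ.contDiffOn_two hk) hκ (inHolderDiscAlgebra_interp hΨ w₁ w₂).1.1
    (interp_sub_le hΨ w₁ w₂ (by norm_num) hΨ.map_one) ?_ ?_ ?_ ?_
  · intro ξ hξ
    have h1 := hfc ξ hξ.1
    have h2 : (1 - ξ) ^ (delta b : ℂ) * κ ξ = f ξ - interp Ψ w₁ w₂ ξ := by rw [← h1]; ring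
    rw [h2, sub_im, hf.on_lower ξ hξ, interp_im_eq_zero hΨ w₁ w₂ hξ, sub_zero]
  · intro θ hθ
    rw [hfc _ (norm_exp_ofReal_mul_I θ)]
    exact hρ.eq_zero (exp_mem_upperArc hθ) (hf.on_upper _ (exp_mem_upperArc hθ))
  · intro θ hθ
    rw [hfc _ (norm_exp_ofReal_mul_I θ)]
    exact hρ.fderiv_ne_zero (exp_mem_upperArc hθ) (hf.on_upper _ (exp_mem_upperArc hθ))
  · have h1 := fderiv_apply_tangent_eq_zero (hρ.curve_eq 1 hone) (hρ.fderiv_ne_zero hone hw₁) hτ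
    rw [orientedAngle, div_one] at hangle
    obtain ⟨x, hx⟩ := exp_delta_eq hb hτ.1 hangle
    rw [interp_one hΨ, hx, map_smul]
    simp only [ofReal_zero, zero_mul, Complex.exp_zero]
    rw [h1, smul_zero]

theorem neg_conj_mem_lowerArc {ξ : ℂ} (hξ : ξ ∈ lowerArc) :
    -(starRingEnd ℂ) ξ ∈ lowerArc := by
  refine ⟨by rw [norm_neg, norm_conj]; exact hξ.1, ?_⟩
  simpa using hξ.2

theorem neg_conj_exp (θ : ℝ) :
    -(starRingEnd ℂ) (cexp (θ * I)) = cexp ((Real.pi - θ : ℝ) * I) := by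
  rw [← exp_conj, map_mul, conj_ofReal, conj_I, ofReal_sub, sub_mul, exp_sub, exp_pi_mul_I,
    mul_neg, exp_neg]
  ring

theorem fderiv_comp_conj (u : ℂ → ℝ) (w v : ℂ) :
    fderiv ℝ (fun x => u ((starRingEnd ℂ) x)) w v =
      fderiv ℝ u ((starRingEnd ℂ) w) ((starRingEnd ℂ) v) := by
  have := conjCLE.comp_right_fderiv (f := u) (x := w)
  have h2 : fderiv ℝ (fun x => u ((starRingEnd ℂ) x)) w =
    (fderiv ℝ u (conjCLE w)).comp (conjCLE : ℂ →L[ℝ] ℂ) := this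
  rw [h2]; rfl

/-- Derivative bound near the corner `-1`. -/
theorem exists_norm_deriv_le_at_neg_one {k : ℕ} (hk : 3 ≤ k) {γ : ℂ → Set ℂ} {ρ : ℂ → ℂ → ℝ}
    (hρ : IsDefiningFunction k γ ρ) {w₁ w₂ : ℝ} (hw₂ : (w₂ : ℂ) ∈ γ (-1)) {b β : ℝ} (hb : b ≠ 0)
    {τ : ℂ} (hτ : IsPositiveTangent (γ (-1)) (w₂ : ℂ) τ)
    (hangle : orientedAngle τ 1 = Real.pi * b)
    (hβ : 0 < β) (hβ1 : β < |b|) (hβ2 : β < 1 - |b|) {Ψ : ℂ → ℂ} (hΨ : IsHalfDiscMap Ψ)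
    {f κ : ℂ → ℂ} (hf : IsSolution γ f) (hκ : InDiscAlgebra κ)
    (hform : ∀ ξ ∈ Metric.closedBall (0 : ℂ) 1,
      f ξ = interp Ψ w₁ w₂ ξ + (1 + ξ) ^ (delta b : ℂ) * κ ξ) :
    ∃ C ≥ 0, ∀ z : ℂ, ‖z‖ < 1 → z.re ≤ 0 → ‖deriv κ z‖ ≤ C * (1 - ‖z‖) ^ (β - 1) := by
  obtain ⟨hd1, hd2⟩ := delta_bounds hβ1 hβ2
  -- The reflection z ↦ -z̄, with conjugated values, carries -1 to 1, preserves both arcs and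
  -- replaces θ by π - θ.
  set κ' : ℂ → ℂ := fun z => (starRingEnd ℂ) (κ (-(starRingEnd ℂ) z)) with hκ'
  set E' : ℂ → ℂ := fun z => (starRingEnd ℂ) (interp Ψ w₁ w₂ (-(starRingEnd ℂ) z)) with hE'
  have hfc : ∀ ξ : ℂ, ‖ξ‖ = 1 → E' ξ + (1 - ξ) ^ (delta b : ℂ) * κ' ξ =
      (starRingEnd ℂ) (f (-(starRingEnd ℂ) ξ)) := by
    intro ξ hξ
    have harg : (1 - ξ).arg ≠ Real.pi := by
      intro hh
      have h1 : (1 - ξ).re < 0 := (arg_eq_pi_iff.1 hh).1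
      have h2 := re_one_sub_mul_nonneg (c := 1) norm_one hξ.le
      rw [one_mul] at h2
      linarith
    have hconj : (starRingEnd ℂ) ((1 + -(starRingEnd ℂ) ξ) ^ (delta b : ℂ)) =
        (1 - ξ) ^ (delta b : ℂ) := by
      have : 1 + -(starRingEnd ℂ) ξ = (starRingEnd ℂ) (1 - ξ) := by
        rw [map_sub, map_one]; ring
      rw [this, conj_cpow _ _ harg, conj_conj, conj_ofReal]
    rw [hform (-(starRingEnd ℂ) ξ) (by simp [hξ]), map_add, map_mul, hconj]
  have hmone : (-1 : ℂ) ∈ upperArc := by simp [upperArc]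
  have hpi := Real.pi_pos
  have hrefl : ∀ θ ∈ Icc 0 Real.pi, Real.pi - θ ∈ Icc 0 Real.pi :=
    fun θ hθ => ⟨by linarith [hθ.2], by linarith [hθ.1]⟩
  have hg : ContDiffOn ℝ 2 (fun p : ℝ × ℂ => ρ (cexp (((Real.pi - p.1 : ℝ) : ℂ) * I))
      ((starRingEnd ℂ) p.2)) (Icc 0 Real.pi ×ˢ univ) := by
    have hmap : ContDiff ℝ 2 fun p : ℝ × ℂ => (Real.pi - p.1, (starRingEnd ℂ) p.2) :=
      (contDiff_const.sub contDiff_fst).prodMk (conjCLE.contDiff.comp contDiff_snd)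
    exact (hρ.contDiffOn_two hk).comp hmap.contDiffOn
      (fun p hp => ⟨hrefl _ hp.1, mem_univ _⟩)
  obtain ⟨C, hC0, hC⟩ := exists_norm_deriv_le_of_corner (β := β) (δ := delta b) (E := E') (κ := κ')
    hβ (by linarith) hd1 hd2 hg hκ.reflect (inHolderDiscAlgebra_interp hΨ w₁ w₂).1.reflect.1
    (by
      obtain ⟨C, h⟩ := interp_sub_le hΨ w₁ w₂ (s := -1) (by norm_num) hΨ.map_neg_one
      refine ⟨C, fun ξ η hξ hη => ?_⟩
      have h1 := h (-(starRingEnd ℂ) ξ) (-(starRingEnd ℂ) η) (by simpa using hξ) (by simpa using hη)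
      have e1 : ∀ x : ℂ, ‖-(starRingEnd ℂ) x - -1‖ = ‖x - 1‖ := by
        intro x
        rw [← norm_conj (x - 1), ← norm_neg, map_sub, map_one]; congr 1; ring
      have e2 : ‖-(starRingEnd ℂ) ξ - -(starRingEnd ℂ) η‖ = ‖ξ - η‖ := by
        rw [← norm_conj (ξ - η), ← norm_neg, map_sub]; congr 1; ring
      rw [e1, e1, e2] at h1
      simp only [hE']
      rw [← map_sub, norm_conj]
      exact h1)
    (by
      intro ξ hξ
      have h1 := hfc ξ hξ.1
      have hξ' := neg_conj_mem_lowerArc hξ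
      have h2 : (1 - ξ) ^ (delta b : ℂ) * κ' ξ =
          (starRingEnd ℂ) (f (-(starRingEnd ℂ) ξ)) - E' ξ := by rw [← h1]; ring
      rw [h2, sub_im, conj_im, hf.on_lower _ hξ']
      simp only [hE', conj_im, interp_im_eq_zero hΨ w₁ w₂ hξ', neg_zero, sub_zero])
    (by
      intro θ hθ
      rw [hfc _ (norm_exp_ofReal_mul_I θ), neg_conj_exp]
      simp only [conj_conj]
      exact hρ.eq_zero (exp_mem_upperArc (hrefl θ hθ)) (hf.on_upper _ (exp_mem_upperArc (hrefl θ hθ))))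
    (by
      intro θ hθ h0
      rw [hfc _ (norm_exp_ofReal_mul_I θ), neg_conj_exp] at h0
      refine hρ.fderiv_ne_zero (exp_mem_upperArc (hrefl θ hθ))
        (hf.on_upper _ (exp_mem_upperArc (hrefl θ hθ))) (ContinuousLinearMap.ext fun v => ?_)
      have h1 := fderiv_comp_conj (ρ (cexp ((Real.pi - θ : ℝ) * I)))
        ((starRingEnd ℂ) (f (cexp ((Real.pi - θ : ℝ) * I)))) ((starRingEnd ℂ) v)
      rw [conj_conj, conj_conj] at h1
      rw [← h1, h0]; rfl)
    (by
      have h1 := fderiv_apply_tangent_eq_zero (hρ.curve_eq (-1) hmone)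
        (hρ.fderiv_ne_zero hmone hw₂) hτ
      rw [orientedAngle, one_div] at hangle
      obtain ⟨x, hx⟩ := exp_delta_eq hb (inv_ne_zero hτ.1) hangle
      have hE1 : E' 1 = w₂ := by
        simp only [hE', map_one, interp_neg_one hΨ, conj_ofReal]
      have hexp : cexp (((Real.pi - 0 : ℝ) : ℂ) * I) = -1 := by rw [sub_zero, exp_pi_mul_I]
      have h2 := fderiv_comp_conj (ρ (cexp (((Real.pi - 0 : ℝ) : ℂ) * I))) (E' 1)
        (cexp ((-(Real.pi * delta b) : ℝ) * I))
      refine h2.trans ?_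
      -- The angle at -1 is measured from the tangent to the real axis, so it is the argument of
      -- τ⁻¹; conjugation of values turns τ⁻¹ back into a real multiple of τ.
      have h3 : (starRingEnd ℂ) (x • τ⁻¹) = (x * (normSq τ)⁻¹) • τ := by
        rw [real_smul, map_mul, conj_ofReal, Complex.inv_def, map_mul, conj_conj, conj_ofReal,
          real_smul, ofReal_mul]
        ring
      rw [hE1, hexp, conj_ofReal, hx, h3, map_smul, h1, smul_zero])
  refine ⟨C, hC0, fun z hz hre => ?_⟩
  have h1 := hC (-(starRingEnd ℂ) z) (by simpa using hz) (by simpa using hre)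
  rw [hκ', norm_deriv_reflect hκ hz, norm_neg, norm_conj] at h1
  exact h1

end Cherepanov

/-! ### Assembly of the two corner estimates -/

theorem proposition1 (k : ℕ) (hk : 3 ≤ k)
    (γ : ℂ → Set ℂ) (hγ : Cherepanov.IsJordanFamily k γ)
    (w₁ w₂ : ℝ) (hw₁ : (w₁ : ℂ) ∈ γ 1) (hw₂ : (w₂ : ℂ) ∈ γ (-1))
    (β₁ β₂ : ℝ) (hβ₁ : β₁ ∈ Set.Ioo (-1 : ℝ) 1 \ {0}) (hβ₂ : β₂ ∈ Set.Ioo (-1 : ℝ) 1 \ {0})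
    -- `w₂`, `β₂` and `τ₂` belong to the point `-1`
    (τ₁ τ₂ : ℂ) (hτ₁ : Cherepanov.IsPositiveTangent (γ 1) (w₁ : ℂ) τ₁)
    (hτ₂ : Cherepanov.IsPositiveTangent (γ (-1)) (w₂ : ℂ) τ₂)
    (hangle₁ : Cherepanov.orientedAngle 1 τ₁ = Real.pi * β₁)
    (hangle₂ : Cherepanov.orientedAngle τ₂ 1 = Real.pi * β₂)
    (β : ℝ) (hβ_pos : 0 < β)
    (hβ_lt : β < min (min |β₁| (1 - |β₁|)) (min |β₂| (1 - |β₂|)))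
    (Ψ : ℂ → ℂ) (hΨ : Cherepanov.IsHalfDiscMap Ψ)
    (f κ : ℂ → ℂ) (hf : Cherepanov.IsSolution γ f) (hκ : Cherepanov.InDiscAlgebra κ)
    (hform : ∀ ξ ∈ Metric.closedBall (0 : ℂ) 1,
      f ξ = Cherepanov.powSubOne (Cherepanov.delta β₁) ξ *
            Cherepanov.powAddOne (Cherepanov.delta β₂) ξ * κ ξ
          + (w₁ : ℂ) * ((1 + Cherepanov.psi Ψ ξ) / 2)
          + (w₂ : ℂ) * ((1 - Cherepanov.psi Ψ ξ) / 2)) :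
    Cherepanov.InHolderDiscAlgebra β f ∧ Cherepanov.InHolderDiscAlgebra β κ := by
  open Cherepanov in
  obtain ⟨-, ρ, hρ⟩ := hγ
  simp only [lt_min_iff] at hβ_lt
  obtain ⟨⟨hb1, hb1'⟩, hb2, hb2'⟩ := hβ_lt
  obtain ⟨hd1, hd1'⟩ := delta_bounds hb1 hb1'
  obtain ⟨hd2, hd2'⟩ := delta_bounds hb2 hb2'
  have hδ1 : 0 < delta β₁ := by linarith
  have hδ2 : 0 < delta β₂ := by linarith
  have hβ1 : β ≤ 1 := by linarith
  set a : ℂ := cexp ((Real.pi : ℂ) * I * (delta β₁ : ℂ)) with ha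
  have han : ‖a‖ = 1 := by
    have : (Real.pi : ℂ) * I * (delta β₁ : ℂ) = ((Real.pi * delta β₁ : ℝ) : ℂ) * I := by
      push_cast; ring
    rw [ha, this, norm_exp_ofReal_mul_I]
  have hm1 : ‖(-1 : ℂ)‖ = 1 := by simp
  have hA := inDiscAlgebra_cpow (c := 1) norm_one hδ1
  have hB := inDiscAlgebra_cpow (c := -1) hm1 hδ2
  -- Each corner is treated with the other power and the unimodular constant a absorbed into κ. The
  -- absorbed power has base of modulus at least 1 on the relevant half-disc, so it can be divided
  -- out of the derivative bound at the cost of M.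
  set κ₁ : ℂ → ℂ := fun z => a * (1 - -1 * z) ^ (delta β₂ : ℂ) * κ z with hκ₁
  set κ₂ : ℂ → ℂ := fun z => a * (1 - 1 * z) ^ (delta β₁ : ℂ) * κ z with hκ₂
  obtain ⟨C₁, hC₁, h₁⟩ := exists_norm_deriv_le_at_one hk hρ (w₂ := w₂) hw₁ (b := β₁)
    (fun h => hβ₁.2 h) hτ₁ hangle₁ hβ_pos hb1 hb1' hΨ hf (κ := κ₁)
    (((inDiscAlgebra_const a).mul hB).mul hκ) (by
      intro ξ hξ
      have e : 1 - -1 * ξ = ξ + 1 := by ring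
      rw [hform ξ hξ, powSubOne, powAddOne, interp, hκ₁, ← ha]
      simp only [e]; ring)
  obtain ⟨C₂, hC₂, h₂⟩ := exists_norm_deriv_le_at_neg_one hk hρ (w₁ := w₁) hw₂ (b := β₂)
    (fun h => hβ₂.2 h) hτ₂ hangle₂ hβ_pos hb2 hb2' hΨ hf (κ := κ₂)
    (((inDiscAlgebra_const a).mul hA).mul hκ) (by
      intro ξ hξ
      have e : 1 + ξ = ξ + 1 := by ring
      rw [hform ξ hξ, powSubOne, powAddOne, interp, hκ₂, ← ha]
      simp only [one_mul, e]; ring)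
  obtain ⟨M, hM⟩ := (isCompact_closedBall (0 : ℂ) 1).exists_bound_of_continuousOn hκ.1
  have hM0 : 0 ≤ M := (norm_nonneg _).trans (hM 0 (by simp))
  have hκβ : InHolderDiscAlgebra β κ := by
    refine inHolderDiscAlgebra_of_deriv_le hκ (C := C₁ + C₂ + M) hβ_pos hβ1 (fun z hz => ?_)
    have hp : 1 ≤ (1 - ‖z‖) ^ (β - 1) :=
      Real.one_le_rpow_of_pos_of_le_one_of_nonpos (by linarith) (by linarith [norm_nonneg z])
        (by linarith)
    have e : (C₁ + C₂ + M) * (1 - ‖z‖) ^ (β - 1) = C₁ * (1 - ‖z‖) ^ (β - 1) +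
      C₂ * (1 - ‖z‖) ^ (β - 1) + M * (1 - ‖z‖) ^ (β - 1) := by ring
    have p₁ : 0 ≤ C₁ * (1 - ‖z‖) ^ (β - 1) := by positivity
    have p₂ : 0 ≤ C₂ * (1 - ‖z‖) ^ (β - 1) := by positivity
    have p₃ : M ≤ M * (1 - ‖z‖) ^ (β - 1) := le_mul_of_one_le_right hM0 hp
    rw [e]
    rcases le_total 0 z.re with hre | hre
    · have h3 : 1 ≤ ‖1 - -1 * z‖ := by
        refine le_trans ?_ (re_le_norm _)
        simp [hre]
      linarith [norm_deriv_le_of_mul_cpow hκ han hm1 hδ2 (by linarith) hM hz h3, h₁ z hz hre]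
    · have h3 : 1 ≤ ‖1 - 1 * z‖ := by
        refine le_trans ?_ (re_le_norm _)
        simp [hre]
      linarith [norm_deriv_le_of_mul_cpow hκ han norm_one hδ1 (by linarith) hM hz h3, h₂ z hz hre]
  refine ⟨⟨hf.inDiscAlgebra, ?_⟩, hκβ⟩
  have hall := ((((inHolderDiscAlgebra_const β a).mul (inHolderDiscAlgebra_cpow (c := 1) norm_one
    hβ_pos hd1 (by linarith))).mul (inHolderDiscAlgebra_cpow (c := -1) hm1
    hβ_pos hd2 (by linarith))).mul hκβ).add
    ((inHolderDiscAlgebra_interp hΨ w₁ w₂).mono hβ_pos (by linarith))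
  obtain ⟨-, C, hC⟩ := hall
  have hfe : ∀ ξ ∈ Metric.closedBall (0 : ℂ) 1, f ξ = a * (1 - 1 * ξ) ^ (delta β₁ : ℂ) *
      (1 - -1 * ξ) ^ (delta β₂ : ℂ) * κ ξ + interp Ψ w₁ w₂ ξ := by
    intro ξ hξ
    have e : 1 - -1 * ξ = ξ + 1 := by ring
    rw [hform ξ hξ, powSubOne, powAddOne, interp, e, one_mul, add_assoc]
  refine ⟨C, fun z hz w hw => ?_⟩
  rw [hfe z hz, hfe w hw]
  exact hC z hz w hw
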